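/- Let $X$ be a compact Kähler manifold of dimension $n$, let $\omega$ be a Kähler form on $X$, let $L$ be a holomorphic line bundle on $X$, and let $s$ be a holomorphic section of $L$ whose zero divisor $D=(s=0)$ is smooth and reduced (so $L\simeq\mathcal O_X(D)$). For a smooth Hermitian metric $h=|\cdot|$ on $L$ with $|s|^2<e^{-1}$ on $X$ and for $\beta\in(0,1)$ put, on $X\setminus D$, $$\omega_\beta:=\omega-dd^c\log\Big[\frac{1-|s|^{2\beta}}{\beta}\Big]^2 ,$$ where $dd^c=\kappa\, i\partial\bar\partial$ for a fixed normalization constant $\kappa>0$. The metric $h$ is taken suitably rescaled, so that $\omega_\beta$ is a positive form on $X\setminus D$ with $\omega_\beta\ge\frac12\omega$. Precisely: 1. For every smooth Hermitian metric $h$ on $L$ there is $c_0>0$ such that for every $c\in(0,c_0]$ the metric with squared norm $c\,|\cdot|_h^2$ satisfies $c\,|s|_h^2<e^{-1}$ on $X$, and the forms $\omega_\beta$ it defines satisfy $\omega_\beta\ge\frac12\omega$ on $X\setminus D$ for all $\beta\in(0,1)$. 2. If $h$ satisfies $|s|_h^2<e^{-1}$ on $X$ and $\omega_\beta\ge\frac12\omega$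 on $X\setminus D$ for all $\beta\in(0,\frac12]$, then there is a constant $C>0$, depending only on the fixed data $(X,\omega,L,s,h)$ (and on $\kappa$) and not on $\beta$, such that for all $\beta\in(0,\frac12]$ the holomorphic bisectional curvature of $\omega_\beta$ on $X\setminus D$ is bounded by $C$ in absolute value. That is, at every point of $X\setminus D$, in holomorphic coordinates in which $\omega_\beta=i\sum g_{i\bar j}\,dz_i\wedge d\bar z_j$, and with $$R_{i\bar jk\bar l}=-\frac{\partial^2 g_{i\bar j}}{\partial z_k\partial\bar z_l}+\sum_{a,b}g^{a\bar b}\frac{\partial g_{i\bar b}}{\partial z_k}\frac{\partial g_{a\bar j}}{\partial\bar z_l},$$ one has $\big|\sum R_{i\bar jk\bar l}\,u_i\bar u_jv_k\bar v_l\big|\le C$ for all tangent vectors $u,v$ with $|u|_{\omega_\beta}=|v|_{\omega_\beta}=1$. -/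

import Mathlib

open scoped Manifold ContDiff ComplexConjugate

namespace ConicMetric

noncomputable section

/-- The Wirtinger derivative `∂f/∂z_j` of a (not necessarily holomorphic) function on `ℂⁿ`. -/
def dz {n : ℕ} (j : Fin n) (f : (Fin n → ℂ) → ℂ) (z : Fin n → ℂ) : ℂ :=
  (1 / 2) * (fderiv ℝ f z (Pi.single j 1) - Complex.I * fderiv ℝ f z (Pi.single j Complex.I))

/-- The Wirtinger derivative `∂f/∂z̄_j`. -/
def dzbar {n : ℕ} (j : Fin n) (f : (Fin n → ℂ) → ℂ) (z : Fin n → ℂ) : ℂ :=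
  (1 / 2) * (fderiv ℝ f z (Pi.single j 1) + Complex.I * fderiv ℝ f z (Pi.single j Complex.I))

/-- `g(u, ū) = ∑ g_{j k̄} u_j ū_k`, the squared norm of `u = ∑ u_j ∂/∂z_j` with respect to the
Hermitian matrix `g` (the real part is taken only to land in `ℝ`). -/
def sqNorm {n : ℕ} (g : Matrix (Fin n) (Fin n) ℂ) (u : Fin n → ℂ) : ℝ :=
  (∑ j, ∑ k, g j k * u j * conj (u k)).re

/-- The curvature tensor of the Kähler metric with coefficients `g_{i j̄}` (where
`ω = i ∑ g_{i j̄} dz_i ∧ dz̄_j`):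
`R_{i j̄ k l̄} = - ∂²g_{i j̄}/∂z_k∂z̄_l + ∑_{a,b} g^{a b̄} (∂g_{i b̄}/∂z_k) (∂g_{a j̄}/∂z̄_l)`,
with `∑_b g^{a b̄} g_{c b̄} = δ_{a c}`, that is `g^{a b̄} = (g⁻¹)_{b a}`. -/
def curvature {n : ℕ} (g : (Fin n → ℂ) → Matrix (Fin n) (Fin n) ℂ) (z : Fin n → ℂ)
    (i j k l : Fin n) : ℂ :=
  - dz k (dzbar l (fun w => g w i j)) z
    + ∑ a, ∑ b, (g z)⁻¹ b a * dz k (fun w => g w i b) z * dzbar l (fun w => g w a j) z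

/-- `R(u, ū, v, v̄) = ∑ R_{i j̄ k l̄} u_i ū_j v_k v̄_l`; for `u` and `v` of norm one this is the
holomorphic bisectional curvature in the directions `u`, `v`. -/
def bisectional {n : ℕ} (g : (Fin n → ℂ) → Matrix (Fin n) (Fin n) ℂ) (z : Fin n → ℂ)
    (u v : Fin n → ℂ) : ℂ :=
  ∑ i, ∑ j, ∑ k, ∑ l, curvature g z i j k l * u i * conj (u j) * v k * conj (v l)

section Manifold

variable {n : ℕ} {X : Type*} [TopologicalSpace X] [ChartedSpace (Fin n → ℂ) X]

/-- The coordinate vector field `∂/∂z_j` of the chart `e`, at the point with coordinates `z`. -/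
def coordVector (e : OpenPartialHomeomorph X (Fin n → ℂ)) (z : Fin n → ℂ) (j : Fin n) :
    TangentSpace 𝓘(ℂ, Fin n → ℂ) (e.symm z) :=
  mfderiv 𝓘(ℂ, Fin n → ℂ) 𝓘(ℂ, Fin n → ℂ) e.symm z
    (Pi.single j 1 : Fin n → ℂ)

/-- The coefficients `g_{j k̄}` in the chart `e` of a family of sesquilinear forms on the
holomorphic tangent spaces of `X`. -/
def coeff (H : ∀ x : X, TangentSpace 𝓘(ℂ, Fin n → ℂ) x →ₗ[ℂ]
      TangentSpace 𝓘(ℂ, Fin n → ℂ) x →ₗ⋆[ℂ] ℂ)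
    (e : OpenPartialHomeomorph X (Fin n → ℂ)) (z : Fin n → ℂ) : Matrix (Fin n) (Fin n) ℂ :=
  Matrix.of fun j k => H (e.symm z) (coordVector e z j) (coordVector e z k)

variable (n X) in
/-- A Kähler form on the complex manifold `X`, given by its Hermitian metric: a smooth family of
positive definite Hermitian forms on the tangent spaces such that the associated `(1,1)`-form
`i ∑ g_{j k̄} dz_j ∧ dz̄_k` is closed. -/
structure KahlerForm where
  /-- the Hermitian form, linear in the first and conjugate linear in the second argument -/
  form : ∀ x : X, TangentSpace 𝓘(ℂ, Fin n → ℂ) x →ₗ[ℂ]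
    TangentSpace 𝓘(ℂ, Fin n → ℂ) x →ₗ⋆[ℂ] ℂ
  conj_symm : ∀ x u v, conj (form x u v) = form x v u
  pos : ∀ x u, u ≠ 0 → 0 < (form x u u).re
  smooth : ∀ e ∈ atlas (Fin n → ℂ) X, ∀ j k,
    ContDiffOn ℝ ∞ (fun z => coeff form e z j k) e.target
  closed : ∀ e ∈ atlas (Fin n → ℂ) X, ∀ z ∈ e.target, ∀ i j k,
    dz i (fun w => coeff form e w j k) z = dz j (fun w => coeff form e w i k) z

variable (n) in
/-- A smooth Hermitian metric on the holomorphic line bundle `L` over `X`. -/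
structure HermitianMetric (L : X → Type*) [TopologicalSpace (Bundle.TotalSpace ℂ L)]
    [∀ x, TopologicalSpace (L x)] [∀ x, AddCommGroup (L x)] [∀ x, Module ℂ (L x)]
    [FiberBundle ℂ L] [VectorBundle ℂ ℂ L] where
  /-- the Hermitian form on the fibres -/
  inner : ∀ x : X, L x →ₗ[ℂ] L x →ₗ⋆[ℂ] ℂ
  conj_symm : ∀ x u v, conj (inner x u v) = inner x v u
  pos : ∀ x u, u ≠ 0 → 0 < (inner x u u).re
  /-- the squared norm of the frame given by a local trivialization is a smooth function -/
  smooth : ∀ x₀ : X, ContMDiffOn 𝓘(ℝ, Fin n → ℂ) 𝓘(ℝ, ℝ) ∞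
    (fun x => (inner x ((trivializationAt ℂ L x₀).symm x 1)
      ((trivializationAt ℂ L x₀).symm x 1)).re) (trivializationAt ℂ L x₀).baseSet

variable {L : X → Type*} [TopologicalSpace (Bundle.TotalSpace ℂ L)]
  [∀ x, TopologicalSpace (L x)] [∀ x, AddCommGroup (L x)] [∀ x, Module ℂ (L x)]
  [FiberBundle ℂ L] [VectorBundle ℂ ℂ L]

/-- The function `|s|²_h` on `X`. -/
def HermitianMetric.sq (h : HermitianMetric n L) (s : ∀ x, L x) (x : X) : ℝ :=
  (h.inner x (s x) (s x)).re

/-- The rescaled metric `c h`, with squared norm `c |·|²_h`. -/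
def HermitianMetric.rescale (h : HermitianMetric n L) (c : ℝ) (hc : 0 < c) :
    HermitianMetric n L where
  inner x := (c : ℂ) • h.inner x
  conj_symm x u v := by simp [h.conj_symm]
  pos x u hu := by simpa using mul_pos hc (h.pos x u hu)
  smooth x₀ := by
    have key : ContMDiffOn 𝓘(ℝ, Fin n → ℂ) 𝓘(ℝ, ℝ) ∞ (fun x => c *
        (h.inner x ((trivializationAt ℂ L x₀).symm x 1)
          ((trivializationAt ℂ L x₀).symm x 1)).re) (trivializationAt ℂ L x₀).baseSet :=
      contMDiffOn_const.mul (h.smooth x₀)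
    simpa using key

variable (n) in
/-- `s` is a holomorphic section of `L` whose zero divisor is smooth (and reduced): `s` is
holomorphic, and its derivative in a local trivialization does not vanish at the zeros of `s`. -/
structure CutsSmoothDivisor (s : ∀ x, L x) : Prop where
  holomorphic : ContMDiff 𝓘(ℂ, Fin n → ℂ) (𝓘(ℂ, Fin n → ℂ).prod 𝓘(ℂ, ℂ)) ω
    (fun x => Bundle.TotalSpace.mk' ℂ x (s x))
  transverse : ∀ x, s x = 0 →
    mfderiv 𝓘(ℂ, Fin n → ℂ) 𝓘(ℂ, ℂ)
      (fun y => (trivializationAt ℂ L x (Bundle.TotalSpace.mk' ℂ y (s y))).2) x ≠ 0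

/-- The potential `log [((1 - |s|^{2β}) / β)²]`. -/
def potential (h : HermitianMetric n L) (s : ∀ x, L x) (β : ℝ) (x : X) : ℝ :=
  Real.log (((1 - h.sq s x ^ β) / β) ^ 2)

/-- The coefficients, in the chart `e`, of the reference conic metric
`ω_β = ω - dd^c log [((1 - |s|^{2β}) / β)²]`, where `dd^c = κ i∂∂̄`. -/
def conicMetric (κ : ℝ) (kf : KahlerForm n X) (h : HermitianMetric n L) (s : ∀ x, L x) (β : ℝ)
    (e : OpenPartialHomeomorph X (Fin n → ℂ)) (z : Fin n → ℂ) : Matrix (Fin n) (Fin n) ℂ :=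
  Matrix.of fun j k => coeff kf.form e z j k
    - κ * dz j (dzbar k (fun w => (potential h s β (e.symm w) : ℂ))) z

/-- The normalization of `h`: `|s|²_h < e⁻¹` on `X`, and `ω_β ≥ ω / 2` on `X ∖ D` for all
`β ∈ B`, where `D = {s = 0}`. -/
structure IsNormalized (κ : ℝ) (kf : KahlerForm n X) (h : HermitianMetric n L) (s : ∀ x, L x)
    (B : Set ℝ) : Prop where
  sq_lt : ∀ x, h.sq s x < Real.exp (-1)
  half_le : ∀ β ∈ B, ∀ e ∈ atlas (Fin n → ℂ) X, ∀ z ∈ e.target, s (e.symm z) ≠ 0 →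
    ∀ u : Fin n → ℂ,
      (1 / 2) * sqNorm (coeff kf.form e z) u ≤ sqNorm (conicMetric κ kf h s β e z) u

/-- The holomorphic bisectional curvature of `ω_β` is bounded by `C` in absolute value at every
point of `X ∖ D`. -/
def BisectionalBounded (κ : ℝ) (kf : KahlerForm n X) (h : HermitianMetric n L) (s : ∀ x, L x)
    (β C : ℝ) : Prop :=
  ∀ e ∈ atlas (Fin n → ℂ) X, ∀ z ∈ e.target, s (e.symm z) ≠ 0 → ∀ u v : Fin n → ℂ,
    sqNorm (conicMetric κ kf h s β e z) u = 1 → sqNorm (conicMetric κ kf h s β e z) v = 1 →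
      ‖bisectional (conicMetric κ kf h s β e) z u v‖ ≤ C

end Manifold

end

end ConicMetric

/-! Locally $|s|^2=|\sigma|^2e^{-\varphi}$ with $\sigma$ holomorphic. Put $\tau=\log|s|^2$,
$P=|s|^{2\beta}=e^{\beta\tau}$. The potential is $2\log(1-e^{\beta\tau})-2\log\beta$, so the chain
rule gives (`del_delbar_potential`, `herm_metric`)
$$\omega_\beta=\omega+\kappa\frac{2\beta^2P}{(1-P)^2}\,\partial\tau\,\bar\partial\tau-\kappa\frac{2\beta
P}{1-P}\,\partial\bar\partial\varphi$$ at the level of coefficient matrices.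

Normalization: the middle term is nonnegative, and if $\tau\le-T$ the last coefficient is at most
$2\kappa/T$, whatever $\beta$ is (`two_mul_div_le`). Multiplying $h$ by a small $c$ makes $T$ large
without changing $\partial\bar\partial\varphi$, so the last term is absorbed by $\frac12\omega$
locally, and on $X$ by compactness.

Curvature: fix a point $p$ off $D$ and freeze $\varepsilon=1-P(p)$. In the coframe $dz_j$ ($j\ne
i_0$), $b\,d\sigma$ with $b=(\beta/\varepsilon)\sigma^{\beta-1}$, the metric becomes a matrix $G$
that is uniformly bounded below. Since $\varepsilon$ is a constant, the coframe is holomorphic and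
the curvature transforms tensorially (`chernForm_congruence`). It therefore suffices to bound, at
$p$, the entries of $G$ and their derivatives $\partial_v$, $\bar\partial_v$,
$\partial_v\bar\partial_v$ along $\omega_\beta$-unit vectors $v$, uniformly in $(\beta,p,v)$
(`exists_chernForm_bound`).

These bounds rest on three facts. The component $y=b\,\partial_v\sigma$ of a unit vector is bounded
(`exists_y_bound`), because the middle term of $\omega_\beta$ controls it. The ratio
$\beta/\varepsilon$ is at most $2$ (`ratio_le`). The inverse $a=b^{-1}$ satisfies
$\partial_va=(1-\beta)(a^2/\sigma)\,y$, where
$|a^2/\sigma|=(\varepsilon/\beta)^2|\sigma|^{1-2\beta}$ is bounded exactly because $\beta\le\frac12$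
(`unifBdd_a_sq_div`). Every entry of $G$ is an algebraic expression in functions with such bounds
(`frameMetric_eq`, `jet_frameMetric`); the poles along $D$ cancel in `ratio_mul_frame_delLog`. A
finite cover of $X$ gives a single constant. -/

namespace ConicMetric

/-! ### Wirtinger calculus along a complex direction. -/

section Wirtinger

variable {n : ℕ}

/-- The Wirtinger derivative `∂_v f = ∑ v_j ∂f/∂z_j` in the direction `v`. -/
noncomputable def del (v : Fin n → ℂ) (f : (Fin n → ℂ) → ℂ) (z : Fin n → ℂ) : ℂ :=
  (1 / 2) * (fderiv ℝ f z v - Complex.I * fderiv ℝ f z (Complex.I • v))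

/-- The Wirtinger derivative `∂̄_v f = ∑ v̄_j ∂f/∂z̄_j` in the direction `v`. -/
noncomputable def delbar (v : Fin n → ℂ) (f : (Fin n → ℂ) → ℂ) (z : Fin n → ℂ) : ℂ :=
  (1 / 2) * (fderiv ℝ f z v + Complex.I * fderiv ℝ f z (Complex.I • v))

theorem I_smul_single (j : Fin n) :
    (Complex.I • (Pi.single j 1 : Fin n → ℂ)) = Pi.single j Complex.I := by
  rw [← Pi.single_smul]; simp

theorem dz_eq_del (j : Fin n) : dz j = del (Pi.single j (1 : ℂ)) := by
  funext f z; simp [dz, del, I_smul_single]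

theorem dzbar_eq_delbar (j : Fin n) : dzbar j = delbar (Pi.single j (1 : ℂ)) := by
  funext f z; simp [dzbar, delbar, I_smul_single]

/-- The real derivative is only $\mathbb R$-linear; splitting $c$ into real and imaginary parts is
what makes `del` linear and `delbar` conjugate linear in the direction. -/
theorem real_smul_decomp (L : (Fin n → ℂ) →L[ℝ] ℂ) (c : ℂ) (v : Fin n → ℂ) :
    L (c • v) = c.re * L v + c.im * L (Complex.I • v) := by
  have : c • v = c.re • v + c.im • (Complex.I • v) := by
    ext i
    simp only [Pi.smul_apply, Pi.add_apply, smul_eq_mul, Complex.real_smul]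
    conv_lhs => rw [← Complex.re_add_im c]
    ring
  rw [this, map_add, map_smul, map_smul]
  simp

theorem del_add_dir (v w : Fin n → ℂ) (f : (Fin n → ℂ) → ℂ) (z : Fin n → ℂ) :
    del (v + w) f z = del v f z + del w f z := by
  simp only [del, smul_add, map_add]; ring

theorem delbar_add_dir (v w : Fin n → ℂ) (f : (Fin n → ℂ) → ℂ) (z : Fin n → ℂ) :
    delbar (v + w) f z = delbar v f z + delbar w f z := by
  simp only [delbar, smul_add, map_add]; ring

theorem del_smul_dir (c : ℂ) (v : Fin n → ℂ) (f : (Fin n → ℂ) → ℂ) (z : Fin n → ℂ) :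
    del (c • v) f z = c * del v f z := by
  simp only [del]
  rw [smul_smul, real_smul_decomp _ c, real_smul_decomp _ (Complex.I * c)]
  conv_rhs => rw [← Complex.re_add_im c]
  simp only [Complex.mul_re, Complex.mul_im, Complex.I_re, Complex.I_im]
  push_cast
  linear_combination ((c.im : ℂ) / 2 * fderiv ℝ f z (Complex.I • v)) * Complex.I_mul_I

theorem delbar_smul_dir (c : ℂ) (v : Fin n → ℂ) (f : (Fin n → ℂ) → ℂ) (z : Fin n → ℂ) :
    delbar (c • v) f z = conj c * delbar v f z := by
  simp only [delbar]
  rw [smul_smul, real_smul_decomp _ c, real_smul_decomp _ (Complex.I * c)]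
  have : conj c = c.re - c.im * Complex.I := by
    apply Complex.ext <;> simp
  rw [this]
  simp only [Complex.mul_re, Complex.mul_im, Complex.I_re, Complex.I_im]
  push_cast
  linear_combination ((c.im : ℂ) / 2 * fderiv ℝ f z (Complex.I • v)) * Complex.I_mul_I

theorem pi_eq_sum_smul_single (v : Fin n → ℂ) :
    v = ∑ j, v j • (Pi.single j (1 : ℂ) : Fin n → ℂ) := by
  ext i; simp [Finset.sum_apply, Pi.single_apply]

theorem del_sum_dir {ι : Type*} (s : Finset ι) (c : ι → ℂ) (v : ι → Fin n → ℂ)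
    (f : (Fin n → ℂ) → ℂ) (z : Fin n → ℂ) :
    del (∑ j ∈ s, c j • v j) f z = ∑ j ∈ s, c j * del (v j) f z := by
  classical
  induction s using Finset.induction_on with
  | empty => simp [del]
  | insert a s ha ih => rw [Finset.sum_insert ha, Finset.sum_insert ha, del_add_dir,
      del_smul_dir, ih]

theorem delbar_sum_dir {ι : Type*} (s : Finset ι) (c : ι → ℂ) (v : ι → Fin n → ℂ)
    (f : (Fin n → ℂ) → ℂ) (z : Fin n → ℂ) :
    delbar (∑ j ∈ s, c j • v j) f z = ∑ j ∈ s, conj (c j) * delbar (v j) f z := by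
  classical
  induction s using Finset.induction_on with
  | empty => simp [delbar]
  | insert a s ha ih => rw [Finset.sum_insert ha, Finset.sum_insert ha, delbar_add_dir,
      delbar_smul_dir, ih]

theorem del_eq_sum (v : Fin n → ℂ) (f : (Fin n → ℂ) → ℂ) (z : Fin n → ℂ) :
    del v f z = ∑ j, v j * dz j f z := by
  conv_lhs => rw [pi_eq_sum_smul_single v]
  rw [del_sum_dir]; simp only [dz_eq_del]

theorem delbar_eq_sum (v : Fin n → ℂ) (f : (Fin n → ℂ) → ℂ) (z : Fin n → ℂ) :
    delbar v f z = ∑ j, conj (v j) * dzbar j f z := by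
  conv_lhs => rw [pi_eq_sum_smul_single v]
  rw [delbar_sum_dir]; simp only [dzbar_eq_delbar]

theorem del_congr {f g : (Fin n → ℂ) → ℂ} {z : Fin n → ℂ} (h : f =ᶠ[nhds z] g)
    (v : Fin n → ℂ) : del v f z = del v g z := by
  simp only [del, h.fderiv_eq]

theorem delbar_congr {f g : (Fin n → ℂ) → ℂ} {z : Fin n → ℂ} (h : f =ᶠ[nhds z] g)
    (v : Fin n → ℂ) : delbar v f z = delbar v g z := by
  simp only [delbar, h.fderiv_eq]

theorem delbar_eventuallyEq {f g : (Fin n → ℂ) → ℂ} {z : Fin n → ℂ} (h : f =ᶠ[nhds z] g)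
    (v : Fin n → ℂ) : delbar v f =ᶠ[nhds z] delbar v g := by
  filter_upwards [h.eventuallyEq_nhds] with w hw using delbar_congr hw v

section Rules

variable {f g : (Fin n → ℂ) → ℂ} {z : Fin n → ℂ} (v : Fin n → ℂ)

@[simp] theorem del_const (c : ℂ) : del v (fun _ => c) z = 0 := by simp [del]
@[simp] theorem delbar_const (c : ℂ) : delbar v (fun _ => c) z = 0 := by simp [delbar]

theorem del_add (hf : DifferentiableAt ℝ f z) (hg : DifferentiableAt ℝ g z) :
    del v (fun w => f w + g w) z = del v f z + del v g z := by
  simp only [del, (hf.hasFDerivAt.fun_add hg.hasFDerivAt).fderiv, add_apply]; ring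

theorem delbar_add (hf : DifferentiableAt ℝ f z) (hg : DifferentiableAt ℝ g z) :
    delbar v (fun w => f w + g w) z = delbar v f z + delbar v g z := by
  simp only [delbar, (hf.hasFDerivAt.fun_add hg.hasFDerivAt).fderiv, add_apply]; ring

theorem fderiv_mul_apply (hf : DifferentiableAt ℝ f z) (hg : DifferentiableAt ℝ g z)
    (u : Fin n → ℂ) : fderiv ℝ (fun w => f w * g w) z u =
      fderiv ℝ f z u * g z + f z * fderiv ℝ g z u := by
  rw [fderiv_fun_mul hf hg]
  simp only [add_apply, smul_apply, smul_eq_mul]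
  ring

theorem del_mul (hf : DifferentiableAt ℝ f z) (hg : DifferentiableAt ℝ g z) :
    del v (fun w => f w * g w) z = del v f z * g z + f z * del v g z := by
  simp only [del, fderiv_mul_apply hf hg]; ring

theorem delbar_mul (hf : DifferentiableAt ℝ f z) (hg : DifferentiableAt ℝ g z) :
    delbar v (fun w => f w * g w) z = delbar v f z * g z + f z * delbar v g z := by
  simp only [delbar, fderiv_mul_apply hf hg]; ring

theorem fderiv_conj (hf : DifferentiableAt ℝ f z) (u : Fin n → ℂ) :
    fderiv ℝ (fun w => conj (f w)) z u = conj (fderiv ℝ f z u) := by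
  have := (Complex.conjCLE.toContinuousLinearMap.hasFDerivAt (x := f z)).comp z hf.hasFDerivAt
  have h2 : fderiv ℝ (fun w => conj (f w)) z = _ := this.fderiv
  rw [h2]; simp

theorem del_conj (hf : DifferentiableAt ℝ f z) :
    del v (fun w => conj (f w)) z = conj (delbar v f z) := by
  have h2 : conj (2 : ℂ) = 2 := Complex.conj_ofNat 2
  simp [del, delbar, fderiv_conj hf, sub_eq_add_neg, h2]

theorem delbar_conj (hf : DifferentiableAt ℝ f z) :
    delbar v (fun w => conj (f w)) z = conj (del v f z) := by
  have h2 : conj (2 : ℂ) = 2 := Complex.conj_ofNat 2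
  simp [del, delbar, fderiv_conj hf, sub_eq_add_neg, h2]

/-- The chain rule for a holomorphic outer function of one variable. -/
theorem fderiv_comp_of_hasDerivAt {φ : ℂ → ℂ} {φ' : ℂ} (hφ : HasDerivAt φ φ' (f z))
    (hf : DifferentiableAt ℝ f z) (u : Fin n → ℂ) :
    fderiv ℝ (fun w => φ (f w)) z u = φ' * fderiv ℝ f z u := by
  have h1 := (hφ.hasFDerivAt.restrictScalars ℝ).comp z hf.hasFDerivAt
  have h2 : fderiv ℝ (fun w => φ (f w)) z = _ := h1.fderiv
  rw [h2]; simp [mul_comm]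

theorem del_comp_of_hasDerivAt {φ : ℂ → ℂ} {φ' : ℂ} (hφ : HasDerivAt φ φ' (f z))
    (hf : DifferentiableAt ℝ f z) : del v (fun w => φ (f w)) z = φ' * del v f z := by
  simp only [del, fderiv_comp_of_hasDerivAt hφ hf]; ring

theorem delbar_comp_of_hasDerivAt {φ : ℂ → ℂ} {φ' : ℂ} (hφ : HasDerivAt φ φ' (f z))
    (hf : DifferentiableAt ℝ f z) : delbar v (fun w => φ (f w)) z = φ' * delbar v f z := by
  simp only [delbar, fderiv_comp_of_hasDerivAt hφ hf]; ring

theorem fderiv_real_of_complex (hf : DifferentiableAt ℂ f z) (u : Fin n → ℂ) :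
    fderiv ℝ f z u = fderiv ℂ f z u := by
  rw [(hf.hasFDerivAt.restrictScalars ℝ).fderiv]; rfl

theorem del_of_holomorphic (hf : DifferentiableAt ℂ f z) : del v f z = fderiv ℂ f z v := by
  simp only [del, fderiv_real_of_complex hf, map_smul, smul_eq_mul]
  linear_combination (-(1 : ℂ) / 2 * fderiv ℂ f z v) * Complex.I_mul_I

theorem delbar_of_holomorphic (hf : DifferentiableAt ℂ f z) : delbar v f z = 0 := by
  simp only [delbar, fderiv_real_of_complex hf, map_smul, smul_eq_mul]
  linear_combination ((1 : ℂ) / 2 * fderiv ℂ f z v) * Complex.I_mul_I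

theorem fderiv_comp_holomorphic {m : ℕ} {ψ : (Fin m → ℂ) → (Fin n → ℂ)} {y : Fin m → ℂ}
    (hψ : DifferentiableAt ℂ ψ y) (hf : DifferentiableAt ℝ f (ψ y)) (u : Fin m → ℂ) :
    fderiv ℝ (fun w => f (ψ w)) y u = fderiv ℝ f (ψ y) (fderiv ℂ ψ y u) := by
  have h1 := hf.hasFDerivAt.comp y (hψ.hasFDerivAt.restrictScalars ℝ)
  have h2 : fderiv ℝ (fun w => f (ψ w)) y = _ := h1.fderiv
  rw [h2]; rfl

theorem del_comp_holomorphic {m : ℕ} {ψ : (Fin m → ℂ) → (Fin n → ℂ)} {y : Fin m → ℂ}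
    (hψ : DifferentiableAt ℂ ψ y) (hf : DifferentiableAt ℝ f (ψ y)) (u : Fin m → ℂ) :
    del u (fun w => f (ψ w)) y = del (fderiv ℂ ψ y u) f (ψ y) := by
  simp only [del, fderiv_comp_holomorphic hψ hf, map_smul]

theorem delbar_comp_holomorphic {m : ℕ} {ψ : (Fin m → ℂ) → (Fin n → ℂ)} {y : Fin m → ℂ}
    (hψ : DifferentiableAt ℂ ψ y) (hf : DifferentiableAt ℝ f (ψ y)) (u : Fin m → ℂ) :
    delbar u (fun w => f (ψ w)) y = delbar (fderiv ℂ ψ y u) f (ψ y) := by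
  simp only [delbar, fderiv_comp_holomorphic hψ hf, map_smul]

end Rules

section Smooth

variable {f g : (Fin n → ℂ) → ℂ} {W : Set (Fin n → ℂ)} (hW : IsOpen W)
include hW

theorem differentiableAt_of_smooth {F : Type*} [NormedAddCommGroup F] [NormedSpace ℝ F]
    {f : (Fin n → ℂ) → F} (hf : ContDiffOn ℝ ∞ f W) {z} (hz : z ∈ W) :
    DifferentiableAt ℝ f z :=
  (hf.contDiffAt (hW.mem_nhds hz)).differentiableAt (by simp)

theorem smooth_fderiv_apply (hf : ContDiffOn ℝ ∞ f W) (v : Fin n → ℂ) :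
    ContDiffOn ℝ ∞ (fun z => fderiv ℝ f z v) W :=
  (hf.fderiv_of_isOpen hW (m := ∞) (by simp)).clm_apply contDiffOn_const

theorem smooth_del (hf : ContDiffOn ℝ ∞ f W) (v : Fin n → ℂ) : ContDiffOn ℝ ∞ (del v f) W :=
  contDiffOn_const.mul ((smooth_fderiv_apply hW hf v).sub
    (contDiffOn_const.mul (smooth_fderiv_apply hW hf _)))

theorem smooth_delbar (hf : ContDiffOn ℝ ∞ f W) (v : Fin n → ℂ) :
    ContDiffOn ℝ ∞ (delbar v f) W :=
  contDiffOn_const.mul ((smooth_fderiv_apply hW hf v).add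
    (contDiffOn_const.mul (smooth_fderiv_apply hW hf _)))

omit hW in
theorem smooth_conj (hf : ContDiffOn ℝ ∞ f W) : ContDiffOn ℝ ∞ (fun z => conj (f z)) W :=
  Complex.conjCLE.contDiff.comp_contDiffOn hf

omit hW in
theorem smooth_of_holomorphic (hf : ContDiffOn ℂ ∞ f W) : ContDiffOn ℝ ∞ f W :=
  hf.restrict_scalars ℝ

/-- Both sides are the same combination of second real derivatives along $v, iv$ and $u, iu$, up to
the symmetry of the second derivative. -/
theorem del_delbar_comm (hf : ContDiffOn ℝ ∞ f W) (v u : Fin n → ℂ) {z} (hz : z ∈ W) :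
    del v (delbar u f) z = delbar u (del v f) z := by
  have hs : ∀ a b, fderiv ℝ (fun z => fderiv ℝ f z a) z b
      = fderiv ℝ (fun z => fderiv ℝ f z b) z a := by
    have hd : DifferentiableAt ℝ (fderiv ℝ f) z :=
      differentiableAt_of_smooth hW (hf.fderiv_of_isOpen hW (m := ∞) (by simp)) hz
    have key : ∀ a b, fderiv ℝ (fun z => fderiv ℝ f z a) z b
        = fderiv ℝ (fderiv ℝ f) z b a := by
      intro a b
      rw [(hd.hasFDerivAt.clm_apply (hasFDerivAt_const a z)).fderiv]; simp
    intro a b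
    rw [key, key]
    exact (hf.contDiffAt (hW.mem_nhds hz)).isSymmSndFDerivAt
      (by simpa using WithTop.coe_le_coe.2 (le_top : (2 : ℕ∞) ≤ ⊤)) b a
  have hd : ∀ a, DifferentiableAt ℝ (fun z => fderiv ℝ f z a) z :=
    fun a => differentiableAt_of_smooth hW (smooth_fderiv_apply hW hf a) hz
  have e1 : ∀ b, fderiv ℝ (delbar u f) z b = (1 / 2) * (fderiv ℝ (fun z => fderiv ℝ f z u) z b +
      Complex.I * fderiv ℝ (fun z => fderiv ℝ f z (Complex.I • u)) z b) := by
    intro b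
    have : HasFDerivAt (delbar u f) _ z := (((hd u).hasFDerivAt.add
      ((hd (Complex.I • u)).hasFDerivAt.const_mul Complex.I)).const_mul (1 / 2 : ℂ))
    rw [this.fderiv]; simp [mul_add]
  have e2 : ∀ b, fderiv ℝ (del v f) z b = (1 / 2) * (fderiv ℝ (fun z => fderiv ℝ f z v) z b -
      Complex.I * fderiv ℝ (fun z => fderiv ℝ f z (Complex.I • v)) z b) := by
    intro b
    have : HasFDerivAt (del v f) _ z := (((hd v).hasFDerivAt.sub
      ((hd (Complex.I • v)).hasFDerivAt.const_mul Complex.I)).const_mul (1 / 2 : ℂ))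
    rw [this.fderiv]; simp [mul_sub]
  simp only [del.eq_1 v (delbar u f), delbar.eq_1 u (del v f), e1, e2]
  rw [hs v u, hs v (Complex.I • u), hs (Complex.I • v) u, hs (Complex.I • v) (Complex.I • u)]
  ring

theorem del_delbar_eq_sum (hf : ContDiffOn ℝ ∞ f W) (v : Fin n → ℂ) {z} (hz : z ∈ W) :
    del v (delbar v f) z = ∑ k, ∑ l, v k * conj (v l) * dz k (dzbar l f) z := by
  rw [del_delbar_comm hW hf v v hz, delbar_eq_sum]
  simp only [dzbar_eq_delbar, ← del_delbar_comm hW hf v _ hz]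
  simp only [del_eq_sum v, dz_eq_del, Finset.mul_sum]
  rw [Finset.sum_comm]
  refine Finset.sum_congr rfl fun k _ => Finset.sum_congr rfl fun l _ => by ring

theorem del_delbar_mul (hf : ContDiffOn ℝ ∞ f W) (hg : ContDiffOn ℝ ∞ g W)
    (v u : Fin n → ℂ) {z} (hz : z ∈ W) :
    del v (delbar u (fun w => f w * g w)) z = del v (delbar u f) z * g z +
      delbar u f z * del v g z + del v f z * delbar u g z + f z * del v (delbar u g) z := by
  have h1 : delbar u (fun w => f w * g w) =ᶠ[nhds z]
      fun w => delbar u f w * g w + f w * delbar u g w := by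
    filter_upwards [hW.mem_nhds hz] with w hw
    exact delbar_mul u (differentiableAt_of_smooth hW hf hw) (differentiableAt_of_smooth hW hg hw)
  have df := differentiableAt_of_smooth hW hf hz
  have dg := differentiableAt_of_smooth hW hg hz
  have df' := differentiableAt_of_smooth hW (smooth_delbar hW hf u) hz
  have dg' := differentiableAt_of_smooth hW (smooth_delbar hW hg u) hz
  rw [del_congr h1, del_add v (df'.fun_mul dg) (df.fun_mul dg'), del_mul v df' dg, del_mul v df dg']
  ring

theorem del_delbar_add (hf : ContDiffOn ℝ ∞ f W) (hg : ContDiffOn ℝ ∞ g W)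
    (v u : Fin n → ℂ) {z} (hz : z ∈ W) :
    del v (delbar u (fun w => f w + g w)) z = del v (delbar u f) z + del v (delbar u g) z := by
  have h1 : delbar u (fun w => f w + g w) =ᶠ[nhds z] fun w => delbar u f w + delbar u g w := by
    filter_upwards [hW.mem_nhds hz] with w hw
    exact delbar_add u (differentiableAt_of_smooth hW hf hw) (differentiableAt_of_smooth hW hg hw)
  rw [del_congr h1, del_add v (differentiableAt_of_smooth hW (smooth_delbar hW hf u) hz)
    (differentiableAt_of_smooth hW (smooth_delbar hW hg u) hz)]

theorem del_delbar_conj (hf : ContDiffOn ℝ ∞ f W) (v u : Fin n → ℂ) {z} (hz : z ∈ W) :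
    del v (delbar u (fun w => conj (f w))) z = conj (del u (delbar v f) z) := by
  have h1 : delbar u (fun w => conj (f w)) =ᶠ[nhds z] fun w => conj (del u f w) := by
    filter_upwards [hW.mem_nhds hz] with w hw
    exact delbar_conj u (differentiableAt_of_smooth hW hf hw)
  rw [del_congr h1, del_conj v (differentiableAt_of_smooth hW (smooth_del hW hf u) hz),
    del_delbar_comm hW hf u v hz]

/-- The outer function is holomorphic, so only its complex derivatives appear. Real functions of
$\log|s|^2$ are treated by extending them holomorphically. -/
theorem del_delbar_comp {φ φ' : ℂ → ℂ} {φ'' : ℂ} (hφ : ∀ w ∈ W, HasDerivAt φ (φ' (f w)) (f w))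
    {z} (hφ' : HasDerivAt φ' φ'' (f z)) (hf : ContDiffOn ℝ ∞ f W) (v u : Fin n → ℂ)
    (hz : z ∈ W) :
    del v (delbar u (fun w => φ (f w))) z = φ'' * del v f z * delbar u f z +
      φ' (f z) * del v (delbar u f) z := by
  have h1 : delbar u (fun w => φ (f w)) =ᶠ[nhds z] fun w => φ' (f w) * delbar u f w := by
    filter_upwards [hW.mem_nhds hz] with w hw
    exact delbar_comp_of_hasDerivAt u (hφ w hw) (differentiableAt_of_smooth hW hf hw)
  have df := differentiableAt_of_smooth hW hf hz
  have dφ : DifferentiableAt ℝ (fun w => φ' (f w)) z :=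
    (hφ'.differentiableAt.restrictScalars ℝ).comp z df
  rw [del_congr h1, del_mul v dφ (differentiableAt_of_smooth hW (smooth_delbar hW hf u) hz),
    del_comp_of_hasDerivAt v hφ' df]

theorem delbar_holomorphic_eventually (hf : ContDiffOn ℂ ∞ f W) (u : Fin n → ℂ) {z}
    (hz : z ∈ W) : delbar u f =ᶠ[nhds z] fun _ => 0 := by
  filter_upwards [hW.mem_nhds hz] with w hw
  exact delbar_of_holomorphic u ((hf.contDiffAt (hW.mem_nhds hw)).differentiableAt (by simp))

theorem del_delbar_holomorphic (hf : ContDiffOn ℂ ∞ f W) (v u : Fin n → ℂ) {z}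
    (hz : z ∈ W) : del v (delbar u f) z = 0 := by
  rw [del_congr (delbar_holomorphic_eventually hW hf u hz), del_const]

end Smooth

end Wirtinger

/-! ### Curvature as a Hermitian-matrix expression, and its invariance. -/

section Chern

open Matrix

variable {n : ℕ}

/-- The sesquilinear form `∑ M_{ij} u_i ū_j`. -/
noncomputable def herm (M : Matrix (Fin n) (Fin n) ℂ) (u : Fin n → ℂ) : ℂ :=
  ∑ i, ∑ j, M i j * u i * conj (u j)

theorem sqNorm_eq_re_herm (M : Matrix (Fin n) (Fin n) ℂ) (u : Fin n → ℂ) :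
    sqNorm M u = (herm M u).re := rfl

theorem herm_eq_dotProduct (M : Matrix (Fin n) (Fin n) ℂ) (u : Fin n → ℂ) :
    herm M u = (u ᵥ* M) ⬝ᵥ star u := by
  simp only [herm, vecMul, dotProduct, Finset.sum_mul, Pi.star_apply, RCLike.star_def]
  rw [Finset.sum_comm]
  refine Finset.sum_congr rfl fun i _ => Finset.sum_congr rfl fun j _ => by ring

theorem herm_congruence (M N : Matrix (Fin n) (Fin n) ℂ) (u : Fin n → ℂ) :
    herm (N * M * Nᴴ) u = herm M (u ᵥ* N) := by
  rw [herm_eq_dotProduct, herm_eq_dotProduct, star_vecMul, ← vecMul_vecMul, ← vecMul_vecMul,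
    dotProduct_mulVec]

theorem herm_add (M N : Matrix (Fin n) (Fin n) ℂ) (u : Fin n → ℂ) :
    herm (M + N) u = herm M u + herm N u := by
  simp only [herm, Matrix.add_apply, add_mul, Finset.sum_add_distrib]

theorem herm_smul (c : ℂ) (M : Matrix (Fin n) (Fin n) ℂ) (u : Fin n → ℂ) :
    herm (c • M) u = c * herm M u := by
  simp only [herm, Matrix.smul_apply, smul_eq_mul, Finset.mul_sum, mul_assoc]

theorem herm_smul_vec (c : ℂ) (M : Matrix (Fin n) (Fin n) ℂ) (u : Fin n → ℂ) :
    herm M (c • u) = c * conj c * herm M u := by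
  simp only [herm, Pi.smul_apply, smul_eq_mul, Finset.mul_sum, map_mul]
  refine Finset.sum_congr rfl fun i _ => Finset.sum_congr rfl fun j _ => by ring

theorem herm_vecMulVec (x u : Fin n → ℂ) :
    herm (Matrix.of fun i j => x i * conj (x j)) u
      = (∑ i, u i * x i) * conj (∑ i, u i * x i) := by
  simp only [herm, Matrix.of_apply, map_sum, map_mul, Finset.sum_mul_sum]
  refine Finset.sum_congr rfl fun i _ => Finset.sum_congr rfl fun j _ => by ring

theorem norm_herm_le (M : Matrix (Fin n) (Fin n) ℂ) (u : Fin n → ℂ) {B r : ℝ}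
    (hM : ∀ i j, ‖M i j‖ ≤ B) (hu : ‖u‖ ≤ r) : ‖herm M u‖ ≤ n ^ 2 * (B * r ^ 2) := by
  have hr : 0 ≤ r := (norm_nonneg u).trans hu
  calc ‖herm M u‖ ≤ ∑ i : Fin n, ∑ j : Fin n, B * r ^ 2 := by
        refine (norm_sum_le _ _).trans (Finset.sum_le_sum fun i _ => ?_)
        refine (norm_sum_le _ _).trans (Finset.sum_le_sum fun j _ => ?_)
        rw [norm_mul, norm_mul, RCLike.norm_conj, mul_assoc, sq]
        have hB : 0 ≤ B := (norm_nonneg _).trans (hM i j)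
        exact mul_le_mul (hM i j) (mul_le_mul ((norm_le_pi_norm u i).trans hu)
          ((norm_le_pi_norm u j).trans hu) (norm_nonneg _) hr) (by positivity) hB
    _ = n ^ 2 * (B * r ^ 2) := by simp; ring

/-- Entrywise smoothness of a matrix-valued function. -/
def SmoothMat (W : Set (Fin n → ℂ)) (A : (Fin n → ℂ) → Matrix (Fin n) (Fin n) ℂ) : Prop :=
  ∀ i j, ContDiffOn ℝ ∞ (fun w => A w i j) W

/-- Entrywise holomorphy of a matrix-valued function. -/
def HolMat (W : Set (Fin n → ℂ)) (A : (Fin n → ℂ) → Matrix (Fin n) (Fin n) ℂ) : Prop :=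
  ∀ i j, ContDiffOn ℂ ∞ (fun w => A w i j) W

theorem HolMat.smoothMat {W : Set (Fin n → ℂ)} {A : (Fin n → ℂ) → Matrix (Fin n) (Fin n) ℂ}
    (h : HolMat W A) : SmoothMat W A := fun i j => smooth_of_holomorphic (h i j)

noncomputable def matDel (v : Fin n → ℂ) (A : (Fin n → ℂ) → Matrix (Fin n) (Fin n) ℂ)
    (z : Fin n → ℂ) : Matrix (Fin n) (Fin n) ℂ :=
  Matrix.of fun i j => del v (fun w => A w i j) z

noncomputable def matDelbar (v : Fin n → ℂ) (A : (Fin n → ℂ) → Matrix (Fin n) (Fin n) ℂ)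
    (z : Fin n → ℂ) : Matrix (Fin n) (Fin n) ℂ :=
  Matrix.of fun i j => delbar v (fun w => A w i j) z

noncomputable def matDelDelbar (v : Fin n → ℂ) (A : (Fin n → ℂ) → Matrix (Fin n) (Fin n) ℂ)
    (z : Fin n → ℂ) : Matrix (Fin n) (Fin n) ℂ :=
  Matrix.of fun i j => del v (delbar v (fun w => A w i j)) z

/-- The curvature `Θ(v, v̄) = - ∂_v ∂̄_v g + (∂_v g) g⁻¹ (∂̄_v g)` of a Hermitian metric. -/
noncomputable def chernForm (v : Fin n → ℂ) (g : (Fin n → ℂ) → Matrix (Fin n) (Fin n) ℂ)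
    (z : Fin n → ℂ) : Matrix (Fin n) (Fin n) ℂ :=
  - matDelDelbar v g z + matDel v g z * (g z)⁻¹ * matDelbar v g z

section

variable {W : Set (Fin n → ℂ)} {z : Fin n → ℂ}
  {A B : (Fin n → ℂ) → Matrix (Fin n) (Fin n) ℂ}

theorem SmoothMat.mul (hA : SmoothMat W A) (hB : SmoothMat W B) :
    SmoothMat W (fun w => A w * B w) := by
  intro i j
  simp only [Matrix.mul_apply]
  exact ContDiffOn.sum fun k _ => (hA i k).mul (hB k j)

theorem SmoothMat.conjTranspose (hA : SmoothMat W A) : SmoothMat W (fun w => (A w)ᴴ) :=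
  fun i j => smooth_conj (hA j i)

variable (v : Fin n → ℂ)

theorem del_sum_fun {ι : Type*} (s : Finset ι) (f : ι → (Fin n → ℂ) → ℂ)
    (hf : ∀ i ∈ s, DifferentiableAt ℝ (f i) z) :
    del v (fun w => ∑ i ∈ s, f i w) z = ∑ i ∈ s, del v (f i) z := by
  classical
  induction s using Finset.induction_on with
  | empty => simp
  | insert a s ha ih =>
    simp only [Finset.sum_insert ha]
    rw [del_add v (hf a (by simp)) (DifferentiableAt.fun_sum fun i hi => hf i (by simp [hi])),
      ih fun i hi => hf i (by simp [hi])]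

theorem delbar_sum_fun {ι : Type*} (s : Finset ι) (f : ι → (Fin n → ℂ) → ℂ)
    (hf : ∀ i ∈ s, DifferentiableAt ℝ (f i) z) :
    delbar v (fun w => ∑ i ∈ s, f i w) z = ∑ i ∈ s, delbar v (f i) z := by
  classical
  induction s using Finset.induction_on with
  | empty => simp
  | insert a s ha ih =>
    simp only [Finset.sum_insert ha]
    rw [delbar_add v (hf a (by simp)) (DifferentiableAt.fun_sum fun i hi => hf i (by simp [hi])),
      ih fun i hi => hf i (by simp [hi])]

variable (hW : IsOpen W) (hz : z ∈ W)
include hW hz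

theorem del_delbar_sum_fun (u : Fin n → ℂ) {ι : Type*} (s : Finset ι)
    (f : ι → (Fin n → ℂ) → ℂ) (hf : ∀ i ∈ s, ContDiffOn ℝ ∞ (f i) W) :
    del v (delbar u (fun w => ∑ i ∈ s, f i w)) z = ∑ i ∈ s, del v (delbar u (f i)) z := by
  have h1 : delbar u (fun w => ∑ i ∈ s, f i w) =ᶠ[nhds z]
      fun w => ∑ i ∈ s, delbar u (f i) w := by
    filter_upwards [hW.mem_nhds hz] with w hw
    exact delbar_sum_fun u s f fun i hi => differentiableAt_of_smooth hW (hf i hi) hw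
  rw [del_congr h1, del_sum_fun v s _ fun i hi =>
    differentiableAt_of_smooth hW (smooth_delbar hW (hf i hi) u) hz]

theorem matDel_mul (hA : SmoothMat W A) (hB : SmoothMat W B) :
    matDel v (fun w => A w * B w) z = matDel v A z * B z + A z * matDel v B z := by
  ext i j
  have dA := fun i j => differentiableAt_of_smooth hW (hA i j) hz
  have dB := fun i j => differentiableAt_of_smooth hW (hB i j) hz
  simp only [matDel, Matrix.mul_apply, Matrix.of_apply, Matrix.add_apply]
  rw [del_sum_fun v _ _ fun k _ => (dA i k).fun_mul (dB k j), ← Finset.sum_add_distrib]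
  exact Finset.sum_congr rfl fun k _ => del_mul v (dA i k) (dB k j)

theorem matDelbar_mul (hA : SmoothMat W A) (hB : SmoothMat W B) :
    matDelbar v (fun w => A w * B w) z = matDelbar v A z * B z + A z * matDelbar v B z := by
  ext i j
  have dA := fun i j => differentiableAt_of_smooth hW (hA i j) hz
  have dB := fun i j => differentiableAt_of_smooth hW (hB i j) hz
  simp only [matDelbar, Matrix.mul_apply, Matrix.of_apply, Matrix.add_apply]
  rw [delbar_sum_fun v _ _ fun k _ => (dA i k).fun_mul (dB k j), ← Finset.sum_add_distrib]
  exact Finset.sum_congr rfl fun k _ => delbar_mul v (dA i k) (dB k j)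

theorem matDelDelbar_mul (hA : SmoothMat W A) (hB : SmoothMat W B) :
    matDelDelbar v (fun w => A w * B w) z = matDelDelbar v A z * B z +
      matDelbar v A z * matDel v B z + matDel v A z * matDelbar v B z +
      A z * matDelDelbar v B z := by
  ext i j
  simp only [matDelDelbar, matDel, matDelbar, Matrix.mul_apply, Matrix.of_apply,
    Matrix.add_apply]
  rw [del_delbar_sum_fun v hW hz v _ _ fun k _ => (hA i k).mul (hB k j)]
  simp only [← Finset.sum_add_distrib]
  exact Finset.sum_congr rfl fun k _ => del_delbar_mul hW (hA i k) (hB k j) v v hz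

theorem matDel_conjTranspose (hA : SmoothMat W A) :
    matDel v (fun w => (A w)ᴴ) z = (matDelbar v A z)ᴴ := by
  ext i j
  exact del_conj v (differentiableAt_of_smooth hW (hA j i) hz)

theorem matDelbar_conjTranspose (hA : SmoothMat W A) :
    matDelbar v (fun w => (A w)ᴴ) z = (matDel v A z)ᴴ := by
  ext i j
  exact delbar_conj v (differentiableAt_of_smooth hW (hA j i) hz)

theorem matDelDelbar_conjTranspose (hA : SmoothMat W A) :
    matDelDelbar v (fun w => (A w)ᴴ) z = (matDelDelbar v A z)ᴴ := by
  ext i j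
  exact del_delbar_conj hW (hA j i) v v hz

theorem matDelbar_holomorphic (hA : HolMat W A) : matDelbar v A z = 0 := by
  ext i j
  exact (delbar_holomorphic_eventually hW (hA i j) v hz).eq_of_nhds

theorem matDelDelbar_holomorphic (hA : HolMat W A) : matDelDelbar v A z = 0 := by
  ext i j
  exact del_delbar_holomorphic hW (hA i j) v v hz

/-- Contracting the indices $k,l$ with $v$ turns coordinate derivatives into derivatives along $v$.
The two directions are thereby decoupled: a change of frame acts on $u$ alone, while $v$ only says
where to differentiate. -/
theorem bisectional_eq_herm (hA : SmoothMat W A) (u : Fin n → ℂ) :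
    bisectional A z u v = herm (chernForm v A z) u := by
  have key : ∀ i j, chernForm v A z i j = ∑ k, ∑ l, v k * conj (v l) * curvature A z i j k l := by
    intro i j
    have h1 : (matDel v A z * (A z)⁻¹ * matDelbar v A z) i j = ∑ k, ∑ l, v k * conj (v l) *
        ∑ a, ∑ b, (A z)⁻¹ b a * dz k (fun w => A w i b) z * dzbar l (fun w => A w a j) z := by
      simp only [Matrix.mul_apply, matDel, matDelbar, Matrix.of_apply]
      simp only [del_eq_sum v, delbar_eq_sum v, Finset.mul_sum, Finset.sum_mul]
      have : ∀ F : Fin n → Fin n → Fin n → Fin n → ℂ, ∑ a, ∑ l, ∑ b, ∑ k, F a l b k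
          = ∑ k, ∑ l, ∑ a, ∑ b, F a l b k := by
        intro F
        calc ∑ a, ∑ l, ∑ b, ∑ k, F a l b k = ∑ a, ∑ l, ∑ k, ∑ b, F a l b k := by
              refine Finset.sum_congr rfl fun a _ => Finset.sum_congr rfl fun l _ => ?_
              rw [Finset.sum_comm]
          _ = ∑ l, ∑ a, ∑ k, ∑ b, F a l b k := by rw [Finset.sum_comm]
          _ = ∑ l, ∑ k, ∑ a, ∑ b, F a l b k := by
              refine Finset.sum_congr rfl fun l _ => ?_
              rw [Finset.sum_comm]
          _ = _ := by rw [Finset.sum_comm]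
      rw [this]
      refine Finset.sum_congr rfl fun k _ => Finset.sum_congr rfl fun l _ =>
        Finset.sum_congr rfl fun a _ => Finset.sum_congr rfl fun b _ => by ring
    simp only [chernForm, Matrix.add_apply, Matrix.neg_apply, h1, matDelDelbar, Matrix.of_apply,
      del_delbar_eq_sum hW (hA i j) v hz, curvature, mul_add, Finset.sum_add_distrib, mul_neg,
      Finset.sum_neg_distrib]
  simp only [bisectional, herm, key, Finset.sum_mul]
  refine Finset.sum_congr rfl fun i _ => Finset.sum_congr rfl fun j _ =>
    Finset.sum_congr rfl fun k _ => Finset.sum_congr rfl fun l _ => by ring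

omit hW hz in
theorem chernForm_congr (h : A =ᶠ[nhds z] B) : chernForm v A z = chernForm v B z := by
  have h' : ∀ i j, (fun w => A w i j) =ᶠ[nhds z] fun w => B w i j := by
    intro i j; filter_upwards [h] with w hw; rw [hw]
  have e1 : matDel v A z = matDel v B z := by
    ext i j; exact del_congr (h' i j) v
  have e2 : matDelbar v A z = matDelbar v B z := by
    ext i j; exact delbar_congr (h' i j) v
  have e3 : matDelDelbar v A z = matDelDelbar v B z := by
    ext i j; exact del_congr (delbar_eventuallyEq (h' i j) v) v
  simp only [chernForm, e1, e2, e3, h.eq_of_nhds]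

/-- The curvature is a tensor: it transforms by `N` under a holomorphic change of frame `N`. -/
theorem chernForm_congruence {G N : (Fin n → ℂ) → Matrix (Fin n) (Fin n) ℂ}
    (hG : SmoothMat W G) (hN : HolMat W N) (hGu : IsUnit (G z).det) (hNu : IsUnit (N z).det) :
    chernForm v (fun w => N w * G w * (N w)ᴴ) z = N z * chernForm v G z * (N z)ᴴ := by
  have sN := hN.smoothMat
  have sH := sN.conjTranspose
  have sNG := sN.mul hG
  have b0 := matDelbar_holomorphic v hW hz hN
  have bb0 := matDelDelbar_holomorphic v hW hz hN
  have e1 := matDel_mul v hW hz sNG sH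
  have e2 := matDelbar_mul v hW hz sNG sH
  have e3 := matDelDelbar_mul v hW hz sNG sH
  rw [matDel_conjTranspose v hW hz sN, b0] at e1 e3
  rw [matDelbar_conjTranspose v hW hz sN] at e2 e3
  rw [matDelDelbar_conjTranspose v hW hz sN, bb0] at e3
  rw [matDel_mul v hW hz sN hG] at e1 e3
  rw [matDelbar_mul v hW hz sN hG, b0] at e2 e3
  rw [matDelDelbar_mul v hW hz sN hG, b0, bb0] at e3
  have hinv : (N z * G z * (N z)ᴴ)⁻¹ = ((N z)⁻¹)ᴴ * (G z)⁻¹ * (N z)⁻¹ := by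
    rw [Matrix.mul_inv_rev, Matrix.mul_inv_rev, Matrix.conjTranspose_nonsing_inv, mul_assoc]
  have i1 : (N z)ᴴ * ((N z)⁻¹)ᴴ = 1 := by
    rw [← Matrix.conjTranspose_mul, Matrix.nonsing_inv_mul _ hNu, Matrix.conjTranspose_one]
  have i2 : (N z)⁻¹ * N z = 1 := Matrix.nonsing_inv_mul _ hNu
  have i3 : G z * (G z)⁻¹ = 1 := Matrix.mul_nonsing_inv _ hGu
  have i4 : (G z)⁻¹ * G z = 1 := Matrix.nonsing_inv_mul _ hGu
  have e4 : matDel v (fun w => N w * G w * (N w)ᴴ) z * (N z * G z * (N z)ᴴ)⁻¹ *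
      matDelbar v (fun w => N w * G w * (N w)ᴴ) z
      = (matDel v N z * G z + N z * matDel v G z) * (G z)⁻¹ *
        (matDelbar v G z * (N z)ᴴ + G z * (matDel v N z)ᴴ) := by
    rw [e1, e2, hinv]
    calc _ = (matDel v N z * G z + N z * matDel v G z) * ((N z)ᴴ * ((N z)⁻¹)ᴴ) * (G z)⁻¹ *
        ((N z)⁻¹ * N z) * (matDelbar v G z * (N z)ᴴ + G z * (matDel v N z)ᴴ) := by
          simp only [conjTranspose_zero]; noncomm_ring
      _ = _ := by rw [i1, i2, mul_one, mul_one]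
  have e5 : (matDel v N z * G z + N z * matDel v G z) * (G z)⁻¹ *
        (matDelbar v G z * (N z)ᴴ + G z * (matDel v N z)ᴴ) =
      matDel v N z * (G z * (G z)⁻¹) * matDelbar v G z * (N z)ᴴ +
      matDel v N z * (G z * (G z)⁻¹) * G z * (matDel v N z)ᴴ +
      N z * (matDel v G z * (G z)⁻¹ * matDelbar v G z) * (N z)ᴴ +
      N z * matDel v G z * ((G z)⁻¹ * G z) * (matDel v N z)ᴴ := by noncomm_ring
  -- The three terms containing $\partial_vN$ or its adjoint are the same in
  -- $\partial\bar\partial(NGN^*)$ and in the quadratic term, and cancel.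
  rw [chernForm, e4, e5, e3, i3, i4, chernForm]
  simp only [conjTranspose_zero]
  noncomm_ring

end

section Composition

variable {W V : Set (Fin n → ℂ)} {ψ : (Fin n → ℂ) → (Fin n → ℂ)} {z : Fin n → ℂ}

theorem del_delbar_eq_sum_right {f : (Fin n → ℂ) → ℂ} (hW : IsOpen W) (hf : ContDiffOn ℝ ∞ f W)
    (v u : Fin n → ℂ) (hz : z ∈ W) :
    del v (delbar u f) z = ∑ l, conj (u l) * del v (dzbar l f) z := by
  rw [del_delbar_comm hW hf v u hz, delbar_eq_sum]
  simp only [dzbar_eq_delbar, ← del_delbar_comm hW hf v _ hz]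

theorem holomorphic_fderiv_apply (hV : IsOpen V) (hψ : ContDiffOn ℂ ∞ ψ V) (v : Fin n → ℂ)
    (l : Fin n) : ContDiffOn ℂ ∞ (fun w => fderiv ℂ ψ w v l) V := by
  have h1 : ContDiffOn ℂ ∞ (fun w => fderiv ℂ ψ w v) V :=
    (hψ.fderiv_of_isOpen hV (m := ∞) (by simp)).clm_apply contDiffOn_const
  exact contDiffOn_pi.1 h1 l

variable (hW : IsOpen W) (hV : IsOpen V) (hψ : ContDiffOn ℂ ∞ ψ V) (hVW : Set.MapsTo ψ V W)
  (hz : z ∈ V)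
include hW hV hψ hVW hz

theorem del_comp_hol {f : (Fin n → ℂ) → ℂ} (hf : ContDiffOn ℝ ∞ f W) (v : Fin n → ℂ) :
    del v (fun w => f (ψ w)) z = del (fderiv ℂ ψ z v) f (ψ z) :=
  del_comp_holomorphic ((hψ.contDiffAt (hV.mem_nhds hz)).differentiableAt (by simp))
    (differentiableAt_of_smooth hW hf (hVW hz)) v

theorem delbar_comp_hol {f : (Fin n → ℂ) → ℂ} (hf : ContDiffOn ℝ ∞ f W) (v : Fin n → ℂ) :
    delbar v (fun w => f (ψ w)) z = delbar (fderiv ℂ ψ z v) f (ψ z) :=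
  delbar_comp_holomorphic ((hψ.contDiffAt (hV.mem_nhds hz)).differentiableAt (by simp))
    (differentiableAt_of_smooth hW hf (hVW hz)) v

/-- No second derivative of $\psi$ survives: $\bar\partial_u(f\circ\psi)$ has coefficients
$\overline{\partial_u\psi_l}$, which are antiholomorphic and so killed by $\partial_v$. -/
theorem del_delbar_comp_hol {f : (Fin n → ℂ) → ℂ} (hf : ContDiffOn ℝ ∞ f W) (v u : Fin n → ℂ) :
    del v (delbar u (fun w => f (ψ w))) z =
      del (fderiv ℂ ψ z v) (delbar (fderiv ℂ ψ z u) f) (ψ z) := by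
  have h1 : delbar u (fun w => f (ψ w)) =ᶠ[nhds z]
      fun w => ∑ l, conj (fderiv ℂ ψ w u l) * dzbar l f (ψ w) := by
    filter_upwards [hV.mem_nhds hz] with w hw
    rw [delbar_comp_hol hW hV hψ hVW hw hf, delbar_eq_sum]
  have sd : ∀ l, ContDiffOn ℝ ∞ (dzbar l f) W := fun l => by
    rw [dzbar_eq_delbar]; exact smooth_delbar hW hf _
  have d1 : ∀ l, DifferentiableAt ℝ (fun w => conj (fderiv ℂ ψ w u l)) z := fun l =>
    differentiableAt_of_smooth hV (smooth_conj (smooth_of_holomorphic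
      (holomorphic_fderiv_apply hV hψ u l))) hz
  have d2 : ∀ l, DifferentiableAt ℝ (fun w => dzbar l f (ψ w)) z := fun l =>
    differentiableAt_of_smooth hV ((sd l).comp (hψ.restrict_scalars ℝ) hVW) hz
  rw [del_congr h1, del_sum_fun v _ _ fun l _ => (d1 l).fun_mul (d2 l),
    del_delbar_eq_sum_right hW hf _ _ (hVW hz)]
  refine Finset.sum_congr rfl fun l _ => ?_
  have hol := holomorphic_fderiv_apply hV hψ u l
  rw [del_mul v (d1 l) (d2 l), del_conj v
    (differentiableAt_of_smooth hV (smooth_of_holomorphic hol) hz),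
    (delbar_holomorphic_eventually hV hol v hz).eq_of_nhds,
    del_comp_hol hW hV hψ hVW hz (sd l)]
  simp

/-- Invariance of the curvature under composition with a holomorphic map. -/
theorem chernForm_comp {g : (Fin n → ℂ) → Matrix (Fin n) (Fin n) ℂ} (hg : SmoothMat W g)
    (v : Fin n → ℂ) :
    chernForm v (fun w => g (ψ w)) z = chernForm (fderiv ℂ ψ z v) g (ψ z) := by
  have e1 : matDel v (fun w => g (ψ w)) z = matDel (fderiv ℂ ψ z v) g (ψ z) := by
    ext i j; exact del_comp_hol hW hV hψ hVW hz (hg i j) v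
  have e2 : matDelbar v (fun w => g (ψ w)) z = matDelbar (fderiv ℂ ψ z v) g (ψ z) := by
    ext i j; exact delbar_comp_hol hW hV hψ hVW hz (hg i j) v
  have e3 : matDelDelbar v (fun w => g (ψ w)) z = matDelDelbar (fderiv ℂ ψ z v) g (ψ z) := by
    ext i j; exact del_delbar_comp_hol hW hV hψ hVW hz (hg i j) v v
  simp only [chernForm, e1, e2, e3]

/-- Invariance of the bisectional curvature under a holomorphic change of coordinates `ψ` with
invertible Jacobian matrix. -/
theorem bisectional_comp {g g' : (Fin n → ℂ) → Matrix (Fin n) (Fin n) ℂ} (hg : SmoothMat W g)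
    (hg' : ∀ w ∈ V, g' w = (Matrix.of fun j a => fderiv ℂ ψ w (Pi.single j 1) a) * g (ψ w) *
      (Matrix.of fun j a => fderiv ℂ ψ w (Pi.single j 1) a)ᴴ)
    (hgu : IsUnit (g (ψ z)).det)
    (hJ : IsUnit (Matrix.of fun j a => fderiv ℂ ψ z (Pi.single j 1) a).det)
    (u v : Fin n → ℂ) :
    bisectional g' z u v = bisectional g (ψ z) (fderiv ℂ ψ z u) (fderiv ℂ ψ z v) := by
  have hol : HolMat V fun w => Matrix.of fun j a => fderiv ℂ ψ w (Pi.single j 1) a :=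
    fun j a => holomorphic_fderiv_apply hV hψ _ a
  have sg : SmoothMat V fun w => g (ψ w) :=
    fun i j => (hg i j).comp (hψ.restrict_scalars ℝ) hVW
  have ev : g' =ᶠ[nhds z] fun w => (Matrix.of fun j a => fderiv ℂ ψ w (Pi.single j 1) a) *
      g (ψ w) * (Matrix.of fun j a => fderiv ℂ ψ w (Pi.single j 1) a)ᴴ := by
    filter_upwards [hV.mem_nhds hz] with w hw using hg' w hw
  have sg' : SmoothMat V g' := fun i j =>
    (((hol.smoothMat.mul sg).mul hol.smoothMat.conjTranspose) i j).congr
      fun w hw => by rw [hg' w hw]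
  rw [bisectional_eq_herm v hV hz sg', chernForm_congr v ev,
    chernForm_congruence v hV hz sg hol hgu hJ, herm_congruence,
    chernForm_comp hW hV hψ hVW hz hg, bisectional_eq_herm _ hW (hVW hz) hg]
  congr 1
  ext a
  have : fderiv ℂ ψ z u = ∑ j, u j • fderiv ℂ ψ z (Pi.single j 1) := by
    conv_lhs => rw [pi_eq_sum_smul_single u]
    simp
  rw [this]
  simp [vecMul, dotProduct, Finset.sum_apply]

end Composition

end Chern

/-! ### Transition maps and the coefficients of $\omega$ in different charts. -/

section Charts

open Matrix

variable {n : ℕ} {X : Type*} [TopologicalSpace X] [ChartedSpace (Fin n → ℂ) X]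

theorem holomorphic_transition [IsManifold 𝓘(ℂ, Fin n → ℂ) ω X]
    {e e' : OpenPartialHomeomorph X (Fin n → ℂ)} (he : e ∈ atlas (Fin n → ℂ) X)
    (he' : e' ∈ atlas (Fin n → ℂ) X) :
    ContDiffOn ℂ ∞ (fun z => e' (e.symm z)) (e.symm.trans e').source := by
  have h : e.symm.trans e' ∈ contDiffGroupoid ω 𝓘(ℂ, Fin n → ℂ) := HasGroupoid.compatible he he'
  have h1 : ContDiffOn ℂ ω (e.symm.trans e') (e.symm.trans e').source := by
    simpa [contDiffPregroupoid] using h.1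
  exact h1.of_le le_top

theorem fderiv_transition_bijective [IsManifold 𝓘(ℂ, Fin n → ℂ) ω X]
    {e e' : OpenPartialHomeomorph X (Fin n → ℂ)} (he : e ∈ atlas (Fin n → ℂ) X)
    (he' : e' ∈ atlas (Fin n → ℂ) X) {z : Fin n → ℂ} (hz : z ∈ (e.symm.trans e').source)
    (v : Fin n → ℂ) :
    fderiv ℂ (fun y => e (e'.symm y)) (e' (e.symm z))
      (fderiv ℂ (fun y => e' (e.symm y)) z v) = v := by
  have o := (e.symm.trans e').open_source
  have o' := (e'.symm.trans e).open_source
  have hz' : e' (e.symm z) ∈ (e'.symm.trans e).source := by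
    simp only [OpenPartialHomeomorph.trans_source, OpenPartialHomeomorph.symm_source,
      Set.mem_inter_iff, Set.mem_preimage] at hz ⊢
    rw [e'.left_inv hz.2]
    exact ⟨e'.map_source hz.2, e.map_target hz.1⟩
  have d1 := ((holomorphic_transition he he').contDiffAt (o.mem_nhds hz)).differentiableAt
    (by simp)
  have d2 := ((holomorphic_transition he' he).contDiffAt (o'.mem_nhds hz')).differentiableAt
    (by simp)
  have h := d2.hasFDerivAt.comp z d1.hasFDerivAt
  have h2 : HasFDerivAt ((fun y => e (e'.symm y)) ∘ fun y => e' (e.symm y))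
      (ContinuousLinearMap.id ℂ (Fin n → ℂ)) z := by
    refine (hasFDerivAt_id z).congr_of_eventuallyEq ?_
    filter_upwards [o.mem_nhds hz] with w hw
    simp only [OpenPartialHomeomorph.trans_source, OpenPartialHomeomorph.symm_source,
      Set.mem_inter_iff, Set.mem_preimage] at hw
    simp [e'.left_inv hw.2, e.right_inv hw.1]
  exact DFunLike.congr_fun (h.unique h2) v

/-- The Jacobian matrix `(∂ψ_a/∂z_j)_{j a}` of a map `ψ`. -/
noncomputable def jacobian (ψ : (Fin n → ℂ) → (Fin n → ℂ)) (z : Fin n → ℂ) :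
    Matrix (Fin n) (Fin n) ℂ :=
  Matrix.of fun j a => fderiv ℂ ψ z (Pi.single j 1) a

theorem vecMul_jacobian (ψ : (Fin n → ℂ) → (Fin n → ℂ)) (z u : Fin n → ℂ) :
    u ᵥ* jacobian ψ z = fderiv ℂ ψ z u := by
  have : fderiv ℂ ψ z u = ∑ j, u j • fderiv ℂ ψ z (Pi.single j 1) := by
    conv_lhs => rw [pi_eq_sum_smul_single u]
    simp
  rw [this]
  ext a
  simp [jacobian, vecMul, dotProduct, Finset.sum_apply]

theorem isUnit_det_jacobian_transition [IsManifold 𝓘(ℂ, Fin n → ℂ) ω X]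
    {e e' : OpenPartialHomeomorph X (Fin n → ℂ)} (he : e ∈ atlas (Fin n → ℂ) X)
    (he' : e' ∈ atlas (Fin n → ℂ) X) {z : Fin n → ℂ} (hz : z ∈ (e.symm.trans e').source) :
    IsUnit (jacobian (fun y => e' (e.symm y)) z).det := by
  have h : jacobian (fun y => e' (e.symm y)) z *
      jacobian (fun y => e (e'.symm y)) (e' (e.symm z)) = 1 := by
    apply Matrix.ext_of_single_vecMul
    intro i
    rw [← vecMul_vecMul, vecMul_jacobian, vecMul_jacobian,
      fderiv_transition_bijective he he' hz, vecMul_one]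
  exact (Matrix.isUnit_iff_isUnit_det _).1 (IsUnit.of_mul_eq_one _ h)

/-- `coordVector`, as a vector of the model space. -/
noncomputable def modelCoordVector (e : OpenPartialHomeomorph X (Fin n → ℂ)) (z : Fin n → ℂ)
    (j : Fin n) : Fin n → ℂ := coordVector e z j

/-- A family of sesquilinear forms on the tangent spaces, as forms on the model space. -/
noncomputable def modelForm (H : ∀ x : X, TangentSpace 𝓘(ℂ, Fin n → ℂ) x →ₗ[ℂ]
    TangentSpace 𝓘(ℂ, Fin n → ℂ) x →ₗ⋆[ℂ] ℂ) (x : X) :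
    (Fin n → ℂ) →ₗ[ℂ] (Fin n → ℂ) →ₗ⋆[ℂ] ℂ := H x

theorem coeff_eq_modelForm (H : ∀ x : X, TangentSpace 𝓘(ℂ, Fin n → ℂ) x →ₗ[ℂ]
    TangentSpace 𝓘(ℂ, Fin n → ℂ) x →ₗ⋆[ℂ] ℂ) (e : OpenPartialHomeomorph X (Fin n → ℂ))
    (z : Fin n → ℂ) (j k : Fin n) :
    coeff H e z j k = modelForm H (e.symm z) (modelCoordVector e z j) (modelCoordVector e z k) :=
  rfl

theorem mfderiv_symm_transition [IsManifold 𝓘(ℂ, Fin n → ℂ) ω X]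
    {e e' : OpenPartialHomeomorph X (Fin n → ℂ)} (he : e ∈ atlas (Fin n → ℂ) X)
    (he' : e' ∈ atlas (Fin n → ℂ) X) {z : Fin n → ℂ} (hz : z ∈ (e.symm.trans e').source)
    (v : Fin n → ℂ) :
    (mfderiv 𝓘(ℂ, Fin n → ℂ) 𝓘(ℂ, Fin n → ℂ) e.symm z v : Fin n → ℂ) =
      (mfderiv 𝓘(ℂ, Fin n → ℂ) 𝓘(ℂ, Fin n → ℂ) e'.symm (e' (e.symm z))
        (fderiv ℂ (fun y => e' (e.symm y)) z v : Fin n → ℂ) : Fin n → ℂ) := by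
  have o := (e.symm.trans e').open_source
  have d1 := ((holomorphic_transition he he').contDiffAt (o.mem_nhds hz)).differentiableAt
    (by simp)
  have hz' := hz
  simp only [OpenPartialHomeomorph.trans_source, OpenPartialHomeomorph.symm_source,
      Set.mem_inter_iff, Set.mem_preimage] at hz'
  have m2 : MDifferentiableAt 𝓘(ℂ, Fin n → ℂ) 𝓘(ℂ, Fin n → ℂ) e'.symm (e' (e.symm z)) :=
    have : IsManifold 𝓘(ℂ, Fin n → ℂ) 1 X := IsManifold.of_le (n := ω) le_top
    (mdifferentiable_of_mem_atlas he').mdifferentiableAt_symm (e'.map_source hz'.2)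
  have hc := m2.hasMFDerivAt.comp z d1.hasFDerivAt.hasMFDerivAt
  have hev : e.symm =ᶠ[nhds z] e'.symm ∘ fun y => e' (e.symm y) := by
    filter_upwards [o.mem_nhds hz] with w hw
    simp only [OpenPartialHomeomorph.trans_source, OpenPartialHomeomorph.symm_source,
      Set.mem_inter_iff, Set.mem_preimage] at hw
    simp [e'.left_inv hw.2]
  have hm := (hc.congr_of_eventuallyEq hev).mfderiv
  exact congrArg (fun L : (Fin n → ℂ) →L[ℂ] (Fin n → ℂ) => L v) hm

theorem modelCoordVector_transition [IsManifold 𝓘(ℂ, Fin n → ℂ) ω X]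
    {e e' : OpenPartialHomeomorph X (Fin n → ℂ)} (he : e ∈ atlas (Fin n → ℂ) X)
    (he' : e' ∈ atlas (Fin n → ℂ) X) {z : Fin n → ℂ} (hz : z ∈ (e.symm.trans e').source)
    (j : Fin n) :
    modelCoordVector e z j =
      ∑ a, jacobian (fun y => e' (e.symm y)) z j a • modelCoordVector e' (e' (e.symm z)) a := by
  have h := mfderiv_symm_transition he he' hz (Pi.single j 1)
  rw [← vecMul_jacobian, single_one_vecMul] at h
  refine h.trans ?_
  let L : (Fin n → ℂ) →L[ℂ] (Fin n → ℂ) :=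
    mfderiv 𝓘(ℂ, Fin n → ℂ) 𝓘(ℂ, Fin n → ℂ) e'.symm (e' (e.symm z))
  change L _ = ∑ a, _ • L (Pi.single a 1)
  conv_lhs => rw [pi_eq_sum_smul_single (Matrix.row _ j)]
  simp

theorem coeff_transition [IsManifold 𝓘(ℂ, Fin n → ℂ) ω X]
    (H : ∀ x : X, TangentSpace 𝓘(ℂ, Fin n → ℂ) x →ₗ[ℂ]
      TangentSpace 𝓘(ℂ, Fin n → ℂ) x →ₗ⋆[ℂ] ℂ)
    {e e' : OpenPartialHomeomorph X (Fin n → ℂ)} (he : e ∈ atlas (Fin n → ℂ) X)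
    (he' : e' ∈ atlas (Fin n → ℂ) X) {z : Fin n → ℂ} (hz : z ∈ (e.symm.trans e').source) :
    coeff H e z = jacobian (fun y => e' (e.symm y)) z * coeff H e' (e' (e.symm z)) *
      (jacobian (fun y => e' (e.symm y)) z)ᴴ := by
  have hz' := hz
  simp only [OpenPartialHomeomorph.trans_source, OpenPartialHomeomorph.symm_source,
      Set.mem_inter_iff, Set.mem_preimage] at hz'
  ext j k
  simp only [coeff_eq_modelForm, Matrix.mul_apply, conjTranspose_apply, RCLike.star_def]
  rw [modelCoordVector_transition he he' hz j, modelCoordVector_transition he he' hz k,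
    e'.left_inv hz'.2]
  simp only [map_sum, LinearMap.map_smulₛₗ, LinearMap.sum_apply, LinearMap.smul_apply, map_smul,
    smul_eq_mul, Finset.sum_mul, Finset.mul_sum]
  refine Finset.sum_congr rfl fun b _ => Finset.sum_congr rfl fun a _ => by ring

theorem modelForm_sum (H : ∀ x : X, TangentSpace 𝓘(ℂ, Fin n → ℂ) x →ₗ[ℂ]
      TangentSpace 𝓘(ℂ, Fin n → ℂ) x →ₗ⋆[ℂ] ℂ)
    (e : OpenPartialHomeomorph X (Fin n → ℂ)) (z u : Fin n → ℂ) :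
    herm (coeff H e z) u = modelForm H (e.symm z) (∑ j, u j • modelCoordVector e z j)
      (∑ j, u j • modelCoordVector e z j) := by
  simp only [herm, coeff_eq_modelForm, map_sum, LinearMap.map_smulₛₗ, LinearMap.sum_apply,
    LinearMap.smul_apply, map_smul, smul_eq_mul, Finset.mul_sum]
  rw [Finset.sum_comm]
  refine Finset.sum_congr rfl fun b _ => Finset.sum_congr rfl fun a _ => by ring

theorem sum_modelCoordVector_injective [IsManifold 𝓘(ℂ, Fin n → ℂ) ω X]
    {e : OpenPartialHomeomorph X (Fin n → ℂ)} (he : e ∈ atlas (Fin n → ℂ) X) {z : Fin n → ℂ}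
    (hz : z ∈ e.target) {u : Fin n → ℂ} (hu : ∑ j, u j • modelCoordVector e z j = 0) : u = 0 := by
  have : IsManifold 𝓘(ℂ, Fin n → ℂ) 1 X := IsManifold.of_le (n := ω) le_top
  let L : (Fin n → ℂ) →L[ℂ] (Fin n → ℂ) := mfderiv 𝓘(ℂ, Fin n → ℂ) 𝓘(ℂ, Fin n → ℂ) e.symm z
  let L' : (Fin n → ℂ) →L[ℂ] (Fin n → ℂ) :=
    mfderiv 𝓘(ℂ, Fin n → ℂ) 𝓘(ℂ, Fin n → ℂ) e (e.symm z)
  have h1 : L'.comp L = ContinuousLinearMap.id ℂ _ :=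
    (mdifferentiable_of_mem_atlas (I := 𝓘(ℂ, Fin n → ℂ)) he).comp_symm_deriv hz
  have h2 : L u = 0 := by
    rw [← hu]
    conv_lhs => rw [pi_eq_sum_smul_single u]
    simp only [map_sum, map_smul]
    rfl
  have h3 : L' (L u) = u := DFunLike.congr_fun h1 u
  rw [← h3, h2, map_zero]

theorem KahlerForm.sqNorm_coeff_pos [IsManifold 𝓘(ℂ, Fin n → ℂ) ω X] (kf : KahlerForm n X)
    {e : OpenPartialHomeomorph X (Fin n → ℂ)} (he : e ∈ atlas (Fin n → ℂ) X) {z : Fin n → ℂ}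
    (hz : z ∈ e.target) {u : Fin n → ℂ} (hu : u ≠ 0) : 0 < sqNorm (coeff kf.form e z) u := by
  rw [sqNorm_eq_re_herm, modelForm_sum]
  exact kf.pos _ _ fun h => hu (sum_modelCoordVector_injective he hz h)

end Charts

/-! ### The coefficients of $\omega_\beta$ under a change of chart. -/

section Metric

open Matrix

variable {n : ℕ} {X : Type*} [TopologicalSpace X] [ChartedSpace (Fin n → ℂ) X]
  {L : X → Type*} [TopologicalSpace (Bundle.TotalSpace ℂ L)]
  [∀ x, TopologicalSpace (L x)] [∀ x, AddCommGroup (L x)] [∀ x, Module ℂ (L x)]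
  [FiberBundle ℂ L] [VectorBundle ℂ ℂ L]

/-- The matrix of `∂∂̄ f`. -/
noncomputable def hessian (f : (Fin n → ℂ) → ℂ) (z : Fin n → ℂ) : Matrix (Fin n) (Fin n) ℂ :=
  Matrix.of fun j k => dz j (dzbar k f) z

theorem hessian_comp {W V : Set (Fin n → ℂ)} {ψ : (Fin n → ℂ) → (Fin n → ℂ)} {z : Fin n → ℂ}
    (hW : IsOpen W) (hV : IsOpen V) (hψ : ContDiffOn ℂ ∞ ψ V) (hVW : Set.MapsTo ψ V W)
    (hz : z ∈ V) {f : (Fin n → ℂ) → ℂ} (hf : ContDiffOn ℝ ∞ f W) :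
    hessian (fun w => f (ψ w)) z = jacobian ψ z * hessian f (ψ z) * (jacobian ψ z)ᴴ := by
  ext j k
  simp only [hessian, Matrix.of_apply, Matrix.mul_apply, conjTranspose_apply, RCLike.star_def]
  rw [dz_eq_del, dzbar_eq_delbar, del_delbar_comp_hol hW hV hψ hVW hz hf,
    del_delbar_eq_sum_right hW hf _ _ (hVW hz)]
  refine Finset.sum_congr rfl fun b _ => ?_
  rw [del_eq_sum, mul_comm]
  simp only [jacobian, Matrix.of_apply]

theorem conicMetric_eq (κ : ℝ) (kf : KahlerForm n X) (h : HermitianMetric n L) (s : ∀ x, L x)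
    (β : ℝ) (e : OpenPartialHomeomorph X (Fin n → ℂ)) (z : Fin n → ℂ) :
    conicMetric κ kf h s β e z = coeff kf.form e z -
      (κ : ℂ) • hessian (fun w => (potential h s β (e.symm w) : ℂ)) z := by
  ext j k; rfl

theorem conicMetric_transition [IsManifold 𝓘(ℂ, Fin n → ℂ) ω X] (κ : ℝ) (kf : KahlerForm n X)
    (h : HermitianMetric n L) (s : ∀ x, L x) (β : ℝ)
    {e e' : OpenPartialHomeomorph X (Fin n → ℂ)} (he : e ∈ atlas (Fin n → ℂ) X)
    (he' : e' ∈ atlas (Fin n → ℂ) X) {z : Fin n → ℂ} (hz : z ∈ (e.symm.trans e').source)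
    {W : Set (Fin n → ℂ)} (hW : IsOpen W) (hzW : e' (e.symm z) ∈ W)
    (hpot : ContDiffOn ℝ ∞ (fun w => (potential h s β (e'.symm w) : ℂ)) W) :
    conicMetric κ kf h s β e z = jacobian (fun y => e' (e.symm y)) z *
      conicMetric κ kf h s β e' (e' (e.symm z)) * (jacobian (fun y => e' (e.symm y)) z)ᴴ := by
  have hψ := holomorphic_transition he he'
  have o := (e.symm.trans e').open_source
  set V := (e.symm.trans e').source ∩ (fun y => e' (e.symm y)) ⁻¹' W with hV
  have oV : IsOpen V := hψ.continuousOn.isOpen_inter_preimage o hW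
  have hh := hessian_comp hW oV (hψ.mono Set.inter_subset_left) (fun _ hw => hw.2)
    (z := z) ⟨hz, hzW⟩ hpot
  have hev : (fun w => (potential h s β (e.symm w) : ℂ)) =ᶠ[nhds z]
      fun w => (potential h s β (e'.symm (e' (e.symm w))) : ℂ) := by
    filter_upwards [o.mem_nhds hz] with w hw
    simp only [OpenPartialHomeomorph.trans_source, OpenPartialHomeomorph.symm_source,
      Set.mem_inter_iff, Set.mem_preimage] at hw
    simp [e'.left_inv hw.2]
  have hh' : hessian (fun w => (potential h s β (e.symm w) : ℂ)) z =
      hessian (fun w => (potential h s β (e'.symm (e' (e.symm w))) : ℂ)) z := by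
    ext j k
    simp only [hessian, Matrix.of_apply, dz_eq_del, dzbar_eq_delbar]
    exact del_congr (delbar_eventuallyEq hev _) _
  rw [conicMetric_eq, conicMetric_eq, hh', hh, coeff_transition kf.form he he' hz]
  simp only [Matrix.mul_sub, Matrix.sub_mul, Matrix.mul_smul, Matrix.smul_mul]

end Metric

/-! ### Local equation of $D$ and local weight of $h$. -/

section LocalData

open Bundle

variable {n : ℕ} {X : Type*} [TopologicalSpace X] [ChartedSpace (Fin n → ℂ) X]
  {L : X → Type*} [TopologicalSpace (Bundle.TotalSpace ℂ L)]
  [∀ x, TopologicalSpace (L x)] [∀ x, AddCommGroup (L x)] [∀ x, Module ℂ (L x)]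
  [FiberBundle ℂ L] [VectorBundle ℂ ℂ L]

/-- The Hermitian metric is smooth only over $\mathbb R$, so its expression in a chart needs the
underlying real manifold structure. -/
theorem isManifold_real [IsManifold 𝓘(ℂ, Fin n → ℂ) ω X] :
    IsManifold 𝓘(ℝ, Fin n → ℂ) ∞ X := by
  refine isManifold_of_contDiffOn _ _ _ fun e e' he he' => ?_
  simpa [Function.comp_def] using (holomorphic_transition he he').restrict_scalars ℝ

theorem symm_section_eq {x₀ x : X} (hx : x ∈ (trivializationAt ℂ L x₀).baseSet) (v : L x) :
    v = (trivializationAt ℂ L x₀ (TotalSpace.mk' ℂ x v)).2 •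
      (trivializationAt ℂ L x₀).symm x 1 := by
  set t := trivializationAt ℂ L x₀
  have h1 : t.symm x (t (TotalSpace.mk' ℂ x v)).2 = v := t.symm_apply_apply_mk hx v
  have h2 : ∀ c : ℂ, t.symm x c = t.symmₗ ℂ x c := fun c => by
    rw [Trivialization.symmₗ_apply _ hx]
  conv_lhs => rw [← h1, h2]
  rw [h2, ← map_smul, smul_eq_mul, mul_one]

theorem symm_one_ne_zero {x₀ x : X} (hx : x ∈ (trivializationAt ℂ L x₀).baseSet) :
    (trivializationAt ℂ L x₀).symm x (1 : ℂ) ≠ 0 := by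
  set t := trivializationAt ℂ L x₀
  intro h
  have h2 : ∀ c : ℂ, t.symm x c = t.symmₗ ℂ x c := fun c => by
    rw [Trivialization.symmₗ_apply _ hx]
  have h3 := t.apply_mk_symm hx (1 : ℂ)
  have h4 := t.apply_mk_symm hx (0 : ℂ)
  rw [h] at h3
  rw [h2, map_zero] at h4
  have := h3.symm.trans h4
  simp at this

/-- Local form of the data: near every point `|s|² = |σ|² e^{-φ}` with `σ` holomorphic. -/
theorem exists_local_data [IsManifold 𝓘(ℂ, Fin n → ℂ) ω X]
    [ContMDiffVectorBundle ω ℂ L 𝓘(ℂ, Fin n → ℂ)] (h : HermitianMetric n L) {s : ∀ x, L x}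
    (hs : CutsSmoothDivisor n s) (x₀ : X) :
    ∃ (U : Set (Fin n → ℂ)) (σ : (Fin n → ℂ) → ℂ) (φ : (Fin n → ℂ) → ℝ),
      IsOpen U ∧ chartAt (Fin n → ℂ) x₀ x₀ ∈ U ∧ U ⊆ (chartAt (Fin n → ℂ) x₀).target ∧
      ContDiffOn ℂ ∞ σ U ∧ ContDiffOn ℝ ∞ φ U ∧
      (∀ z ∈ U, h.sq s ((chartAt (Fin n → ℂ) x₀).symm z) = ‖σ z‖ ^ 2 * Real.exp (-φ z)) ∧
      (∀ z ∈ U, s ((chartAt (Fin n → ℂ) x₀).symm z) = 0 ↔ σ z = 0) ∧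
      (σ (chartAt (Fin n → ℂ) x₀ x₀) = 0 → fderiv ℂ σ (chartAt (Fin n → ℂ) x₀ x₀) ≠ 0) := by
  have := isManifold_real (n := n) (X := X)
  set e := chartAt (Fin n → ℂ) x₀ with he
  set t := trivializationAt ℂ L x₀ with ht
  have hbase : IsOpen t.baseSet := t.open_baseSet
  let f : X → ℂ := fun x => (t (TotalSpace.mk' ℂ x (s x))).2
  let H : X → ℝ := fun x => (h.inner x (t.symm x 1) (t.symm x 1)).re
  have hs_eq : ∀ x ∈ t.baseSet, s x = f x • t.symm x (1 : ℂ) := fun x hx => symm_section_eq hx _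
  have hH : ∀ x ∈ t.baseSet, 0 < H x := fun x hx => h.pos x _ (symm_one_ne_zero hx)
  have hx₀ : x₀ ∈ t.baseSet := mem_baseSet_trivializationAt ℂ L x₀
  set U := e.target ∩ e.symm ⁻¹' t.baseSet with hU
  have oU : IsOpen U := e.symm.isOpen_inter_preimage hbase
  have maps : Set.MapsTo e.symm U t.baseSet := fun z hz => hz.2
  have hσm : ContMDiffOn 𝓘(ℂ, Fin n → ℂ) 𝓘(ℂ, ℂ) ω f t.baseSet :=
    (t.contMDiffOn_section_baseSet_iff (IB := 𝓘(ℂ, Fin n → ℂ)) (n := ω) (s := s)).1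
      hs.holomorphic.contMDiffOn
  have hes : ContMDiffOn 𝓘(ℂ, Fin n → ℂ) 𝓘(ℂ, Fin n → ℂ) ω e.symm U :=
    (contMDiffOn_chart_symm (x := x₀)).mono Set.inter_subset_left
  have hσ : ContDiffOn ℂ ω (fun z => f (e.symm z)) U :=
    contMDiffOn_iff_contDiffOn.1 (hσm.comp hes maps)
  have hesR : ContMDiffOn 𝓘(ℝ, Fin n → ℂ) 𝓘(ℝ, Fin n → ℂ) ∞ e.symm U :=
    (contMDiffOn_chart_symm (x := x₀)).mono Set.inter_subset_left
  have hφ : ContDiffOn ℝ ∞ (fun z => H (e.symm z)) U :=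
    contMDiffOn_iff_contDiffOn.1 ((h.smooth x₀).comp hesR maps)
  have hx₀e : x₀ ∈ e.source := mem_chart_source _ x₀
  -- The local frame has squared norm $H>0$ and $s$ is $f$ times it, so $|s|^2=|f|^2H$ and the
  -- weight is $\varphi=-\log H$.
  refine ⟨U, fun z => f (e.symm z), fun z => - Real.log (H (e.symm z)), oU,
    ⟨e.map_source hx₀e, by simpa [e.left_inv hx₀e] using hx₀⟩, Set.inter_subset_left,
    hσ.of_le le_top, (hφ.log fun z hz => (hH _ hz.2).ne').neg, fun z hz => ?_, fun z hz => ?_,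
    fun h0 => ?_⟩
  · rw [neg_neg, Real.exp_log (hH _ hz.2), HermitianMetric.sq, hs_eq _ hz.2]
    simp only [map_smul, LinearMap.map_smulₛₗ, LinearMap.smul_apply, smul_eq_mul]
    rw [← mul_assoc, mul_comm (conj _), Complex.mul_conj, Complex.re_ofReal_mul,
      Complex.normSq_eq_norm_sq]
  · rw [hs_eq _ hz.2, smul_eq_zero]
    simp [symm_one_ne_zero hz.2, ht]
  · have h1 := hs.transverse x₀ (by
      rw [hs_eq _ hx₀]; simp only [e.left_inv hx₀e] at h0; simp [h0])
    -- If $d\sigma$ vanished at the point, so would the manifold derivative of $f=\sigma\circ e$,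
    -- against transversality.
    contrapose! h1
    have hp : e x₀ ∈ U := ⟨e.map_source hx₀e, by simpa [e.left_inv hx₀e] using hx₀⟩
    have h2 : HasFDerivAt (fun z => f (e.symm z)) (0 : (Fin n → ℂ) →L[ℂ] ℂ) (e x₀) := by
      rw [← h1]
      exact ((hσ.contDiffAt (oU.mem_nhds hp)).differentiableAt (by simp)).hasFDerivAt
    have : IsManifold 𝓘(ℂ, Fin n → ℂ) 1 X := IsManifold.of_le (n := ω) le_top
    have h3 := (mdifferentiable_of_mem_atlas (I := 𝓘(ℂ, Fin n → ℂ))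
      (chart_mem_atlas (Fin n → ℂ) x₀)).mdifferentiableAt hx₀e
    have h4 := h2.hasMFDerivAt.comp x₀ h3.hasMFDerivAt
    have hev : f =ᶠ[nhds x₀] (fun z => f (e.symm z)) ∘ e := by
      filter_upwards [e.open_source.mem_nhds hx₀e] with w hw
      simp [e.left_inv hw]
    exact (h4.congr_of_eventuallyEq hev).mfderiv.trans (ContinuousLinearMap.zero_comp _)

end LocalData

/-! ### The complex Hessian of the potential. -/

section Potential

open Matrix

variable {n : ℕ}

/-- Dividing by $\sigma(p)$ moves the value at $p$ to $1$, inside the slit plane. Branches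
$l=\log\sigma$ give holomorphic powers $\sigma^{t}=e^{tl}$ off $D$. -/
theorem exists_log_branch {U : Set (Fin n → ℂ)} (hU : IsOpen U) {σ : (Fin n → ℂ) → ℂ}
    (hσ : ContDiffOn ℂ ∞ σ U) {p : Fin n → ℂ} (hp : p ∈ U) (h0 : σ p ≠ 0) :
    ∃ (W : Set (Fin n → ℂ)) (l : (Fin n → ℂ) → ℂ), IsOpen W ∧ p ∈ W ∧ W ⊆ U ∧
      ContDiffOn ℂ ∞ l W ∧ ∀ z ∈ W, Complex.exp (l z) = σ z := by
  have hc : ContDiffOn ℂ ∞ (fun z => σ z / σ p) U := hσ.div_const _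
  refine ⟨U ∩ (fun z => σ z / σ p) ⁻¹' Complex.slitPlane,
    fun z => Complex.log (σ z / σ p) + Complex.log (σ p),
    hc.continuousOn.isOpen_inter_preimage hU Complex.isOpen_slitPlane,
    ⟨hp, by simp [div_self h0]⟩, Set.inter_subset_left, ?_, ?_⟩
  · refine ContDiffOn.add ?_ contDiffOn_const
    intro z hz
    exact ((Complex.contDiffAt_log hz.2).comp_contDiffWithinAt z
      ((hc z hz.1).mono Set.inter_subset_left))
  · intro z hz
    have h1 : σ z / σ p ≠ 0 := Complex.slitPlane_ne_zero hz.2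
    rw [Complex.exp_add, Complex.exp_log h1, Complex.exp_log h0, div_mul_cancel₀ _ h0]

section RealFunction

variable {φ : (Fin n → ℂ) → ℝ} {W : Set (Fin n → ℂ)} (hW : IsOpen W)
include hW

omit hW in
theorem smooth_ofReal (hφ : ContDiffOn ℝ ∞ φ W) : ContDiffOn ℝ ∞ (fun z => (φ z : ℂ)) W :=
  Complex.ofRealCLM.contDiff.comp_contDiffOn hφ

theorem delbar_ofReal (hφ : ContDiffOn ℝ ∞ φ W) {z : Fin n → ℂ} (hz : z ∈ W) (v : Fin n → ℂ) :
    delbar v (fun w => (φ w : ℂ)) z = conj (del v (fun w => (φ w : ℂ)) z) := by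
  rw [← delbar_conj v (differentiableAt_of_smooth hW (smooth_ofReal hφ) hz)]
  simp

end RealFunction

theorem del_sub {f g : (Fin n → ℂ) → ℂ} {z : Fin n → ℂ} (v : Fin n → ℂ)
    (hf : DifferentiableAt ℝ f z) (hg : DifferentiableAt ℝ g z) :
    del v (fun w => f w - g w) z = del v f z - del v g z := by
  simp only [del, (hf.hasFDerivAt.fun_sub hg.hasFDerivAt).fderiv, _root_.sub_apply]; ring

theorem delbar_sub {f g : (Fin n → ℂ) → ℂ} {z : Fin n → ℂ} (v : Fin n → ℂ)
    (hf : DifferentiableAt ℝ f z) (hg : DifferentiableAt ℝ g z) :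
    delbar v (fun w => f w - g w) z = delbar v f z - delbar v g z := by
  simp only [delbar, (hf.hasFDerivAt.fun_sub hg.hasFDerivAt).fderiv, _root_.sub_apply]; ring

theorem del_delbar_sub {f g : (Fin n → ℂ) → ℂ} {W : Set (Fin n → ℂ)} (hW : IsOpen W)
    (hf : ContDiffOn ℝ ∞ f W) (hg : ContDiffOn ℝ ∞ g W)
    (v u : Fin n → ℂ) {z} (hz : z ∈ W) :
    del v (delbar u (fun w => f w - g w)) z = del v (delbar u f) z - del v (delbar u g) z := by
  have h1 : delbar u (fun w => f w - g w) =ᶠ[nhds z] fun w => delbar u f w - delbar u g w := by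
    filter_upwards [hW.mem_nhds hz] with w hw
    exact delbar_sub u (differentiableAt_of_smooth hW hf hw) (differentiableAt_of_smooth hW hg hw)
  rw [del_congr h1, del_sub v (differentiableAt_of_smooth hW (smooth_delbar hW hf u) hz)
    (differentiableAt_of_smooth hW (smooth_delbar hW hg u) hz)]

variable {W : Set (Fin n → ℂ)} {l : (Fin n → ℂ) → ℂ} {φ : (Fin n → ℂ) → ℝ} {β : ℝ}

/-- The function `exp (β (2 Re l - φ))`, that is `|s|^{2β}` for `s = e^l`. -/
noncomputable def powSq (l : (Fin n → ℂ) → ℂ) (φ : (Fin n → ℂ) → ℝ) (β : ℝ)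
    (z : Fin n → ℂ) : ℝ :=
  Real.exp (β * (2 * (l z).re - φ z))

/-- `∂_v log |s|²`. -/
noncomputable def delLog (l : (Fin n → ℂ) → ℂ) (φ : (Fin n → ℂ) → ℝ) (v z : Fin n → ℂ) : ℂ :=
  del v l z - del v (fun w => (φ w : ℂ)) z

theorem powSq_pos (z : Fin n → ℂ) : 0 < powSq l φ β z := Real.exp_pos _

theorem powSq_lt_one {z : Fin n → ℂ} (hβ : 0 < β) (h : 2 * (l z).re - φ z < 0) :
    powSq l φ β z < 1 := Real.exp_lt_one_iff.2 (mul_neg_of_pos_of_neg hβ h)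

/-- Exhibits the potential as a holomorphic function of the complex-valued expression $l+\bar
l-\varphi$, the form required by `del_delbar_comp`. -/
theorem ofReal_log_eq {z : Fin n → ℂ} (hβ : 0 < β) (h : 2 * (l z).re - φ z < 0) :
    ((Real.log (((1 - powSq l φ β z) / β) ^ 2) : ℝ) : ℂ) =
      2 * Complex.log (1 - Complex.exp (β * (l z + conj (l z) - φ z))) -
        2 * Real.log β := by
  have h1 := powSq_lt_one hβ h
  have h2 : (0 : ℝ) < 1 - powSq l φ β z := by linarith
  rw [Real.log_pow, Real.log_div h2.ne' hβ.ne']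
  have h3 : (1 - Complex.exp (β * (l z + conj (l z) - φ z))) = ((1 - powSq l φ β z : ℝ) : ℂ) := by
    rw [Complex.add_conj, powSq]
    push_cast
    rfl
  rw [h3, ← Complex.ofReal_log h2.le]
  push_cast
  ring

theorem hasDerivAt_logPotential {x : ℝ} (hβ : 0 < β) (hx : x < 0) (c : ℂ) :
    HasDerivAt (fun y : ℂ => 2 * Complex.log (1 - Complex.exp (β * y)) - c)
      (-(2 * β * Complex.exp (β * x) / (1 - Complex.exp (β * x)))) (x : ℂ) := by
  have h1 : HasDerivAt (fun y : ℂ => 1 - Complex.exp (β * y))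
      (-(Complex.exp (β * x) * (β * 1))) (x : ℂ) :=
    (((hasDerivAt_id (x : ℂ)).const_mul (β : ℂ)).cexp).const_sub 1
  have h2 : 1 - Complex.exp (β * x) = ((1 - Real.exp (β * x) : ℝ) : ℂ) := by push_cast; rfl
  have h3 : 0 < 1 - Real.exp (β * x) := by
    have := Real.exp_lt_one_iff.2 (mul_neg_of_pos_of_neg hβ hx); linarith
  have h4 : (1 - Complex.exp (β * x)) ∈ Complex.slitPlane := by
    rw [h2]; exact Complex.ofReal_mem_slitPlane.2 h3
  refine (((h1.clog h4).const_mul 2).sub_const c).congr_deriv ?_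
  ring

theorem hasDerivAt_deriv_logPotential {x : ℝ} (hβ : 0 < β) (hx : x < 0) :
    HasDerivAt (fun y : ℂ => -(2 * β * Complex.exp (β * y) / (1 - Complex.exp (β * y))))
      (-(2 * β ^ 2 * Complex.exp (β * x) / (1 - Complex.exp (β * x)) ^ 2)) (x : ℂ) := by
  have h0 : HasDerivAt (fun y : ℂ => Complex.exp (β * y))
      (Complex.exp (β * x) * (β * 1)) (x : ℂ) :=
    (((hasDerivAt_id (x : ℂ)).const_mul (β : ℂ)).cexp)
  have h2 : 1 - Complex.exp (β * x) = ((1 - Real.exp (β * x) : ℝ) : ℂ) := by push_cast; rfl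
  have h3 : 0 < 1 - Real.exp (β * x) := by
    have := Real.exp_lt_one_iff.2 (mul_neg_of_pos_of_neg hβ hx); linarith
  have h4 : (1 - Complex.exp (β * x)) ≠ 0 := by
    rw [h2]; exact_mod_cast h3.ne'
  refine ((h0.const_mul (2 * (β : ℂ))).div (h0.const_sub 1) h4).neg.congr_deriv ?_
  field_simp
  ring

section

variable (hW : IsOpen W) (hl : ContDiffOn ℂ ∞ l W) (hφ : ContDiffOn ℝ ∞ φ W) (hβ : 0 < β)
  (hneg : ∀ z ∈ W, 2 * (l z).re - φ z < 0) {Q : (Fin n → ℂ) → ℝ}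
  (hQ : ∀ z ∈ W, Q z = Real.log (((1 - powSq l φ β z) / β) ^ 2))

include hl hφ in
theorem smooth_powSq : ContDiffOn ℝ ∞ (powSq l φ β) W := by
  have h1 : ContDiffOn ℝ ∞ (fun z => (l z).re) W :=
    Complex.reCLM.contDiff.comp_contDiffOn (hl.restrict_scalars ℝ)
  exact (contDiffOn_const.mul ((contDiffOn_const.mul h1).sub hφ)).exp

include hl hφ hβ hneg hQ in
theorem smooth_potential : ContDiffOn ℝ ∞ (fun z => (Q z : ℂ)) W := by
  refine smooth_ofReal (ContDiffOn.congr ?_ hQ)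
  refine ContDiffOn.log (((contDiffOn_const.sub (smooth_powSq hl hφ)).div_const _).pow 2) ?_
  intro z hz
  have := powSq_lt_one hβ (hneg z hz)
  have h2 : 0 < (1 - powSq l φ β z) / β := div_pos (by linarith) hβ
  positivity

include hW hl hφ hβ hneg hQ in
-- Chain rule for $f(\tau)=2\log(1-e^{\beta\tau})-2\log\beta$ with $\tau=l+\bar l-\varphi$: here
-- $\partial\tau$ is `delLog`, and $\partial\bar\partial\tau=-\partial\bar\partial\varphi$ since $l$
-- is holomorphic.
theorem del_delbar_potential (v u : Fin n → ℂ) {z : Fin n → ℂ} (hz : z ∈ W) :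
    del v (delbar u (fun w => (Q w : ℂ))) z =
      -((2 * β ^ 2 * powSq l φ β z / (1 - powSq l φ β z) ^ 2 : ℝ) : ℂ) *
        (delLog l φ v z * conj (delLog l φ u z)) +
      ((2 * β * powSq l φ β z / (1 - powSq l φ β z) : ℝ) : ℂ) *
        del v (delbar u (fun w => (φ w : ℂ))) z := by
  have sl := smooth_of_holomorphic hl
  have slc := smooth_conj sl
  have sφ := smooth_ofReal hφ
  have sτ : ContDiffOn ℝ ∞ (fun w => l w + conj (l w) - (φ w : ℂ)) W := (sl.add slc).sub sφ
  have hreal : ∀ w, l w + conj (l w) - (φ w : ℂ) = ((2 * (l w).re - φ w : ℝ) : ℂ) := by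
    intro w; rw [Complex.add_conj]; push_cast; rfl
  have hev : (fun w => (Q w : ℂ)) =ᶠ[nhds z] fun w => (fun y : ℂ =>
      2 * Complex.log (1 - Complex.exp (β * y)) - 2 * Real.log β)
        (l w + conj (l w) - (φ w : ℂ)) := by
    filter_upwards [hW.mem_nhds hz] with w hw
    rw [hQ w hw, ofReal_log_eq hβ (hneg w hw)]
  have d1 := differentiableAt_of_smooth hW sl hz
  have d2 := differentiableAt_of_smooth hW slc hz
  have d3 := differentiableAt_of_smooth hW sφ hz
  have hbl : ∀ u, delbar u l z = 0 := fun u => (delbar_holomorphic_eventually hW hl u hz).eq_of_nhds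
  have e1 : del v (fun w => l w + conj (l w) - (φ w : ℂ)) z = delLog l φ v z := by
    rw [del_sub v (d1.fun_add d2) d3, del_add v d1 d2, del_conj v d1, hbl, delLog]; simp
  have e2 : delbar u (fun w => l w + conj (l w) - (φ w : ℂ)) z = conj (delLog l φ u z) := by
    rw [delbar_sub u (d1.fun_add d2) d3, delbar_add u d1 d2, delbar_conj u d1, hbl, delLog,
      delbar_ofReal hW hφ hz]; simp
  have e3 : del v (delbar u (fun w => l w + conj (l w) - (φ w : ℂ))) z =
      - del v (delbar u (fun w => (φ w : ℂ))) z := by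
    rw [del_delbar_sub hW (sl.add slc) sφ v u hz, del_delbar_add hW sl slc v u hz,
      del_delbar_holomorphic hW hl v u hz, del_delbar_conj hW sl v u hz,
      del_delbar_holomorphic hW hl u v hz]
    simp
  have hc := del_delbar_comp hW
    (φ := fun y : ℂ => 2 * Complex.log (1 - Complex.exp (β * y)) - 2 * Real.log β)
    (φ' := fun y : ℂ => -(2 * β * Complex.exp (β * y) / (1 - Complex.exp (β * y))))
    (φ'' := -(2 * β ^ 2 * Complex.exp (β * (2 * (l z).re - φ z : ℝ)) /
      (1 - Complex.exp (β * (2 * (l z).re - φ z : ℝ))) ^ 2))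
    (f := fun w => l w + conj (l w) - (φ w : ℂ)) ?_ (z := z) ?_ sτ v u hz
  rw [del_congr (delbar_eventuallyEq hev u)]
  refine hc.trans ?_
  rw [e1, e2, e3]
  · have h3 : Complex.exp (β * (2 * (l z).re - φ z : ℝ)) = ((powSq l φ β z : ℝ) : ℂ) := by
      rw [powSq]; push_cast; rfl
    simp only [hreal]
    rw [h3]
    push_cast
    ring
  · intro w hw
    rw [hreal]
    exact hasDerivAt_logPotential hβ (hneg w hw) _
  · rw [hreal]
    exact hasDerivAt_deriv_logPotential hβ (hneg z hz)

include hW hl hφ hβ hneg hQ in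
-- For $\kappa>0$ the second term is the nonnegative conic part; only the Hessian of $\varphi$ can
-- lower the metric below `Om`.
theorem herm_metric (Om : Matrix (Fin n) (Fin n) ℂ) (κ : ℝ) {z : Fin n → ℂ} (hz : z ∈ W)
    (u : Fin n → ℂ) :
    herm (Om - (κ : ℂ) • hessian (fun w => (Q w : ℂ)) z) u = herm Om u
      + ((κ * (2 * β ^ 2 * powSq l φ β z / (1 - powSq l φ β z) ^ 2) * ‖delLog l φ u z‖ ^ 2 : ℝ) : ℂ)
      - ((κ * (2 * β * powSq l φ β z / (1 - powSq l φ β z)) : ℝ) : ℂ) *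
          herm (hessian (fun w => (φ w : ℂ)) z) u := by
  have h1 : Om - (κ : ℂ) • hessian (fun w => (Q w : ℂ)) z = Om +
      (((κ * (2 * β ^ 2 * powSq l φ β z / (1 - powSq l φ β z) ^ 2) : ℝ) : ℂ) •
        (Matrix.of fun i j => delLog l φ (Pi.single i 1) z * conj (delLog l φ (Pi.single j 1) z)) +
      (-((κ * (2 * β * powSq l φ β z / (1 - powSq l φ β z)) : ℝ) : ℂ)) •
        hessian (fun w => (φ w : ℂ)) z) := by
    ext j k
    simp only [hessian, Matrix.sub_apply, Matrix.add_apply, Matrix.smul_apply, Matrix.of_apply,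
      smul_eq_mul, dz_eq_del, dzbar_eq_delbar,
      del_delbar_potential hW hl hφ hβ hneg hQ _ _ hz]
    push_cast
    ring
  have h2 : ∑ i, u i * delLog l φ (Pi.single i 1) z = delLog l φ u z := by
    simp only [delLog, mul_sub, Finset.sum_sub_distrib, ← dz_eq_del, ← del_eq_sum]
  rw [h1, herm_add, herm_add, herm_smul, herm_smul, herm_vecMulVec, h2, Complex.mul_conj,
    Complex.normSq_eq_norm_sq]
  push_cast
  ring

end

end Potential

/-! ### Uniform bounds for continuous matrix functions on compact sets. -/

section Compactness

variable {n : ℕ}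

theorem exists_matrix_bound {K : Set (Fin n → ℂ)} (hK : IsCompact K)
    {A : (Fin n → ℂ) → Matrix (Fin n) (Fin n) ℂ}
    (hA : ∀ i j, ContinuousOn (fun z => A z i j) K) :
    ∃ B > 0, ∀ z ∈ K, ∀ i j, ‖A z i j‖ ≤ B := by
  have h1 : ContinuousOn (fun z => fun i j => A z i j) K :=
    continuousOn_pi.2 fun i => continuousOn_pi.2 fun j => hA i j
  obtain ⟨B, hB⟩ := hK.exists_bound_of_continuousOn h1
  refine ⟨max B 1, by positivity, fun z hz i j => ?_⟩
  exact ((norm_le_pi_norm (fun j => A z i j) j).trans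
    (norm_le_pi_norm (fun i j => A z i j) i)).trans ((hB z hz).trans (le_max_left _ _))

theorem sqNorm_smul (M : Matrix (Fin n) (Fin n) ℂ) (c : ℝ) (u : Fin n → ℂ) :
    sqNorm M ((c : ℂ) • u) = c ^ 2 * sqNorm M u := by
  rw [sqNorm_eq_re_herm, sqNorm_eq_re_herm, herm_smul_vec, Complex.conj_ofReal,
    ← Complex.ofReal_mul, Complex.re_ofReal_mul, sq]

/-- Take the minimum over $K$ times the unit sphere, then use homogeneity in $u$. -/
theorem exists_sqNorm_lower_bound {K : Set (Fin n → ℂ)} (hK : IsCompact K)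
    {A : (Fin n → ℂ) → Matrix (Fin n) (Fin n) ℂ}
    (hA : ∀ i j, ContinuousOn (fun z => A z i j) K)
    (hpos : ∀ z ∈ K, ∀ u, u ≠ 0 → 0 < sqNorm (A z) u) :
    ∃ m > 0, ∀ z ∈ K, ∀ u, m * ‖u‖ ^ 2 ≤ sqNorm (A z) u := by
  have hS : IsCompact (K ×ˢ Metric.sphere (0 : Fin n → ℂ) 1) := hK.prod (isCompact_sphere _ _)
  have hc : ContinuousOn (fun q : (Fin n → ℂ) × (Fin n → ℂ) => sqNorm (A q.1) q.2)
      (K ×ˢ Metric.sphere (0 : Fin n → ℂ) 1) := by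
    have h1 : ∀ i j, ContinuousOn (fun q : (Fin n → ℂ) × (Fin n → ℂ) => A q.1 i j)
        (K ×ˢ Metric.sphere (0 : Fin n → ℂ) 1) := fun i j =>
      (hA i j).comp continuousOn_fst fun q hq => hq.1
    refine Complex.continuous_re.comp_continuousOn (continuousOn_finsetSum _ fun i _ =>
      continuousOn_finsetSum _ fun j _ => ((h1 i j).mul ?_).mul ?_)
    · fun_prop
    · exact (Complex.continuous_conj.comp ((continuous_apply j).comp continuous_snd)).continuousOn
  obtain ⟨m, hm, hmin⟩ : ∃ m > 0, ∀ q ∈ K ×ˢ Metric.sphere (0 : Fin n → ℂ) 1,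
      m ≤ sqNorm (A q.1) q.2 := by
    rcases (K ×ˢ Metric.sphere (0 : Fin n → ℂ) 1).eq_empty_or_nonempty with h | h
    · exact ⟨1, one_pos, by simp [h]⟩
    · obtain ⟨q, hq, hmin⟩ := hS.exists_isMinOn h hc
      refine ⟨_, hpos q.1 hq.1 q.2 ?_, hmin⟩
      intro h0
      have := hq.2
      simp [h0] at this
  refine ⟨m, hm, fun z hz u => ?_⟩
  by_cases hu : u = 0
  · simp [hu, sqNorm]
  have hu' : 0 < ‖u‖ := norm_pos_iff.2 hu
  have h2 := hmin (z, ((‖u‖⁻¹ : ℝ) : ℂ) • u) ⟨hz, by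
    rw [mem_sphere_zero_iff_norm, norm_smul, Complex.norm_real, norm_inv, norm_norm,
      inv_mul_cancel₀ hu'.ne']⟩
  simp only [sqNorm_smul] at h2
  rw [inv_pow, ← div_eq_inv_mul, le_div_iff₀ (by positivity)] at h2
  exact h2

end Compactness

/-! ### Normalization of the metric by a small factor. -/

section Rescaling

variable {n : ℕ}

theorem powSq_eq_rpow {l : (Fin n → ℂ) → ℂ} {φ : (Fin n → ℂ) → ℝ} {σ : ℂ} {z : Fin n → ℂ}
    (h : Complex.exp (l z) = σ) (β : ℝ) :
    (‖σ‖ ^ 2 * Real.exp (-φ z)) ^ β = powSq l φ β z := by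
  rw [← h, Complex.norm_exp, ← Real.exp_nat_mul, ← Real.exp_add, ← Real.exp_mul, powSq]
  congr 1
  push_cast
  ring

theorem log_sq_eq {l : (Fin n → ℂ) → ℂ} {φ : (Fin n → ℂ) → ℝ} {σ : ℂ} {z : Fin n → ℂ}
    (h : Complex.exp (l z) = σ) :
    ‖σ‖ ^ 2 * Real.exp (-φ z) = Real.exp (2 * (l z).re - φ z) := by
  rw [← h, Complex.norm_exp, ← Real.exp_nat_mul, ← Real.exp_add]
  congr 1

/-- Since $e^{-\beta x}\ge1+\beta T$, the quotient $e^{\beta x}/(1-e^{\beta x})=1/(e^{-\beta x}-1)$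
is at most $1/(\beta T)$. The factor $\beta$ cancels, which makes the normalization uniform in
$\beta$. -/
theorem two_mul_div_le {β T x : ℝ} (hβ : 0 < β) (hT : 0 < T) (hx : x ≤ -T) :
    2 * β * Real.exp (β * x) / (1 - Real.exp (β * x)) ≤ 2 / T := by
  have h1 : Real.exp (β * x) < 1 := Real.exp_lt_one_iff.2 (by nlinarith)
  have h2 : 1 + β * T ≤ Real.exp (-(β * x)) := by
    have := Real.add_one_le_exp (-(β * x)); nlinarith
  have h3 : Real.exp (β * x) * Real.exp (-(β * x)) = 1 := by rw [← Real.exp_add]; simp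
  rw [div_le_div_iff₀ (by linarith) hT]
  have := Real.exp_pos (β * x)
  nlinarith

theorem exists_local_normalization {κ : ℝ} (hκ : 0 < κ) {U : Set (Fin n → ℂ)} (hU : IsOpen U)
    {p : Fin n → ℂ} (hp : p ∈ U) {Om : (Fin n → ℂ) → Matrix (Fin n) (Fin n) ℂ}
    (hOm : SmoothMat U Om) (hpos : ∀ z ∈ U, ∀ u, u ≠ 0 → 0 < sqNorm (Om z) u)
    {σ : (Fin n → ℂ) → ℂ} {φ : (Fin n → ℂ) → ℝ} (hσ : ContDiffOn ℂ ∞ σ U)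
    (hφ : ContDiffOn ℝ ∞ φ U) :
    ∃ V ⊆ U, IsOpen V ∧ p ∈ V ∧ ∃ c₀ > 0, ∀ c, 0 < c → c ≤ c₀ → ∀ z ∈ V,
      c * (‖σ z‖ ^ 2 * Real.exp (-φ z)) < Real.exp (-1) ∧
      (σ z ≠ 0 → ∀ β > 0, ∀ Q : (Fin n → ℂ) → ℝ,
        (∀ w ∈ U, Q w = Real.log (((1 - (c * (‖σ w‖ ^ 2 * Real.exp (-φ w))) ^ β) / β) ^ 2)) →
        ContDiffAt ℝ ∞ (fun w => (Q w : ℂ)) z ∧ ∀ u, (1 / 2) * sqNorm (Om z) u ≤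
          sqNorm (Om z - (κ : ℂ) • hessian (fun w => (Q w : ℂ)) z) u) := by
  obtain ⟨r, hr, hrU⟩ := Metric.nhds_basis_closedBall.mem_iff.1 (hU.mem_nhds hp)
  have hK := isCompact_closedBall p r
  obtain ⟨m, hm, hlow⟩ := exists_sqNorm_lower_bound hK
    (fun i j => (hOm i j).continuousOn.mono hrU) (fun z hz => hpos z (hrU hz))
  obtain ⟨B, hB, hup⟩ := exists_matrix_bound hK (A := hessian fun w => (φ w : ℂ)) (by
    intro i j
    have h1 : ContDiffOn ℝ ∞ (dz i (dzbar j fun w => (φ w : ℂ))) U := by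
      rw [dz_eq_del, dzbar_eq_delbar]
      exact smooth_del hU (smooth_delbar hU (smooth_ofReal hφ) _) _
    exact h1.continuousOn.mono hrU)
  obtain ⟨M, hM⟩ := hK.exists_bound_of_continuousOn
    (f := fun z => ‖σ z‖ ^ 2 * Real.exp (-φ z)) (by
      have h1 := hσ.continuousOn.mono hrU
      have h2 := hφ.continuousOn.mono hrU
      exact (h1.norm.pow 2).mul (Real.continuous_exp.comp_continuousOn h2.neg))
  -- Chosen so that $\kappa(2/T)n^2B\le m/2$, half the lower bound of $\omega$; the summand $2$ also
  -- yields $e^{-T}<e^{-1}$.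
  set T : ℝ := 2 + 4 * κ * (n ^ 2 * B) / m with hT
  have hT2 : 2 ≤ T := by
    have : 0 ≤ 4 * κ * (n ^ 2 * B) / m := by positivity
    linarith
  refine ⟨Metric.ball p r, Metric.ball_subset_closedBall.trans hrU, Metric.isOpen_ball,
    Metric.mem_ball_self hr, Real.exp (-T) / (|M| + 1), by positivity, fun c hc hcc z hz => ?_⟩
  have hzK := Metric.ball_subset_closedBall hz
  have ht : ∀ w ∈ Metric.ball p r, c * (‖σ w‖ ^ 2 * Real.exp (-φ w)) ≤ Real.exp (-T) := by
    intro w hw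
    have h1 : ‖σ w‖ ^ 2 * Real.exp (-φ w) ≤ |M| + 1 := by
      have := (le_abs_self _).trans ((hM w (Metric.ball_subset_closedBall hw)).trans
        (le_abs_self M))
      linarith
    calc c * (‖σ w‖ ^ 2 * Real.exp (-φ w)) ≤ Real.exp (-T) / (|M| + 1) * (|M| + 1) :=
          mul_le_mul hcc h1 (by positivity) (by positivity)
      _ = _ := div_mul_cancel₀ _ (by positivity)
  refine ⟨(ht z hz).trans_lt (Real.exp_lt_exp.2 (by linarith)), fun hz0 β hβ Q hQ => ?_⟩
  obtain ⟨W, l, oW, hzW, hWU, hl, hle⟩ := exists_log_branch Metric.isOpen_ball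
    (hσ.mono (Metric.ball_subset_closedBall.trans hrU)) hz hz0
  have hWU' : W ⊆ U := hWU.trans (Metric.ball_subset_closedBall.trans hrU)
  -- The factor $c$ goes into the weight as the constant $-\log c$, which leaves
  -- $\partial\bar\partial\varphi$ and its bound $B$ unchanged.
  have hφ' : ContDiffOn ℝ ∞ (fun w => φ w - Real.log c) W :=
    (hφ.mono hWU').sub contDiffOn_const
  have hc_eq : ∀ w, c * (‖σ w‖ ^ 2 * Real.exp (-φ w)) =
      ‖σ w‖ ^ 2 * Real.exp (-(φ w - Real.log c)) := by
    intro w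
    rw [neg_sub, sub_eq_add_neg, Real.exp_add, Real.exp_log hc]; ring
  have hlt : ∀ w ∈ W, 2 * (l w).re - (φ w - Real.log c) ≤ -T := by
    intro w hw
    have h1 := ht w (hWU hw)
    rw [hc_eq, log_sq_eq (φ := fun w => φ w - Real.log c) (hle w hw), Real.exp_le_exp] at h1
    exact h1
  have hneg : ∀ w ∈ W, 2 * (l w).re - (φ w - Real.log c) < 0 := fun w hw => by
    have := hlt w hw; linarith
  have hQ' : ∀ w ∈ W, Q w = Real.log (((1 - powSq l (fun w => φ w - Real.log c) β w) / β) ^ 2) := by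
    intro w hw
    rw [hQ w (hWU' hw), hc_eq, powSq_eq_rpow (φ := fun w => φ w - Real.log c) (hle w hw)]
  refine ⟨(smooth_potential hl hφ' hβ hneg hQ').contDiffAt (oW.mem_nhds hzW), fun u => ?_⟩
  have hh : hessian (fun w => ((φ w - Real.log c : ℝ) : ℂ)) z = hessian (fun w => (φ w : ℂ)) z := by
    ext i j
    simp only [hessian, Matrix.of_apply, dz_eq_del, dzbar_eq_delbar, Complex.ofReal_sub]
    rw [del_delbar_sub oW (smooth_ofReal (hφ.mono hWU')) contDiffOn_const _ _ hzW]
    have : delbar (Pi.single j 1) (fun _ : Fin n → ℂ => ((Real.log c : ℝ) : ℂ)) = fun _ => 0 := by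
      funext w; simp
    rw [this]; simp
  rw [sqNorm_eq_re_herm, sqNorm_eq_re_herm,
    herm_metric oW hl hφ' hβ hneg hQ' (Om z) κ hzW u, hh, Complex.sub_re, Complex.add_re,
    Complex.ofReal_re, Complex.re_ofReal_mul]
  set P := powSq l (fun w => φ w - Real.log c) β z with hP
  have hP1 : P < 1 := powSq_lt_one hβ (hneg z hzW)
  have hP0 : 0 < P := powSq_pos z
  have hF : 2 * β * P / (1 - P) ≤ 2 / T := two_mul_div_le hβ (by linarith) (hlt z hzW)
  have hF0 : 0 ≤ 2 * β * P / (1 - P) := div_nonneg (by positivity) (by linarith)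
  have h1 := hlow z hzK u
  rw [sqNorm_eq_re_herm] at h1
  have h2 : (herm (hessian (fun w => (φ w : ℂ)) z) u).re ≤ n ^ 2 * (B * ‖u‖ ^ 2) :=
    (Complex.re_le_norm _).trans (norm_herm_le _ u (hup z hzK) le_rfl)
  have h3 : 0 ≤ κ * (2 * β ^ 2 * P / (1 - P) ^ 2) *
    ‖delLog l (fun w => φ w - Real.log c) u z‖ ^ 2 := by positivity
  have h4 : κ * (2 * β * P / (1 - P)) * (herm (hessian (fun w => (φ w : ℂ)) z) u).re ≤
      m / 2 * ‖u‖ ^ 2 := by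
    calc κ * (2 * β * P / (1 - P)) * (herm (hessian (fun w => (φ w : ℂ)) z) u).re
        ≤ κ * (2 * β * P / (1 - P)) * (n ^ 2 * (B * ‖u‖ ^ 2)) :=
          mul_le_mul_of_nonneg_left h2 (by positivity)
      _ ≤ κ * (2 / T) * (n ^ 2 * (B * ‖u‖ ^ 2)) := by gcongr
      _ = (2 * κ * (n ^ 2 * B)) / T * ‖u‖ ^ 2 := by ring
      _ ≤ m / 2 * ‖u‖ ^ 2 := by
          refine mul_le_mul_of_nonneg_right ?_ (by positivity)
          rw [div_le_div_iff₀ (by linarith) two_pos, hT]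
          have : m * (2 + 4 * κ * (n ^ 2 * B) / m) = 2 * m + 4 * κ * (n ^ 2 * B) := by
            field_simp
          rw [this]; nlinarith
  nlinarith

end Rescaling

/-! ### Families of functions with uniformly bounded jets in a direction. -/

section UniformJets

variable {n : ℕ} {ι : Type*}

/-- A family of complex numbers that is bounded. -/
def UnifBdd (a : ι → ℂ) : Prop := ∃ M : ℝ, ∀ i, ‖a i‖ ≤ M

namespace UnifBdd

variable {a b : ι → ℂ}

theorem add (ha : UnifBdd a) (hb : UnifBdd b) : UnifBdd fun i => a i + b i := by
  obtain ⟨A, hA⟩ := ha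
  obtain ⟨B, hB⟩ := hb
  exact ⟨A + B, fun i => (norm_add_le _ _).trans (add_le_add (hA i) (hB i))⟩

theorem mul (ha : UnifBdd a) (hb : UnifBdd b) : UnifBdd fun i => a i * b i := by
  obtain ⟨A, hA⟩ := ha
  obtain ⟨B, hB⟩ := hb
  refine ⟨A * B, fun i => ?_⟩
  rw [norm_mul]
  exact mul_le_mul (hA i) (hB i) (norm_nonneg _) ((norm_nonneg _).trans (hA i))

theorem neg (ha : UnifBdd a) : UnifBdd fun i => - a i := by
  obtain ⟨A, hA⟩ := ha
  exact ⟨A, fun i => by rw [norm_neg]; exact hA i⟩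

theorem conjugate (ha : UnifBdd a) : UnifBdd fun i => conj (a i) := by
  obtain ⟨A, hA⟩ := ha
  exact ⟨A, fun i => by rw [RCLike.norm_conj]; exact hA i⟩

theorem const (c : ℂ) : UnifBdd fun _ : ι => c := ⟨‖c‖, fun _ => le_rfl⟩

theorem sum {J : Type*} (s : Finset J) {f : J → ι → ℂ} (hf : ∀ j ∈ s, UnifBdd (f j)) :
    UnifBdd fun i => ∑ j ∈ s, f j i := by
  classical
  induction s using Finset.induction_on with
  | empty => simpa using const 0
  | insert a s ha ih =>
    simp only [Finset.sum_insert ha]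
    exact (hf a (by simp)).add (ih fun j hj => hf j (by simp [hj]))

end UnifBdd

/-- A family of points with open neighbourhoods and directions. -/
structure Probe (n : ℕ) (ι : Type*) where
  /-- the neighbourhoods -/
  W : ι → Set (Fin n → ℂ)
  /-- the points -/
  p : ι → Fin n → ℂ
  /-- the directions -/
  v : ι → Fin n → ℂ
  isOpen : ∀ i, IsOpen (W i)
  mem : ∀ i, p i ∈ W i

/-- A family of smooth functions whose value and derivatives `∂_v`, `∂̄_v`, `∂_v ∂̄_v` at the points
of a family of probes are bounded. -/
structure UnifJet (q : Probe n ι) (F : ι → (Fin n → ℂ) → ℂ) : Prop where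
  smooth : ∀ i, ContDiffOn ℝ ∞ (F i) (q.W i)
  val : UnifBdd fun i => F i (q.p i)
  del : UnifBdd fun i => del (q.v i) (F i) (q.p i)
  delbar : UnifBdd fun i => delbar (q.v i) (F i) (q.p i)
  del_delbar : UnifBdd fun i => ConicMetric.del (q.v i) (ConicMetric.delbar (q.v i) (F i)) (q.p i)

namespace UnifJet

variable {q : Probe n ι} {F G : ι → (Fin n → ℂ) → ℂ}

theorem diff (hF : UnifJet q F) (i : ι) : DifferentiableAt ℝ (F i) (q.p i) :=
  differentiableAt_of_smooth (q.isOpen i) (hF.smooth i) (q.mem i)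

theorem congr (hF : UnifJet q F) (h : ∀ i, ∀ z ∈ q.W i, G i z = F i z) : UnifJet q G := by
  have hev : ∀ i, G i =ᶠ[nhds (q.p i)] F i := fun i => by
    filter_upwards [(q.isOpen i).mem_nhds (q.mem i)] with z hz using h i z hz
  refine ⟨fun i => (hF.smooth i).congr (h i), ?_, ?_, ?_, ?_⟩
  · simpa only [fun i => h i _ (q.mem i)] using hF.val
  · simpa only [fun i => del_congr (hev i) (q.v i)] using hF.del
  · simpa only [fun i => delbar_congr (hev i) (q.v i)] using hF.delbar
  · simpa only [fun i => del_congr (delbar_eventuallyEq (hev i) (q.v i)) (q.v i)]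
      using hF.del_delbar

theorem add (hF : UnifJet q F) (hG : UnifJet q G) : UnifJet q fun i z => F i z + G i z := by
  refine ⟨fun i => (hF.smooth i).add (hG.smooth i), hF.val.add hG.val, ?_, ?_, ?_⟩
  · simpa only [fun i => del_add (q.v i) (hF.diff i) (hG.diff i)] using hF.del.add hG.del
  · simpa only [fun i => delbar_add (q.v i) (hF.diff i) (hG.diff i)]
      using hF.delbar.add hG.delbar
  · simpa only [fun i => del_delbar_add (q.isOpen i) (hF.smooth i) (hG.smooth i) (q.v i) (q.v i)
      (q.mem i)] using hF.del_delbar.add hG.del_delbar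

theorem mul (hF : UnifJet q F) (hG : UnifJet q G) : UnifJet q fun i z => F i z * G i z := by
  refine ⟨fun i => (hF.smooth i).mul (hG.smooth i), hF.val.mul hG.val, ?_, ?_, ?_⟩
  · simpa only [fun i => del_mul (q.v i) (hF.diff i) (hG.diff i)]
      using (hF.del.mul hG.val).add (hF.val.mul hG.del)
  · simpa only [fun i => delbar_mul (q.v i) (hF.diff i) (hG.diff i)]
      using (hF.delbar.mul hG.val).add (hF.val.mul hG.delbar)
  · simpa only [fun i => del_delbar_mul (q.isOpen i) (hF.smooth i) (hG.smooth i) (q.v i) (q.v i)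
      (q.mem i)] using (((hF.del_delbar.mul hG.val).add (hF.delbar.mul hG.del)).add
        (hF.del.mul hG.delbar)).add (hF.val.mul hG.del_delbar)

theorem conjugate (hF : UnifJet q F) : UnifJet q fun i z => conj (F i z) := by
  refine ⟨fun i => smooth_conj (hF.smooth i), hF.val.conjugate, ?_, ?_, ?_⟩
  · simpa only [fun i => del_conj (q.v i) (hF.diff i)] using hF.delbar.conjugate
  · simpa only [fun i => delbar_conj (q.v i) (hF.diff i)] using hF.del.conjugate
  · simpa only [fun i => del_delbar_conj (q.isOpen i) (hF.smooth i) (q.v i) (q.v i) (q.mem i)]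
      using hF.del_delbar.conjugate

theorem of_holomorphic (hF : ∀ i, ContDiffOn ℂ ∞ (F i) (q.W i))
    (h0 : UnifBdd fun i => F i (q.p i))
    (h1 : UnifBdd fun i => ConicMetric.del (q.v i) (F i) (q.p i)) : UnifJet q F := by
  refine ⟨fun i => smooth_of_holomorphic (hF i), h0, h1, ?_, ?_⟩
  · simpa only [fun i => (delbar_holomorphic_eventually (q.isOpen i) (hF i) (q.v i)
      (q.mem i)).eq_of_nhds] using UnifBdd.const 0
  · simpa only [fun i => del_delbar_holomorphic (q.isOpen i) (hF i) (q.v i) (q.v i) (q.mem i)]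
      using UnifBdd.const 0

theorem const {c : ι → ℂ} (hc : UnifBdd c) : UnifJet q fun i _ => c i :=
  of_holomorphic (fun _ => contDiffOn_const) hc (by simpa using UnifBdd.const 0)

theorem neg (hF : UnifJet q F) : UnifJet q fun i z => - F i z :=
  ((const (UnifBdd.const (-1))).mul hF).congr fun i z _ => by ring

theorem sub (hF : UnifJet q F) (hG : UnifJet q G) : UnifJet q fun i z => F i z - G i z :=
  (hF.add hG.neg).congr fun i z _ => by ring

theorem sum {J : Type*} (s : Finset J) {f : J → ι → (Fin n → ℂ) → ℂ}
    (hf : ∀ j ∈ s, UnifJet q (f j)) : UnifJet q fun i z => ∑ j ∈ s, f j i z := by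
  classical
  induction s using Finset.induction_on with
  | empty => simpa using const (UnifBdd.const 0)
  | insert a s ha ih =>
    simp only [Finset.sum_insert ha]
    exact (hf a (by simp)).add (ih fun j hj => hf j (by simp [hj]))

/-- Composition with outer holomorphic functions. -/
theorem comp (hF : UnifJet q F) {φ φ' : ι → ℂ → ℂ} {φ'' : ι → ℂ}
    (hs : ∀ i, ContDiffOn ℝ ∞ (fun z => φ i (F i z)) (q.W i))
    (h1 : ∀ i, ∀ z ∈ q.W i, HasDerivAt (φ i) (φ' i (F i z)) (F i z))
    (h2 : ∀ i, HasDerivAt (φ' i) (φ'' i) (F i (q.p i)))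
    (b0 : UnifBdd fun i => φ i (F i (q.p i))) (b1 : UnifBdd fun i => φ' i (F i (q.p i)))
    (b2 : UnifBdd φ'') : UnifJet q fun i z => φ i (F i z) := by
  refine ⟨hs, b0, ?_, ?_, ?_⟩
  · simpa only [fun i => del_comp_of_hasDerivAt (q.v i) (h1 i _ (q.mem i)) (hF.diff i)]
      using b1.mul hF.del
  · simpa only [fun i => delbar_comp_of_hasDerivAt (q.v i) (h1 i _ (q.mem i)) (hF.diff i)]
      using b1.mul hF.delbar
  · simpa only [fun i => del_delbar_comp (q.isOpen i) (h1 i) (h2 i) (hF.smooth i) (q.v i) (q.v i)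
      (q.mem i)] using ((b2.mul hF.del).mul hF.delbar).add (b1.mul hF.del_delbar)

theorem inv (hF : UnifJet q F) (h0 : ∀ i, ∀ z ∈ q.W i, F i z ≠ 0)
    (hb : UnifBdd fun i => (F i (q.p i))⁻¹) : UnifJet q fun i z => (F i z)⁻¹ := by
  refine hF.comp (φ := fun _ y => y⁻¹) (φ' := fun _ y => -(y⁻¹ * y⁻¹))
    (φ'' := fun i => 2 * ((F i (q.p i))⁻¹ * ((F i (q.p i))⁻¹ * (F i (q.p i))⁻¹)))
    (fun i => (hF.smooth i).inv (h0 i)) ?_ ?_ hb (hb.mul hb).neg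
    ((UnifBdd.const 2).mul (hb.mul (hb.mul hb)))
  · intro i z hz
    refine (hasDerivAt_inv (h0 i z hz)).congr_deriv ?_
    rw [sq, mul_inv]
  · intro i
    have hd := hasDerivAt_inv (h0 i _ (q.mem i))
    refine (hd.mul hd).neg.congr_deriv ?_
    ring

/-- A fixed smooth function has uniformly bounded jets at points of a compact set. -/
theorem of_smooth {U K : Set (Fin n → ℂ)} (hU : IsOpen U) (hK : IsCompact K) (hKU : K ⊆ U)
    {f : (Fin n → ℂ) → ℂ} (hf : ContDiffOn ℝ ∞ f U) (hWU : ∀ i, q.W i ⊆ U)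
    (hp : ∀ i, q.p i ∈ K) (hv : ∀ j, UnifBdd fun i => q.v i j) : UnifJet q fun _ => f := by
  have hb : ∀ {g : (Fin n → ℂ) → ℂ}, ContDiffOn ℝ ∞ g U → UnifBdd fun i => g (q.p i) := by
    intro g hg
    obtain ⟨C, hC⟩ := hK.exists_bound_of_continuousOn (hg.continuousOn.mono hKU)
    exact ⟨C, fun i => hC _ (hp i)⟩
  have s1 : ∀ j, ContDiffOn ℝ ∞ (dz j f) U := fun j => by
    rw [dz_eq_del]; exact smooth_del hU hf _
  have s2 : ∀ j, ContDiffOn ℝ ∞ (dzbar j f) U := fun j => by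
    rw [dzbar_eq_delbar]; exact smooth_delbar hU hf _
  refine ⟨fun i => hf.mono (hWU i), hb hf, ?_, ?_, ?_⟩
  · simp only [del_eq_sum]
    exact UnifBdd.sum _ fun j _ => (hv j).mul (hb (s1 j))
  · simp only [delbar_eq_sum]
    exact UnifBdd.sum _ fun j _ => (hv j).conjugate.mul (hb (s2 j))
  · simp only [fun i => del_delbar_eq_sum hU hf (q.v i) (hKU (hp i))]
    refine UnifBdd.sum _ fun k _ => UnifBdd.sum _ fun j _ => ((hv k).mul (hv j).conjugate).mul (hb ?_)
    rw [dz_eq_del]; exact smooth_del hU (s2 j) _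

end UnifJet

open Matrix

/-- The $i$-th row $y$ of $A^{-1}$ solves $yA=e_i$, so coercivity reads
$c\|y\|^2\le\mathrm{Re}\,\bar y_i\le\|y\|$. -/
theorem norm_inv_apply_le {A : Matrix (Fin n) (Fin n) ℂ} {c : ℝ} (hc : 0 < c)
    (h : ∀ y, c * ‖y‖ ^ 2 ≤ sqNorm A y) : IsUnit A.det ∧ ∀ i j, ‖A⁻¹ i j‖ ≤ c⁻¹ := by
  have hu : IsUnit A := by
    rw [← Matrix.vecMul_injective_iff_isUnit]
    intro x y hxy
    have h1 : (x - y) ᵥ* A = 0 := by rw [Matrix.sub_vecMul]; exact sub_eq_zero.2 hxy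
    have h2 := h (x - y)
    rw [sqNorm_eq_re_herm, herm_eq_dotProduct, h1, zero_dotProduct, Complex.zero_re] at h2
    have h3 : ‖x - y‖ ^ 2 ≤ 0 := by nlinarith
    have h4 : ‖x - y‖ = 0 := by nlinarith [norm_nonneg (x - y)]
    exact sub_eq_zero.1 (norm_eq_zero.1 h4)
  have hd := (Matrix.isUnit_iff_isUnit_det _).1 hu
  refine ⟨hd, fun i j => ?_⟩
  set y : Fin n → ℂ := (Pi.single i 1 : Fin n → ℂ) ᵥ* A⁻¹ with hy
  have h1 : y ᵥ* A = Pi.single i 1 := by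
    rw [hy, vecMul_vecMul, Matrix.nonsing_inv_mul _ hd, vecMul_one]
  have h2 := h y
  rw [sqNorm_eq_re_herm, herm_eq_dotProduct, h1, single_one_dotProduct] at h2
  have h3 : (star y i).re ≤ ‖y‖ := (Complex.re_le_norm _).trans (by
    rw [Pi.star_apply, norm_star]; exact norm_le_pi_norm y i)
  have h4 : ‖y‖ ≤ c⁻¹ := by
    rw [← one_div, le_div_iff₀ hc]
    by_contra! hlt
    have h5 : 0 < ‖y‖ := by
      rcases (norm_nonneg y).eq_or_lt with h | h
      · rw [← h] at hlt; linarith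
      · exact h
    nlinarith
  have h6 : y j = A⁻¹ i j := by rw [hy, single_one_vecMul]; rfl
  rw [← h6]
  exact (norm_le_pi_norm y j).trans h4

/-- A uniform bound for the curvature of metrics with uniformly bounded jets which are uniformly
bounded below. -/
theorem exists_chernForm_bound {q : Probe n ι} {G : ι → (Fin n → ℂ) → Matrix (Fin n) (Fin n) ℂ}
    (hG : ∀ j k, UnifJet q fun i z => G i z j k) {c : ℝ} (hc : 0 < c)
    (h : ∀ i y, c * ‖y‖ ^ 2 ≤ sqNorm (G i (q.p i)) y) :
    ∃ B, ∀ i j k, ‖chernForm (q.v i) (G i) (q.p i) j k‖ ≤ B := by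
  have hinv : ∀ a b, UnifBdd fun i => (G i (q.p i))⁻¹ a b := fun a b =>
    ⟨c⁻¹, fun i => (norm_inv_apply_le hc (h i)).2 a b⟩
  have hb : ∀ j k, UnifBdd fun i => chernForm (q.v i) (G i) (q.p i) j k := by
    intro j k
    simp only [chernForm, Matrix.add_apply, Matrix.neg_apply, Matrix.mul_apply]
    refine (hG j k).del_delbar.neg.add (UnifBdd.sum _ fun b _ => UnifBdd.mul
      (UnifBdd.sum _ fun a _ => UnifBdd.mul ?_ (hinv a b)) ?_)
    · exact (hG j a).del
    · exact (hG b k).delbar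
  choose B hB using hb
  refine ⟨∑ j, ∑ k, |B j k|, fun i j k => (hB j k i).trans ((le_abs_self _).trans ?_)⟩
  exact (Finset.single_le_sum (f := fun k => |B j k|) (fun _ _ => abs_nonneg _)
    (Finset.mem_univ k)).trans (Finset.single_le_sum (f := fun j => ∑ k, |B j k|)
      (fun _ _ => Finset.sum_nonneg fun _ _ => abs_nonneg _) (Finset.mem_univ j))

end UniformJets

/-! ### Cone metrics with a varying angle: the basic estimates. -/

open Matrix

/-- A family of points and directions for the reference conic metrics
`Om + ∂∂̄`-terms with varying cone angle, in a coordinate domain `U` in which the section is `σ` and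
the weight of the Hermitian metric is `φ`. -/
structure ConeFamily (n : ℕ) (ι : Type*) extends Probe n ι where
  U : Set (Fin n → ℂ)
  K : Set (Fin n → ℂ)
  Om : (Fin n → ℂ) → Matrix (Fin n) (Fin n) ℂ
  σ : (Fin n → ℂ) → ℂ
  φ : (Fin n → ℂ) → ℝ
  i₀ : Fin n
  κ : ℝ
  m : ℝ
  β : ι → ℝ
  l : ι → (Fin n → ℂ) → ℂ
  Q : ι → (Fin n → ℂ) → ℝ
  isOpen_U : IsOpen U
  isCompact_K : IsCompact K
  K_subset : K ⊆ U
  W_subset : ∀ i, W i ⊆ U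
  p_mem : ∀ i, p i ∈ K
  smooth_Om : SmoothMat U Om
  hol_σ : ContDiffOn ℂ ∞ σ U
  smooth_φ : ContDiffOn ℝ ∞ φ U
  dz_σ_ne : ∀ z ∈ U, dz i₀ σ z ≠ 0
  κ_pos : 0 < κ
  m_pos : 0 < m
  β_pos : ∀ i, 0 < β i
  β_le : ∀ i, β i ≤ 1 / 2
  hol_l : ∀ i, ContDiffOn ℂ ∞ (l i) (W i)
  exp_l : ∀ i, ∀ z ∈ W i, Complex.exp (l i z) = σ z
  lt_neg_one : ∀ i, ∀ z ∈ W i, 2 * (l i z).re - φ z < -1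
  Q_eq : ∀ i, ∀ z ∈ W i, Q i z = Real.log (((1 - powSq (l i) φ (β i) z) / β i) ^ 2)
  lower : ∀ i u, m * ‖u‖ ^ 2 ≤ sqNorm (Om (p i) - (κ : ℂ) • hessian (fun w => (Q i w : ℂ)) (p i)) u
  v_unit : ∀ i, sqNorm (Om (p i) - (κ : ℂ) • hessian (fun w => (Q i w : ℂ)) (p i)) (v i) = 1

namespace ConeFamily

variable {n : ℕ} {ι : Type*} (c : ConeFamily n ι)

/-- The metrics of the family. -/
noncomputable def metric (i : ι) (z : Fin n → ℂ) : Matrix (Fin n) (Fin n) ℂ :=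
  c.Om z - (c.κ : ℂ) • hessian (fun w => (c.Q i w : ℂ)) z

/-- `ε = 1 - |s|^{2β}` at the point. -/
noncomputable def eps (i : ι) : ℝ := 1 - powSq (c.l i) c.φ (c.β i) (c.p i)

/-- A branch of `σ^β`. -/
noncomputable def w (i : ι) (z : Fin n → ℂ) : ℂ := Complex.exp (c.β i * c.l i z)

/-- `(β / ε) σ^{β - 1}`, so that `b dσ = dw / ε`. -/
noncomputable def b (i : ι) (z : Fin n → ℂ) : ℂ := c.β i / c.eps i * Complex.exp ((c.β i - 1) * c.l i z)

/-- The inverse of `b`. -/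
noncomputable def a (i : ι) (z : Fin n → ℂ) : ℂ := c.eps i / c.β i * Complex.exp ((1 - c.β i) * c.l i z)

theorem neg (i : ι) (z : Fin n → ℂ) (hz : z ∈ c.W i) : 2 * (c.l i z).re - c.φ z < 0 :=
  (c.lt_neg_one i z hz).trans (by norm_num)

/-- The normalization gives $\log|s|^2<-1$, so $P\le e^{-\beta}\le1/(1+\beta)\le1-\beta/2$. Hence
$\beta/\varepsilon$ stays bounded as $\beta\to0$. -/
theorem half_β_le_eps (i : ι) : c.β i / 2 ≤ c.eps i := by
  have h1 := c.lt_neg_one i _ (c.mem i)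
  have hb := c.β_pos i
  have hb2 := c.β_le i
  have h2 : powSq (c.l i) c.φ (c.β i) (c.p i) ≤ Real.exp (-c.β i) :=
    Real.exp_le_exp.2 (by nlinarith)
  have h3 : Real.exp (-c.β i) ≤ 1 - c.β i / 2 := by
    have h4 : Real.exp (-c.β i) * Real.exp (c.β i) = 1 := by rw [← Real.exp_add]; simp
    have h5 := Real.add_one_le_exp (c.β i)
    have h6 := Real.exp_pos (-c.β i)
    nlinarith
  rw [eps]; linarith

theorem eps_pos (i : ι) : 0 < c.eps i :=
  (half_pos (c.β_pos i)).trans_le (c.half_β_le_eps i)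

theorem eps_le_one (i : ι) : c.eps i ≤ 1 := by
  have := powSq_pos (l := c.l i) (φ := c.φ) (β := c.β i) (c.p i)
  rw [eps]; linarith

theorem ratio_le (i : ι) : c.β i / c.eps i ≤ 2 := by
  rw [div_le_iff₀ (c.eps_pos i)]
  linarith [c.half_β_le_eps i]

theorem unifBdd_eps : UnifBdd fun i => (c.eps i : ℂ) :=
  ⟨1, fun i => by
    rw [Complex.norm_real, Real.norm_of_nonneg (c.eps_pos i).le]; exact c.eps_le_one i⟩

theorem unifBdd_β : UnifBdd fun i => (c.β i : ℂ) :=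
  ⟨1, fun i => by
    rw [Complex.norm_real, Real.norm_of_nonneg (c.β_pos i).le]; linarith [c.β_le i]⟩

theorem unifBdd_ratio : UnifBdd fun i => ((c.β i : ℂ) / c.eps i) :=
  ⟨2, fun i => by
    beta_reduce
    rw [← Complex.ofReal_div, Complex.norm_real,
      Real.norm_of_nonneg (div_pos (c.β_pos i) (c.eps_pos i)).le]
    exact c.ratio_le i⟩

theorem exists_φ_bound : ∃ M ≥ 0, ∀ z ∈ c.K, |c.φ z| ≤ M := by
  obtain ⟨M, hM⟩ := c.isCompact_K.exists_bound_of_continuousOn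
    (c.smooth_φ.continuousOn.mono c.K_subset)
  exact ⟨|M|, abs_nonneg _, fun z hz => (hM z hz).trans (le_abs_self _)⟩

theorem a_mul_b (i : ι) (z : Fin n → ℂ) : c.a i z * c.b i z = 1 := by
  have h1 : (c.β i : ℂ) ≠ 0 := by exact_mod_cast (c.β_pos i).ne'
  have h2 : (c.eps i : ℂ) ≠ 0 := by exact_mod_cast (c.eps_pos i).ne'
  have h3 : Complex.exp ((1 - c.β i) * c.l i z) * Complex.exp ((c.β i - 1) * c.l i z) = 1 := by
    rw [← Complex.exp_add]; ring_nf; simp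
  rw [a, b]
  have h4 : (c.eps i : ℂ) / c.β i * (c.β i / c.eps i) = 1 := by field_simp
  linear_combination h3 + Complex.exp ((1 - c.β i) * c.l i z) *
    Complex.exp ((c.β i - 1) * c.l i z) * h4

theorem b_mul_σ (i : ι) {z : Fin n → ℂ} (hz : z ∈ c.W i) :
    c.b i z * c.σ z = c.β i / c.eps i * c.w i z := by
  rw [← c.exp_l i z hz, b, w, mul_assoc, ← Complex.exp_add]; ring_nf

theorem σ_ne (i : ι) {z : Fin n → ℂ} (hz : z ∈ c.W i) : c.σ z ≠ 0 := by
  rw [← c.exp_l i z hz]; exact Complex.exp_ne_zero _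

theorem hol_exp_mul_l (i : ι) (t : ℂ) :
    ContDiffOn ℂ ∞ (fun z => Complex.exp (t * c.l i z)) (c.W i) :=
  (contDiffOn_const.mul (c.hol_l i)).cexp

theorem del_exp_mul_l (i : ι) (t : ℂ) {z : Fin n → ℂ} (hz : z ∈ c.W i) (u : Fin n → ℂ) :
    del u (fun z => Complex.exp (t * c.l i z)) z =
      Complex.exp (t * c.l i z) * t * del u (c.l i) z := by
  have hd : HasDerivAt (fun y : ℂ => Complex.exp (t * y)) (Complex.exp (t * c.l i z) * (t * 1))
      (c.l i z) := ((hasDerivAt_id _).const_mul t).cexp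
  rw [del_comp_of_hasDerivAt u hd (differentiableAt_of_smooth (c.isOpen i)
    (smooth_of_holomorphic (c.hol_l i)) hz), mul_one]

theorem del_l (i : ι) {z : Fin n → ℂ} (hz : z ∈ c.W i) (u : Fin n → ℂ) :
    del u (c.l i) z = del u c.σ z / c.σ z := by
  have hev : c.σ =ᶠ[nhds z] fun z => Complex.exp (1 * c.l i z) := by
    filter_upwards [(c.isOpen i).mem_nhds hz] with y hy
    rw [one_mul, c.exp_l i y hy]
  rw [del_congr hev, c.del_exp_mul_l i 1 hz u, one_mul, c.exp_l i z hz, mul_one,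
    mul_div_cancel_left₀ _ (c.σ_ne i hz)]

/-- $|w|^2=|s|^{2\beta}e^{\beta\varphi}$, with $|s|<1$ and $0<\beta<1$. -/
theorem norm_w_sq_le {M : ℝ} (hM0 : 0 ≤ M) (hM : ∀ z ∈ c.K, |c.φ z| ≤ M) (i : ι) :
    ‖c.w i (c.p i)‖ ^ 2 ≤ Real.exp M := by
  have h1 := c.lt_neg_one i _ (c.mem i)
  have h2 := (le_abs_self _).trans (hM _ (c.p_mem i))
  rw [w, Complex.norm_exp, ← Real.exp_nat_mul]
  refine Real.exp_le_exp.2 ?_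
  have hb := c.β_pos i
  have hb2 := c.β_le i
  simp only [Complex.mul_re, Complex.ofReal_re, Complex.ofReal_im, zero_mul, sub_zero]
  push_cast
  nlinarith

theorem unifBdd_w : UnifBdd fun i => c.w i (c.p i) := by
  obtain ⟨M, hM0, hM⟩ := c.exists_φ_bound
  refine ⟨Real.exp M, fun i => ?_⟩
  have h1 := c.norm_w_sq_le hM0 hM i
  have h2 := Real.one_le_exp hM0
  nlinarith [norm_nonneg (c.w i (c.p i))]

theorem powSq_eq_norm (i : ι) (z : Fin n → ℂ) :
    (powSq (c.l i) c.φ (c.β i) z : ℂ) =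
      c.w i z * conj (c.w i z) * Complex.exp (-c.β i * c.φ z) := by
  rw [powSq, w, ← Complex.exp_conj, ← Complex.exp_add, ← Complex.exp_add, map_mul,
    Complex.conj_ofReal, ← mul_add, Complex.add_conj]
  push_cast
  congr 1
  ring

/-- Two regimes. For $\beta$ away from $0$, $e\le1$ bounds $e/\beta$ while the exponential may fail
to decay (at $\beta=\frac12$ it is $1$). For small $\beta$, $e/\beta$ may grow like $T$, but the
exponential is at most $e^{-T/4}$. -/
theorem eps_sq_mul_exp_le {β T e : ℝ} (hβ : 0 < β) (hβ2 : β ≤ 1 / 2) (hT : 0 < T) (he0 : 0 ≤ e)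
    (he1 : e ≤ 1) (he : e ≤ β * T) : (e / β) ^ 2 * Real.exp (-(1 - 2 * β) * T / 2) ≤ 64 := by
  have h0 : 0 ≤ e / β := by positivity
  rcases le_or_gt (1 / 4) β with h | h
  · have h1 : e / β ≤ 4 := by rw [div_le_iff₀ hβ]; linarith
    have h2 : Real.exp (-(1 - 2 * β) * T / 2) ≤ 1 := Real.exp_le_one_iff.2 (by nlinarith)
    have h3 := Real.exp_pos (-(1 - 2 * β) * T / 2)
    nlinarith
  · have h1 : e / β ≤ T := by rw [div_le_iff₀ hβ]; linarith
    have h2 : Real.exp (-(1 - 2 * β) * T / 2) ≤ Real.exp (-(T / 8)) ^ 2 := by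
      rw [← Real.exp_nat_mul]
      refine Real.exp_le_exp.2 ?_
      push_cast
      nlinarith
    have h3 : T * Real.exp (-(T / 8)) ≤ 8 := by
      have h4 := Real.add_one_le_exp (T / 8)
      have h5 : Real.exp (-(T / 8)) * Real.exp (T / 8) = 1 := by rw [← Real.exp_add]; simp
      have h6 := Real.exp_pos (-(T / 8))
      nlinarith
    calc (e / β) ^ 2 * Real.exp (-(1 - 2 * β) * T / 2)
        ≤ T ^ 2 * Real.exp (-(T / 8)) ^ 2 := by gcongr
      _ = (T * Real.exp (-(T / 8))) ^ 2 := by ring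
      _ ≤ 8 ^ 2 := by
          have := Real.exp_pos (-(T / 8))
          gcongr
      _ = 64 := by norm_num

/-- The key estimate `|a|² ≤ C |σ|`; this is where `β ≤ 1/2` is used. -/
theorem unifBdd_a_sq_div : UnifBdd fun i => c.a i (c.p i) ^ 2 / c.σ (c.p i) := by
  obtain ⟨M, hM0, hM⟩ := c.exists_φ_bound
  refine ⟨64 * Real.exp M, fun i => ?_⟩
  set T := -(2 * (c.l i (c.p i)).re - c.φ (c.p i)) with hT
  have hT1 : 1 < T := by have := c.lt_neg_one i _ (c.mem i); linarith
  have hb := c.β_pos i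
  have hb2 := c.β_le i
  have he : c.eps i ≤ c.β i * T := by
    have h1 := Real.add_one_le_exp (-(c.β i * T))
    have h2 : c.eps i = 1 - Real.exp (-(c.β i * T)) := by
      rw [eps, powSq, hT]; congr 2; ring
    linarith
  -- With $|\sigma|=e^{\mathrm{Re}\,l}$ this is $(\varepsilon/\beta)^2|\sigma|^{1-2\beta}$. Here
  -- $T=-\log|s|^2$, so $|\sigma|^{1-2\beta}$ equals $e^{-(1-2\beta)T/2}$ up to a bounded factor
  -- coming from $\varphi$.
  have hn : ‖c.a i (c.p i) ^ 2 / c.σ (c.p i)‖ =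
      (c.eps i / c.β i) ^ 2 * Real.exp ((1 - 2 * c.β i) * (c.l i (c.p i)).re) := by
    have h1 : c.a i (c.p i) ^ 2 / c.σ (c.p i) =
        ((c.eps i / c.β i : ℝ) : ℂ) ^ 2 * Complex.exp ((1 - 2 * c.β i : ℝ) * c.l i (c.p i)) := by
      rw [← c.exp_l i _ (c.mem i), a, mul_pow, ← Complex.exp_nat_mul, mul_div_assoc,
        ← Complex.exp_sub]
      push_cast
      congr 2
      ring
    rw [h1, norm_mul, norm_pow, Complex.norm_real, Complex.norm_exp, Complex.re_ofReal_mul,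
      Real.norm_of_nonneg (div_pos (c.eps_pos i) hb).le]
  rw [hn]
  have hl : (1 - 2 * c.β i) * (c.l i (c.p i)).re =
      -(1 - 2 * c.β i) * T / 2 + (1 - 2 * c.β i) * c.φ (c.p i) / 2 := by rw [hT]; ring
  have h2 := (le_abs_self _).trans (hM _ (c.p_mem i))
  have h3 : Real.exp ((1 - 2 * c.β i) * c.φ (c.p i) / 2) ≤ Real.exp M :=
    Real.exp_le_exp.2 (by nlinarith)
  rw [hl, Real.exp_add, ← mul_assoc]
  exact mul_le_mul (eps_sq_mul_exp_le hb hb2 (by linarith) (c.eps_pos i).le (c.eps_le_one i) he)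
    h3 (Real.exp_pos _).le (by norm_num)

theorem unifBdd_σ : UnifBdd fun i => c.σ (c.p i) := by
  obtain ⟨C, hC⟩ := c.isCompact_K.exists_bound_of_continuousOn
    (c.hol_σ.continuousOn.mono c.K_subset)
  exact ⟨C, fun i => hC _ (c.p_mem i)⟩

/-- Write $a^2=(a^2/\sigma)\,\sigma$. -/
theorem unifBdd_a : UnifBdd fun i => c.a i (c.p i) := by
  obtain ⟨C, hC⟩ := c.unifBdd_a_sq_div.mul c.unifBdd_σ
  refine ⟨C + 1, fun i => ?_⟩
  have h1 := hC i
  beta_reduce at h1 ⊢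
  rw [div_mul_cancel₀ _ (c.σ_ne i (c.mem i)), norm_pow] at h1
  nlinarith [norm_nonneg (c.a i (c.p i)), sq_nonneg (‖c.a i (c.p i)‖ - 1)]

/-- The component of `u` along the coframe element `b dσ`. -/
noncomputable def y (i : ι) (u : Fin n → ℂ) : ℂ := c.b i (c.p i) * del u c.σ (c.p i)

/-- Uses $b\sigma=(\beta/\varepsilon)w$ and $\partial\sigma/\sigma=\partial\tau+\partial\varphi$.
The first summand is what the conic term of the metric measures; the second has bounded
coefficients. -/
theorem y_eq (i : ι) (u : Fin n → ℂ) :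
    c.y i u = c.β i / c.eps i * c.w i (c.p i) * delLog (c.l i) c.φ u (c.p i) +
      c.β i / c.eps i * c.w i (c.p i) * del u (fun z => (c.φ z : ℂ)) (c.p i) := by
  rw [← mul_add, delLog, sub_add_cancel, c.del_l i (c.mem i), ← c.b_mul_σ i (c.mem i), y]
  field_simp [c.σ_ne i (c.mem i)]

/-- Uniform lower bound of the metrics in the coframe. -/
theorem exists_y_bound : ∃ C > 0, ∀ i u, ‖c.y i u‖ ^ 2 ≤ C * sqNorm (c.metric i (c.p i)) u := by
  obtain ⟨M, hM0, hM⟩ := c.exists_φ_bound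
  obtain ⟨B, hB, hOm⟩ := exists_matrix_bound c.isCompact_K
    (fun i j => (c.smooth_Om i j).continuousOn.mono c.K_subset)
  obtain ⟨B', hB', hΦ⟩ := exists_matrix_bound c.isCompact_K
    (A := hessian fun w => (c.φ w : ℂ)) (by
      intro i j
      have h1 : ContDiffOn ℝ ∞ (dz i (dzbar j fun w => (c.φ w : ℂ))) c.U := by
        rw [dz_eq_del, dzbar_eq_delbar]
        exact smooth_del c.isOpen_U (smooth_delbar c.isOpen_U (smooth_ofReal c.smooth_φ) _) _
      exact h1.continuousOn.mono c.K_subset)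
  obtain ⟨B'', hB''⟩ := c.isCompact_K.exists_bound_of_continuousOn
    (f := fun z => fun j => dz j (fun w => (c.φ w : ℂ)) z) (by
      refine continuousOn_pi.2 fun j => ?_
      rw [dz_eq_del]
      exact (smooth_del c.isOpen_U (smooth_ofReal c.smooth_φ) _).continuousOn.mono c.K_subset)
  have hm := c.m_pos
  have hκ := c.κ_pos
  -- `C₁` bounds the conic term of the metric by a multiple of the full metric, `C₂` and `C₃` bound
  -- the two summands of `y_eq`, and the factor $2$ in the final constant is that of
  -- $(x+y)^2\le2(x^2+y^2)$.
  set C₁ : ℝ := 1 + (n ^ 2 * B + c.κ * 4 * (n ^ 2 * B')) / c.m with hC₁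
  set C₂ : ℝ := C₁ * Real.exp M / c.κ with hC₂
  set C₃ : ℝ := 4 * Real.exp M * (n * |B''|) ^ 2 / c.m with hC₃
  have hC₁p : 0 < C₁ := by positivity
  refine ⟨2 * C₂ + 2 * C₃, by positivity, fun i u => ?_⟩
  set S := sqNorm (c.metric i (c.p i)) u with hS
  have hu : ‖u‖ ^ 2 ≤ S / c.m := by
    rw [le_div_iff₀ hm, mul_comm]; exact c.lower i u
  have hS0 : 0 ≤ S := (mul_nonneg hm.le (sq_nonneg _)).trans (c.lower i u)
  have hp := c.p_mem i
  have hb := c.β_pos i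
  have he := c.eps_pos i
  set P := powSq (c.l i) c.φ (c.β i) (c.p i) with hP
  have hPe : 1 - P = c.eps i := rfl
  have hP0 : 0 < P := powSq_pos _
  have key : S = sqNorm (c.Om (c.p i)) u +
      c.κ * (2 * c.β i ^ 2 * P / c.eps i ^ 2) * ‖delLog (c.l i) c.φ u (c.p i)‖ ^ 2 -
      c.κ * (2 * c.β i * P / c.eps i) * (herm (hessian (fun w => (c.φ w : ℂ)) (c.p i)) u).re := by
    rw [hS, metric, sqNorm_eq_re_herm, herm_metric (c.isOpen i) (c.hol_l i)
      (c.smooth_φ.mono (c.W_subset i)) hb (c.neg i) (c.Q_eq i) _ _ (c.mem i) u, Complex.sub_re,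
      Complex.add_re, Complex.ofReal_re, Complex.re_ofReal_mul, hPe, sqNorm_eq_re_herm]
  have h1 : -(n ^ 2 * (B * ‖u‖ ^ 2)) ≤ sqNorm (c.Om (c.p i)) u := by
    have := (abs_le.1 ((Complex.abs_re_le_norm (herm (c.Om (c.p i)) u)).trans
      (norm_herm_le _ u (hOm _ hp) le_rfl))).1
    rwa [sqNorm_eq_re_herm]
  have h2 : (herm (hessian (fun w => (c.φ w : ℂ)) (c.p i)) u).re ≤ n ^ 2 * (B' * ‖u‖ ^ 2) :=
    (Complex.re_le_norm _).trans (norm_herm_le _ u (hΦ _ hp) le_rfl)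
  have hF1 : 2 * c.β i * P / c.eps i ≤ 4 := by
    have hP1 : P ≤ 1 := by linarith
    have := c.half_β_le_eps i
    rw [div_le_iff₀ he]; nlinarith
  have h3 : c.κ * (2 * c.β i * P / c.eps i) *
      (herm (hessian (fun w => (c.φ w : ℂ)) (c.p i)) u).re ≤
      c.κ * 4 * (n ^ 2 * (B' * ‖u‖ ^ 2)) := by
    have hnn : 0 ≤ 2 * c.β i * P / c.eps i := by positivity
    calc _ ≤ c.κ * (2 * c.β i * P / c.eps i) * (n ^ 2 * (B' * ‖u‖ ^ 2)) :=
          mul_le_mul_of_nonneg_left h2 (by positivity)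
      _ ≤ _ := by gcongr
  -- Solve the formula for the metric for its conic term; the other two terms are $O(\|u\|^2)$,
  -- hence $O(S)$ by the lower bound $m\|u\|^2\le S$.
  have h4 : c.κ * (2 * c.β i ^ 2 * P / c.eps i ^ 2) * ‖delLog (c.l i) c.φ u (c.p i)‖ ^ 2 ≤
      C₁ * S := by
    have h5 : (n ^ 2 * B + c.κ * 4 * (n ^ 2 * B')) * ‖u‖ ^ 2 ≤
        (n ^ 2 * B + c.κ * 4 * (n ^ 2 * B')) * (S / c.m) :=
      mul_le_mul_of_nonneg_left hu (by positivity)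
    have h6 : C₁ * S = S + (n ^ 2 * B + c.κ * 4 * (n ^ 2 * B')) * (S / c.m) := by rw [hC₁]; ring
    rw [h6]; nlinarith
  set X := c.β i / c.eps i * c.w i (c.p i) * delLog (c.l i) c.φ u (c.p i) with hX
  have hφb := hM _ hp
  have hPw : P = ‖c.w i (c.p i)‖ ^ 2 * Real.exp (-c.β i * c.φ (c.p i)) := by
    have := c.powSq_eq_norm i (c.p i)
    rw [Complex.mul_conj, Complex.normSq_eq_norm_sq] at this
    exact_mod_cast this
  have hE : Real.exp (-M) ≤ Real.exp (-c.β i * c.φ (c.p i)) := by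
    refine Real.exp_le_exp.2 ?_
    have := (abs_le.1 hφb).2
    have := c.β_le i
    nlinarith
  have hXn : ‖X‖ ^ 2 = c.β i ^ 2 / c.eps i ^ 2 * ‖c.w i (c.p i)‖ ^ 2 *
      ‖delLog (c.l i) c.φ u (c.p i)‖ ^ 2 := by
    rw [hX, ← Complex.ofReal_div, norm_mul, norm_mul, Complex.norm_real,
      Real.norm_of_nonneg (by positivity)]
    ring
  -- $P$ and $|w|^2$ differ by $e^{-\beta\varphi}\ge e^{-M}$, so the conic term dominates $\kappa
  -- e^{-M}\|X\|^2$.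
  have hX2 : ‖X‖ ^ 2 ≤ C₂ * S := by
    have h7 : c.κ * Real.exp (-M) * ‖X‖ ^ 2 ≤ C₁ * S := by
      refine le_trans ?_ h4
      rw [hXn, hPw]
      have h8 : c.κ * (2 * c.β i ^ 2 * (‖c.w i (c.p i)‖ ^ 2 *
          Real.exp (-c.β i * c.φ (c.p i))) / c.eps i ^ 2) * ‖delLog (c.l i) c.φ u (c.p i)‖ ^ 2 =
          c.κ * (2 * Real.exp (-c.β i * c.φ (c.p i))) * (c.β i ^ 2 / c.eps i ^ 2 *
          ‖c.w i (c.p i)‖ ^ 2 * ‖delLog (c.l i) c.φ u (c.p i)‖ ^ 2) := by ring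
      rw [h8]
      have := Real.exp_pos (-M)
      gcongr
      linarith
    have h9 : Real.exp (-M) * Real.exp M = 1 := by rw [← Real.exp_add]; simp
    have h10 : c.κ * ‖X‖ ^ 2 ≤ C₁ * S * Real.exp M := by
      have := mul_le_mul_of_nonneg_right h7 (Real.exp_pos M).le
      calc c.κ * ‖X‖ ^ 2 = c.κ * Real.exp (-M) * ‖X‖ ^ 2 * Real.exp M := by
            linear_combination (-(c.κ * ‖X‖ ^ 2)) * h9
        _ ≤ _ := this
    rw [hC₂, div_mul_eq_mul_div, le_div_iff₀ hκ]
    linarith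
  set Y := c.β i / c.eps i * c.w i (c.p i) * del u (fun z => (c.φ z : ℂ)) (c.p i) with hY
  have hd : ‖del u (fun z => (c.φ z : ℂ)) (c.p i)‖ ≤ n * |B''| * ‖u‖ := by
    rw [del_eq_sum]
    calc _ ≤ ∑ j : Fin n, |B''| * ‖u‖ := by
          refine (norm_sum_le _ _).trans (Finset.sum_le_sum fun j _ => ?_)
          rw [norm_mul, mul_comm]
          exact mul_le_mul ((norm_le_pi_norm (fun j => dz j (fun w => (c.φ w : ℂ)) (c.p i)) j).trans
            ((hB'' _ hp).trans (le_abs_self _))) (norm_le_pi_norm u j) (norm_nonneg _)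
            (abs_nonneg _)
      _ = n * |B''| * ‖u‖ := by simp; ring
  have hY2 : ‖Y‖ ^ 2 ≤ C₃ * S := by
    have hYn : ‖Y‖ ^ 2 = (c.β i / c.eps i) ^ 2 * ‖c.w i (c.p i)‖ ^ 2 *
        ‖del u (fun z => (c.φ z : ℂ)) (c.p i)‖ ^ 2 := by
      rw [hY, ← Complex.ofReal_div, norm_mul, norm_mul, Complex.norm_real,
        Real.norm_of_nonneg (by positivity)]
      ring
    have hr := c.ratio_le i
    have hw := c.norm_w_sq_le hM0 hM i
    calc ‖Y‖ ^ 2 ≤ 2 ^ 2 * Real.exp M * (n * |B''| * ‖u‖) ^ 2 := by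
          rw [hYn]; gcongr
      _ = 4 * Real.exp M * (n * |B''|) ^ 2 * ‖u‖ ^ 2 := by ring
      _ ≤ 4 * Real.exp M * (n * |B''|) ^ 2 * (S / c.m) :=
          mul_le_mul_of_nonneg_left hu (by positivity)
      _ = C₃ * S := by rw [hC₃]; ring
  have hyXY : ‖c.y i u‖ ≤ ‖X‖ + ‖Y‖ := by rw [c.y_eq i u]; exact norm_add_le _ _
  have h11 : ‖c.y i u‖ ^ 2 ≤ 2 * (‖X‖ ^ 2 + ‖Y‖ ^ 2) :=
    (pow_le_pow_left₀ (norm_nonneg _) hyXY 2).trans add_sq_le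
  linarith only [h11, hX2, hY2]

end ConeFamily

/-! ### Uniform jets of the metric in the adapted frame, and the curvature bound. -/

open Matrix

namespace ConeFamily

variable {n : ℕ} {ι : Type*} (c : ConeFamily n ι)

theorem eps_ne (i : ι) : (c.eps i : ℂ) ≠ 0 := by exact_mod_cast (c.eps_pos i).ne'

theorem unifBdd_v (j : Fin n) : UnifBdd fun i => c.v i j := by
  refine ⟨1 / c.m + 1, fun i => (norm_le_pi_norm (c.v i) j).trans ?_⟩
  have h1 := c.lower i (c.v i)
  rw [c.v_unit i, mul_comm, ← le_div_iff₀ c.m_pos] at h1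
  nlinarith only [h1, sq_nonneg (‖c.v i‖ - 1), norm_nonneg (c.v i)]

theorem unifBdd_y : UnifBdd fun i => c.y i (c.v i) := by
  obtain ⟨C, hC, h⟩ := c.exists_y_bound
  refine ⟨C + 1, fun i => ?_⟩
  have h1 := h i (c.v i)
  have h2 : sqNorm (c.metric i (c.p i)) (c.v i) = 1 := c.v_unit i
  rw [h2, mul_one] at h1
  nlinarith only [h1, sq_nonneg (‖c.y i (c.v i)‖ - 1), norm_nonneg (c.y i (c.v i))]

theorem jet_of_smooth {f : (Fin n → ℂ) → ℂ} (hf : ContDiffOn ℝ ∞ f c.U) :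
    UnifJet c.toProbe fun _ => f :=
  UnifJet.of_smooth c.isOpen_U c.isCompact_K c.K_subset hf c.W_subset c.p_mem c.unifBdd_v

theorem hol_w (i : ι) : ContDiffOn ℂ ∞ (c.w i) (c.W i) := c.hol_exp_mul_l i _

theorem hol_a (i : ι) : ContDiffOn ℂ ∞ (c.a i) (c.W i) :=
  contDiffOn_const.mul (c.hol_exp_mul_l i _)

theorem hol_b (i : ι) : ContDiffOn ℂ ∞ (c.b i) (c.W i) :=
  contDiffOn_const.mul (c.hol_exp_mul_l i _)

/-- Derivatives are expressed through the bounded component $y$ rather than $\partial_u\sigma$. The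
gain of a full factor $\varepsilon$ makes $(w-w(p))/\varepsilon$ admissible. -/
theorem del_w (i : ι) (u : Fin n → ℂ) : del u (c.w i) (c.p i) = c.eps i * c.y i u := by
  have h1 : del u (c.w i) (c.p i) = c.w i (c.p i) * c.β i * del u (c.l i) (c.p i) :=
    c.del_exp_mul_l i _ (c.mem i) u
  have h2 := c.b_mul_σ i (c.mem i)
  have h3 := c.σ_ne i (c.mem i)
  have h4 := c.eps_ne i
  have h5 : c.w i (c.p i) * c.β i = c.eps i * (c.b i (c.p i) * c.σ (c.p i)) := by
    rw [h2]; field_simp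
  rw [h1, h5, c.del_l i (c.mem i), y]
  field_simp

/-- Logarithmic differentiation gives $(1-\beta)a\,\partial_u\sigma/\sigma$, and
$\partial_u\sigma=a\,y$ supplies the second factor $a$. -/
theorem del_a (i : ι) (u : Fin n → ℂ) : del u (c.a i) (c.p i) =
    (1 - c.β i) * (c.a i (c.p i) ^ 2 / c.σ (c.p i) * c.y i u) := by
  have d1 := differentiableAt_of_smooth (c.isOpen i)
    (smooth_of_holomorphic (c.hol_exp_mul_l i (1 - c.β i))) (c.mem i)
  have h1 : del u (c.a i) (c.p i) = c.a i (c.p i) * (1 - c.β i) * del u (c.l i) (c.p i) := by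
    have h2 : del u (c.a i) (c.p i) = del u (fun _ => (c.eps i / c.β i : ℂ)) (c.p i) *
        Complex.exp ((1 - c.β i) * c.l i (c.p i)) + c.eps i / c.β i *
        del u (fun z => Complex.exp ((1 - c.β i) * c.l i z)) (c.p i) :=
      del_mul u (differentiableAt_const _) d1
    rw [h2, del_const, c.del_exp_mul_l i _ (c.mem i), a]
    ring
  have h3 := c.a_mul_b i (c.p i)
  rw [h1, c.del_l i (c.mem i), y]
  linear_combination (-(c.a i (c.p i) * (1 - c.β i) * (del u c.σ (c.p i) / c.σ (c.p i)))) * h3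

theorem jet_w : UnifJet c.toProbe c.w := by
  refine UnifJet.of_holomorphic c.hol_w c.unifBdd_w ?_
  simpa only [c.del_w] using c.unifBdd_eps.mul c.unifBdd_y

theorem jet_a : UnifJet c.toProbe c.a := by
  refine UnifJet.of_holomorphic c.hol_a c.unifBdd_a ?_
  simpa only [c.del_a, sub_eq_add_neg] using
    ((UnifBdd.const 1).add c.unifBdd_β.neg).mul (c.unifBdd_a_sq_div.mul c.unifBdd_y)

/-- The rescaled branch `(w - w(p)) / ε`. -/
noncomputable def wHat (i : ι) (z : Fin n → ℂ) : ℂ := (c.w i z - c.w i (c.p i)) / c.eps i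

theorem jet_wHat : UnifJet c.toProbe c.wHat := by
  have hd : ∀ i, del (c.v i) (c.wHat i) (c.p i) = c.y i (c.v i) := by
    intro i
    have h1 : HasDerivAt (fun y : ℂ => (y - c.w i (c.p i)) / c.eps i) (1 / c.eps i)
        (c.w i (c.p i)) := ((hasDerivAt_id _).sub_const _).div_const _
    have h2 : del (c.v i) (c.wHat i) (c.p i) = 1 / c.eps i * del (c.v i) (c.w i) (c.p i) :=
      del_comp_of_hasDerivAt (c.v i) h1 (c.jet_w.diff i)
    rw [h2, c.del_w]
    field_simp [c.eps_ne i]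
  refine UnifJet.of_holomorphic (fun i => ((c.hol_w i).sub contDiffOn_const).div_const _) ?_ ?_
  · simpa [wHat] using UnifBdd.const 0
  · simpa only [hd] using c.unifBdd_y

/-- The weight `e^{-βφ}`. -/
noncomputable def E (i : ι) (z : Fin n → ℂ) : ℂ := Complex.exp (-c.β i * c.φ z)

theorem jet_φ : UnifJet c.toProbe fun _ z => (c.φ z : ℂ) :=
  c.jet_of_smooth (smooth_ofReal c.smooth_φ)

theorem unifBdd_E : UnifBdd fun i => c.E i (c.p i) := by
  obtain ⟨M, hM0, hM⟩ := c.exists_φ_bound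
  refine ⟨Real.exp M, fun i => ?_⟩
  have h1 : c.E i (c.p i) = ((Real.exp (-c.β i * c.φ (c.p i)) : ℝ) : ℂ) := by
    rw [E]; push_cast; rfl
  have h2 := (abs_le.1 (hM _ (c.p_mem i))).1
  have hb := c.β_pos i
  have hb2 := c.β_le i
  beta_reduce
  rw [h1, Complex.norm_real, Real.norm_of_nonneg (Real.exp_pos _).le]
  refine Real.exp_le_exp.2 ?_
  nlinarith only [h2, hb, hb2, hM0]

theorem hasDerivAt_exp_mul (t y : ℂ) :
    HasDerivAt (fun y : ℂ => Complex.exp (t * y)) (t * Complex.exp (t * y)) y :=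
  ((hasDerivAt_id y).const_mul t).cexp.congr_deriv (by simp [mul_comm])

theorem smooth_E (i : ι) : ContDiffOn ℝ ∞ (c.E i) (c.W i) :=
  (contDiffOn_const.mul ((smooth_ofReal c.smooth_φ).mono (c.W_subset i))).cexp

theorem jet_E : UnifJet c.toProbe c.E := by
  refine c.jet_φ.comp (φ := fun i y => Complex.exp (-c.β i * y))
    (φ' := fun i y => -c.β i * Complex.exp (-c.β i * y))
    (φ'' := fun i => -c.β i * (-c.β i * Complex.exp (-c.β i * c.φ (c.p i)))) c.smooth_E
    (fun i z _ => hasDerivAt_exp_mul _ _) (fun i => (hasDerivAt_exp_mul _ _).const_mul _)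
    c.unifBdd_E (c.unifBdd_β.neg.mul c.unifBdd_E)
    (c.unifBdd_β.neg.mul (c.unifBdd_β.neg.mul c.unifBdd_E))

/-- The rescaled weight `(e^{-βφ} - e^{-βφ(p)}) / ε`. -/
noncomputable def EHat (i : ι) (z : Fin n → ℂ) : ℂ := (c.E i z - c.E i (c.p i)) / c.eps i

/-- Each derivative of $e^{-\beta\varphi}$ produces a factor $\beta$, which compensates the division
by $\varepsilon$. -/
theorem jet_EHat : UnifJet c.toProbe c.EHat := by
  refine c.jet_φ.comp (φ := fun i y => (Complex.exp (-c.β i * y) - c.E i (c.p i)) / c.eps i)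
    (φ' := fun i y => -(c.β i / c.eps i) * Complex.exp (-c.β i * y))
    (φ'' := fun i => -(c.β i / c.eps i) * (-c.β i * Complex.exp (-c.β i * c.φ (c.p i))))
    (fun i => ((c.smooth_E i).sub contDiffOn_const).div_const _)
    (fun i z _ => ?_) (fun i => (hasDerivAt_exp_mul _ _).const_mul _)
    ?_ (c.unifBdd_ratio.neg.mul c.unifBdd_E)
    (c.unifBdd_ratio.neg.mul (c.unifBdd_β.neg.mul c.unifBdd_E))
  · refine (((hasDerivAt_exp_mul _ _).sub_const _).div_const _).congr_deriv ?_
    ring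
  · simpa [E] using UnifBdd.const 0

/-- The complex-valued function `|s|^{2β}`. -/
noncomputable def P (i : ι) (z : Fin n → ℂ) : ℂ := powSq (c.l i) c.φ (c.β i) z

theorem P_eq (i : ι) (z : Fin n → ℂ) : c.P i z = c.w i z * conj (c.w i z) * c.E i z :=
  c.powSq_eq_norm i z

theorem one_sub_P_ne (i : ι) {z : Fin n → ℂ} (hz : z ∈ c.W i) : 1 - c.P i z ≠ 0 := by
  have := powSq_lt_one (c.β_pos i) (c.neg i z hz)
  have h2 : 1 - c.P i z = ((1 - powSq (c.l i) c.φ (c.β i) z : ℝ) : ℂ) := by rw [P]; push_cast; rfl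
  rw [h2]
  exact_mod_cast (sub_pos.2 this).ne'

theorem eps_eq (i : ι) : (c.eps i : ℂ) = 1 - c.P i (c.p i) := by
  rw [eps, P]; push_cast; rfl

/-- Substitute $w=w(p)+\varepsilon\hat w$ and $e^{-\beta\varphi}=E(p)+\varepsilon\hat E$ in
$1-|w|^2e^{-\beta\varphi}$. The constant term is $\varepsilon$ and every other term carries a factor
$\varepsilon$, so no negative power of $\varepsilon$ is left. -/
theorem jet_one_sub_P_div : UnifJet c.toProbe fun i z => (1 - c.P i z) / c.eps i := by
  have h1 := UnifJet.const (q := c.toProbe) (UnifBdd.const 1)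
  have hw0 := UnifJet.const (q := c.toProbe) c.unifBdd_w
  have hE0 := UnifJet.const (q := c.toProbe) c.unifBdd_E
  have he := UnifJet.const (q := c.toProbe) c.unifBdd_eps
  have hw := c.jet_wHat
  have hE := c.jet_EHat
  refine (h1.sub (((hw0.mul hw0.conjugate).mul hE).add
    ((((hw0.mul hw.conjugate).add (hw0.conjugate.mul hw)).add ((he.mul hw).mul hw.conjugate)).mul
      (hE0.add (he.mul hE))))).congr ?_
  intro i z hz
  have e1 : c.w i z = c.w i (c.p i) + c.eps i * c.wHat i z := by
    rw [wHat]; field_simp [c.eps_ne i]; ring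
  have e2 : c.E i z = c.E i (c.p i) + c.eps i * c.EHat i z := by
    rw [EHat]; field_simp [c.eps_ne i]; ring
  have e3 := c.eps_eq i
  rw [c.P_eq] at e3
  rw [div_eq_iff (c.eps_ne i), c.P_eq, e1, e2]
  simp only [map_add, map_mul, Complex.conj_ofReal]
  linear_combination -e3

/-- `R = ε / (1 - |s|^{2β})`. -/
noncomputable def R (i : ι) (z : Fin n → ℂ) : ℂ := c.eps i / (1 - c.P i z)

theorem jet_R : UnifJet c.toProbe c.R := by
  refine (c.jet_one_sub_P_div.inv (fun i z hz => div_ne_zero (c.one_sub_P_ne i hz) (c.eps_ne i))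
    ?_).congr fun i z _ => by rw [R, inv_div]
  simpa only [← c.eps_eq, div_self (c.eps_ne _), inv_one] using UnifBdd.const 1

/-- The inverse of the coframe matrix is `1 + rowCorrection ⊗ e_{i₀}`. -/
noncomputable def rowCorrection (i : ι) (j : Fin n) (z : Fin n → ℂ) : ℂ :=
  if j = c.i₀ then c.a i z / dz c.i₀ c.σ z - 1 else -(dz j c.σ z / dz c.i₀ c.σ z)

/-- The dual frame. -/
noncomputable def frame (i : ι) (z : Fin n → ℂ) : Matrix (Fin n) (Fin n) ℂ :=
  Matrix.of fun j k => (if j = k then 1 else 0) + if k = c.i₀ then c.rowCorrection i j z else 0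

/-- The holomorphic coframe `dz_j` (`j ≠ i₀`), `b dσ`. -/
noncomputable def coframe (i : ι) (z : Fin n → ℂ) : Matrix (Fin n) (Fin n) ℂ :=
  Matrix.of fun j k => (if j = k then 1 else 0) +
    if k = c.i₀ then c.b i z * dz j c.σ z - (if j = c.i₀ then 1 else 0) else 0

/-- For $j\ne i_0$ row $j$ of the frame is
$\partial_j-(\partial_j\sigma/\partial_{i_0}\sigma)\partial_{i_0}$, which is annihilated by
$d\sigma$; row $i_0$ is $(a/\partial_{i_0}\sigma)\partial_{i_0}$, on which $b\,d\sigma$ equals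
$ab=1$. -/
theorem coframe_mul_frame (i : ι) {z : Fin n → ℂ} (hz : z ∈ c.W i) :
    c.coframe i z * c.frame i z = 1 := by
  have h0 := c.dz_σ_ne z (c.W_subset i hz)
  have hab := c.a_mul_b i z
  ext j k
  simp only [Matrix.mul_apply, coframe, Matrix.of_apply, add_mul, ite_mul, one_mul, zero_mul,
    Finset.sum_add_distrib, Finset.sum_ite_eq, Finset.sum_ite_eq', Finset.mem_univ, if_true,
    frame, Matrix.one_apply]
  by_cases hj : j = c.i₀ <;> by_cases hk : k = c.i₀
  · subst hj; subst hk
    simp only [if_true, rowCorrection]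
    field_simp
    linear_combination dz c.i₀ c.σ z * hab
  · subst hj
    simp [hk, Ne.symm hk]
  · subst hk
    simp only [hj, if_true, if_false, rowCorrection]
    field_simp
    linear_combination dz j c.σ z * hab
  · simp [hj, hk, Ne.symm hk]

theorem hol_dz_σ (j : Fin n) : ContDiffOn ℂ ∞ (dz j c.σ) c.U := by
  have h1 : ContDiffOn ℂ ∞ (fun z => fderiv ℂ c.σ z (Pi.single j 1)) c.U :=
    (c.hol_σ.fderiv_of_isOpen c.isOpen_U (m := ∞) (by simp)).clm_apply contDiffOn_const
  refine h1.congr fun z hz => ?_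
  rw [dz_eq_del]
  exact del_of_holomorphic _ ((c.hol_σ.contDiffAt (c.isOpen_U.mem_nhds hz)).differentiableAt
    (by simp))

theorem hol_coframe (i : ι) : HolMat (c.W i) (c.coframe i) := by
  intro j k
  simp only [coframe, Matrix.of_apply]
  refine ContDiffOn.add contDiffOn_const ?_
  split_ifs
  · exact ((c.hol_b i).mul ((c.hol_dz_σ j).mono (c.W_subset i))).sub contDiffOn_const
  · exact ((c.hol_b i).mul ((c.hol_dz_σ j).mono (c.W_subset i))).sub contDiffOn_const
  · exact contDiffOn_const

theorem jet_dz_σ (j : Fin n) : UnifJet c.toProbe fun _ => dz j c.σ :=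
  c.jet_of_smooth (smooth_of_holomorphic (c.hol_dz_σ j))

theorem jet_inv_dz_σ : UnifJet c.toProbe fun _ z => (dz c.i₀ c.σ z)⁻¹ :=
  c.jet_of_smooth ((smooth_of_holomorphic (c.hol_dz_σ _)).inv c.dz_σ_ne)

theorem jet_rowCorrection (j : Fin n) : UnifJet c.toProbe fun i => c.rowCorrection i j := by
  have h1 := UnifJet.const (q := c.toProbe) (UnifBdd.const 1)
  by_cases hj : j = c.i₀
  · refine ((c.jet_a.mul c.jet_inv_dz_σ).sub h1).congr fun i z _ => ?_
    rw [rowCorrection, if_pos hj, div_eq_mul_inv]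
  · refine ((c.jet_dz_σ j).mul c.jet_inv_dz_σ).neg.congr fun i z _ => ?_
    rw [rowCorrection, if_neg hj, div_eq_mul_inv]

theorem jet_frame (j k : Fin n) : UnifJet c.toProbe fun i z => c.frame i z j k := by
  simp only [frame, Matrix.of_apply]
  refine UnifJet.add (UnifJet.const (UnifBdd.const _)) ?_
  split_ifs
  · exact c.jet_rowCorrection j
  · exact UnifJet.const (UnifBdd.const _)

/-- The metrics in the frame. -/
noncomputable def frameMetric (i : ι) (z : Fin n → ℂ) : Matrix (Fin n) (Fin n) ℂ :=
  c.frame i z * c.metric i z * (c.frame i z)ᴴ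

/-- The normalized components of `∂ log |s|²` in the frame. -/
noncomputable def eta (i : ι) (j : Fin n) (z : Fin n → ℂ) : ℂ :=
  if j = c.i₀ then 1 - c.σ z * (dz c.i₀ (fun w => (c.φ w : ℂ)) z / dz c.i₀ c.σ z)
  else c.β i / c.eps i * c.w i z * (dz j c.σ z *
    (dz c.i₀ (fun w => (c.φ w : ℂ)) z / dz c.i₀ c.σ z) - dz j (fun w => (c.φ w : ℂ)) z)

theorem smooth_dz_φ (j : Fin n) : ContDiffOn ℝ ∞ (dz j (fun w => (c.φ w : ℂ))) c.U := by
  rw [dz_eq_del]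
  exact smooth_del c.isOpen_U (smooth_ofReal c.smooth_φ) _

theorem jet_eta (j : Fin n) : UnifJet c.toProbe fun i => c.eta i j := by
  have h1 := UnifJet.const (q := c.toProbe) (UnifBdd.const 1)
  have hσ := c.jet_of_smooth (smooth_of_holomorphic c.hol_σ)
  have hq := (c.jet_of_smooth (c.smooth_dz_φ c.i₀)).mul c.jet_inv_dz_σ
  by_cases hj : j = c.i₀
  · refine (h1.sub (hσ.mul hq)).congr fun i z _ => ?_
    rw [eta, if_pos hj, div_eq_mul_inv]
  · refine (((UnifJet.const c.unifBdd_ratio).mul c.jet_w).mul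
      (((c.jet_dz_σ j).mul hq).sub (c.jet_of_smooth (c.smooth_dz_φ j)))).congr fun i z _ => ?_
    rw [eta, if_neg hj, div_eq_mul_inv _ (dz c.i₀ c.σ z)]

/-- The pole $\partial\sigma/\sigma$ of $\partial\log|s|^2$ disappears: for $j\ne i_0$ the frame
vector is annihilated by $d\sigma$, and for $j=i_0$ the factor $(\beta/\varepsilon)w=b\sigma$
together with $ab=1$ turns it into $1$. -/
theorem ratio_mul_frame_delLog (i : ι) {z : Fin n → ℂ} (hz : z ∈ c.W i) (j : Fin n) :
    c.β i / c.eps i * c.w i z * ∑ k, c.frame i z j k * delLog (c.l i) c.φ (Pi.single k 1) z =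
      c.eta i j z := by
  have hs : ∑ k, c.frame i z j k * delLog (c.l i) c.φ (Pi.single k 1) z =
      delLog (c.l i) c.φ (Pi.single j 1) z +
        c.rowCorrection i j z * delLog (c.l i) c.φ (Pi.single c.i₀ 1) z := by
    simp only [frame, Matrix.of_apply, add_mul, ite_mul, one_mul, zero_mul,
      Finset.sum_add_distrib, Finset.sum_ite_eq, Finset.sum_ite_eq', Finset.mem_univ, if_true]
  have h0 := c.dz_σ_ne z (c.W_subset i hz)
  have hσ0 := c.σ_ne i hz
  have hab := c.a_mul_b i z
  have hbσ := c.b_mul_σ i hz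
  rw [hs]
  simp only [delLog, c.del_l i hz, ← dz_eq_del]
  by_cases hj : j = c.i₀
  · subst hj
    simp only [eta, rowCorrection, if_true, ← hbσ]
    field_simp
    linear_combination (dz c.i₀ c.σ z - dz c.i₀ (fun w => (c.φ w : ℂ)) z * c.σ z) * hab
  · simp only [eta, rowCorrection, if_neg hj]
    field_simp
    ring

/-- Written so that each factor has uniformly bounded jets: the singular coefficients are regrouped
into $\beta/\varepsilon$, $R=\varepsilon/(1-P)$, $P$, $e^{-\beta\varphi}$ and `eta`. -/
theorem frameMetric_eq (i : ι) {z : Fin n → ℂ} (hz : z ∈ c.W i) (j k : Fin n) :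
    c.frameMetric i z j k = (∑ x, (∑ y, c.frame i z j y * (c.Om z y x -
      c.κ * (2 * (c.β i / c.eps i) * c.R i z * c.P i z) *
        dz y (dzbar x fun w => (c.φ w : ℂ)) z)) * conj (c.frame i z k x)) +
      2 * c.κ * c.E i z * (c.R i z * c.R i z) * (c.eta i j z * conj (c.eta i k z)) := by
  have hm : ∀ y x, c.metric i z y x = (c.Om z y x -
      c.κ * (2 * (c.β i / c.eps i) * c.R i z * c.P i z) *
        dz y (dzbar x fun w => (c.φ w : ℂ)) z) +
      c.κ * (2 * c.β i ^ 2 * c.P i z / (1 - c.P i z) ^ 2) *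
        (delLog (c.l i) c.φ (Pi.single y 1) z * conj (delLog (c.l i) c.φ (Pi.single x 1) z)) := by
    intro y x
    have hR : 2 * (c.β i / c.eps i) * c.R i z * c.P i z = 2 * c.β i * c.P i z / (1 - c.P i z) := by
      rw [R]
      field_simp [c.eps_ne i, c.one_sub_P_ne i hz]
    rw [hR]
    simp only [metric, Matrix.sub_apply, Matrix.smul_apply, hessian, Matrix.of_apply, smul_eq_mul,
      dz_eq_del, dzbar_eq_delbar]
    rw [del_delbar_potential (c.isOpen i) (c.hol_l i)
      (c.smooth_φ.mono (c.W_subset i)) (c.β_pos i) (c.neg i) (c.Q_eq i) _ _ hz, P]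
    push_cast
    ring
  have hR2 : c.κ * (2 * c.β i ^ 2 * c.P i z / (1 - c.P i z) ^ 2) = 2 * c.κ * c.E i z *
      (c.R i z * c.R i z) * ((c.β i / c.eps i * c.w i z) * conj (c.β i / c.eps i * c.w i z)) := by
    simp only [map_mul, map_div₀, Complex.conj_ofReal]
    rw [R]
    field_simp [c.eps_ne i, c.one_sub_P_ne i hz]
    rw [c.P_eq i z]
    ring
  rw [← c.ratio_mul_frame_delLog i hz j, ← c.ratio_mul_frame_delLog i hz k]
  simp only [frameMetric, Matrix.mul_apply, conjTranspose_apply, RCLike.star_def, hm, hR2]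
  simp only [mul_add, Finset.sum_add_distrib, add_mul]
  congr 1
  simp only [map_mul, map_sum, Finset.mul_sum, Finset.sum_mul]
  refine Finset.sum_congr rfl fun x _ => Finset.sum_congr rfl fun y _ => ?_
  ring

theorem jet_frameMetric (j k : Fin n) : UnifJet c.toProbe fun i z => c.frameMetric i z j k := by
  have hP : UnifJet c.toProbe c.P :=
    ((c.jet_w.mul c.jet_w.conjugate).mul c.jet_E).congr fun i z _ => c.P_eq i z
  have hκ := UnifJet.const (q := c.toProbe) (UnifBdd.const c.κ)
  have h2 := UnifJet.const (q := c.toProbe) (UnifBdd.const 2)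
  have hr := UnifJet.const (q := c.toProbe) c.unifBdd_ratio
  have hΦ : ∀ y x, UnifJet c.toProbe fun _ z => dz y (dzbar x fun w => (c.φ w : ℂ)) z := by
    intro y x
    refine c.jet_of_smooth ?_
    rw [dz_eq_del, dzbar_eq_delbar]
    exact smooth_del c.isOpen_U (smooth_delbar c.isOpen_U (smooth_ofReal c.smooth_φ) _) _
  refine UnifJet.congr (UnifJet.add (UnifJet.sum Finset.univ fun x _ => UnifJet.mul
    (UnifJet.sum Finset.univ fun y _ => (c.jet_frame j y).mul
      ((c.jet_of_smooth (c.smooth_Om y x)).sub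
        ((hκ.mul (((h2.mul hr).mul c.jet_R).mul hP)).mul (hΦ y x))))
    (c.jet_frame k x).conjugate)
    ((((h2.mul hκ).mul c.jet_E).mul (c.jet_R.mul c.jet_R)).mul
      ((c.jet_eta j).mul (c.jet_eta k).conjugate))) fun i z hz => c.frameMetric_eq i hz j k

theorem metric_eq (i : ι) {z : Fin n → ℂ} (hz : z ∈ c.W i) :
    c.metric i z = c.coframe i z * c.frameMetric i z * (c.coframe i z)ᴴ := by
  have h1 := c.coframe_mul_frame i hz
  have h2 : (c.frame i z)ᴴ * (c.coframe i z)ᴴ = 1 := by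
    rw [← conjTranspose_mul, h1, conjTranspose_one]
  calc c.metric i z = (c.coframe i z * c.frame i z) * c.metric i z *
        ((c.frame i z)ᴴ * (c.coframe i z)ᴴ) := by rw [h1, h2, one_mul, mul_one]
    _ = _ := by simp only [frameMetric, mul_assoc]

theorem vecMul_coframe (i : ι) (u : Fin n → ℂ) (k : Fin n) :
    (u ᵥ* c.coframe i (c.p i)) k = if k = c.i₀ then c.y i u else u k := by
  simp only [vecMul, dotProduct, coframe, Matrix.of_apply, mul_add, mul_ite, mul_one, mul_zero,
    Finset.sum_add_distrib, Finset.sum_ite_eq', Finset.mem_univ, if_true]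
  by_cases hk : k = c.i₀
  · simp only [hk, if_true, mul_sub, mul_ite, mul_one, mul_zero, Finset.sum_sub_distrib,
      Finset.sum_ite_eq', Finset.mem_univ, y, del_eq_sum u, Finset.mul_sum]
    rw [add_sub_cancel]
    refine Finset.sum_congr rfl fun j _ => by ring
  · simp [hk]

/-- Serves twice: it bounds the components of unit vectors in the adapted frame and, read through
the inverse matrix, bounds `frameMetric` from below. -/
theorem exists_coframe_bound : ∃ C > 0, ∀ i u,
    ‖u ᵥ* c.coframe i (c.p i)‖ ^ 2 ≤ C * sqNorm (c.metric i (c.p i)) u := by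
  obtain ⟨C, hC, h⟩ := c.exists_y_bound
  have hm := c.m_pos
  refine ⟨C + 1 / c.m, by positivity, fun i u => ?_⟩
  have hS := c.lower i u
  change c.m * ‖u‖ ^ 2 ≤ sqNorm (c.metric i (c.p i)) u at hS
  have h0 : 0 ≤ sqNorm (c.metric i (c.p i)) u := (by positivity : 0 ≤ c.m * ‖u‖ ^ 2).trans hS
  have h1 : ‖u‖ ^ 2 ≤ 1 / c.m * sqNorm (c.metric i (c.p i)) u := by
    rw [one_div, ← div_eq_inv_mul, le_div_iff₀ hm, mul_comm]; exact hS
  have hy := h i u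
  have h2 : 0 ≤ C * sqNorm (c.metric i (c.p i)) u := by positivity
  have h3 : 0 ≤ 1 / c.m * sqNorm (c.metric i (c.p i)) u := by positivity
  rw [add_mul]
  refine (Real.le_sqrt (norm_nonneg _) (by positivity)).1
    ((pi_norm_le_iff_of_nonneg (Real.sqrt_nonneg _)).2 fun k => ?_)
  refine (Real.le_sqrt (norm_nonneg _) (by positivity)).2 ?_
  rw [c.vecMul_coframe]
  split_ifs
  · linarith
  · have h4 : ‖u k‖ ^ 2 ≤ ‖u‖ ^ 2 := pow_le_pow_left₀ (norm_nonneg _) (norm_le_pi_norm u k) 2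
    linarith

/-- The uniform curvature bound for the family. -/
theorem exists_bisectional_bound : ∃ B, ∀ i u, sqNorm (c.metric i (c.p i)) u = 1 →
    ‖bisectional (c.metric i) (c.p i) u (c.v i)‖ ≤ B := by
  obtain ⟨C, hC, hco⟩ := c.exists_coframe_bound
  have hlow : ∀ i y, C⁻¹ * ‖y‖ ^ 2 ≤ sqNorm (c.frameMetric i (c.p i)) y := by
    intro i y
    have h1 := c.coframe_mul_frame i (c.mem i)
    have h2 := hco i (y ᵥ* c.frame i (c.p i))
    rw [vecMul_vecMul, mul_eq_one_comm.1 h1, vecMul_one, sqNorm_eq_re_herm,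
      ← herm_congruence] at h2
    rw [inv_mul_le_iff₀ hC]
    exact h2
  obtain ⟨B, hB⟩ := exists_chernForm_bound c.jet_frameMetric (inv_pos.2 hC) hlow
  refine ⟨n ^ 2 * (B * Real.sqrt C ^ 2), fun i u hu => ?_⟩
  have hev : c.metric i =ᶠ[nhds (c.p i)] fun z =>
      c.coframe i z * c.frameMetric i z * (c.coframe i z)ᴴ := by
    filter_upwards [(c.isOpen i).mem_nhds (c.mem i)] with z hz using c.metric_eq i hz
  have sG : SmoothMat (c.W i) (c.frameMetric i) := fun j k => (c.jet_frameMetric j k).smooth i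
  have hN := c.hol_coframe i
  have sg : SmoothMat (c.W i) (c.metric i) := fun j k =>
    (((hN.smoothMat.mul sG).mul hN.smoothMat.conjTranspose) j k).congr
      fun z hz => by rw [c.metric_eq i hz]
  have hNu : IsUnit (c.coframe i (c.p i)).det := (Matrix.isUnit_iff_isUnit_det _).1
    (IsUnit.of_mul_eq_one _ (c.coframe_mul_frame i (c.mem i)))
  rw [bisectional_eq_herm (c.v i) (c.isOpen i) (c.mem i) sg, chernForm_congr _ hev,
    chernForm_congruence (c.v i) (c.isOpen i) (c.mem i) sG hN
      (norm_inv_apply_le (inv_pos.2 hC) (hlow i)).1 hNu, herm_congruence]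
  refine norm_herm_le _ _ (hB i) (Real.le_sqrt_of_sq_le ?_)
  have := hco i u
  rwa [hu, mul_one] at this

end ConeFamily

/-! ### Estimates in one coordinate domain. -/

section Local

open Matrix

variable {n : ℕ}

/-- Smoothness is local, so local branches of $\log\sigma$ suffice although no global one need exist
off $D$. -/
theorem smoothOn_local_potential {U : Set (Fin n → ℂ)} (hU : IsOpen U)
    {σ : (Fin n → ℂ) → ℂ} {φ : (Fin n → ℂ) → ℝ} (hσ : ContDiffOn ℂ ∞ σ U)
    (hφ : ContDiffOn ℝ ∞ φ U) (hlt : ∀ z ∈ U, ‖σ z‖ ^ 2 * Real.exp (-φ z) < 1) {β : ℝ}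
    (hβ : 0 < β) {Q : (Fin n → ℂ) → ℝ}
    (hQ : ∀ w ∈ U, Q w = Real.log (((1 - (‖σ w‖ ^ 2 * Real.exp (-φ w)) ^ β) / β) ^ 2)) :
    ContDiffOn ℝ ∞ (fun w => (Q w : ℂ)) (U ∩ {z | σ z ≠ 0}) := by
  intro z hz
  obtain ⟨W, l, oW, hzW, hWU, hl, hle⟩ := exists_log_branch hU hσ hz.1 hz.2
  refine ((smooth_potential hl (hφ.mono hWU) hβ (fun w hw => ?_) fun w hw => ?_).contDiffAt
    (oW.mem_nhds hzW)).contDiffWithinAt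
  · have := hlt w (hWU hw)
    rwa [log_sq_eq (hle w hw), Real.exp_lt_one_iff] at this
  · rw [hQ w (hWU hw), powSq_eq_rpow (hle w hw)]

theorem isOpen_inter_ne_zero {U : Set (Fin n → ℂ)} (hU : IsOpen U)
    {σ : (Fin n → ℂ) → ℂ} (hσ : ContinuousOn σ U) : IsOpen (U ∩ {z | σ z ≠ 0}) :=
  hσ.isOpen_inter_preimage hU isOpen_ne

theorem smoothMat_sub_hessian {U W : Set (Fin n → ℂ)} (hW : IsOpen W) (hWU : W ⊆ U)
    {Om : (Fin n → ℂ) → Matrix (Fin n) (Fin n) ℂ} (hOm : SmoothMat U Om) (κ : ℂ)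
    {Q : (Fin n → ℂ) → ℂ} (hQ : ContDiffOn ℝ ∞ Q W) :
    SmoothMat W fun z => Om z - κ • hessian Q z := by
  intro i j
  simp only [Matrix.sub_apply, Matrix.smul_apply, smul_eq_mul, hessian, Matrix.of_apply,
    dz_eq_del, dzbar_eq_delbar]
  exact ((hOm i j).mono hWU).sub
    (contDiffOn_const.mul (smooth_del hW (smooth_delbar hW hQ _) _))

theorem isUnit_det_of_sqNorm_pos {A : Matrix (Fin n) (Fin n) ℂ}
    (h : ∀ u, u ≠ 0 → 0 < sqNorm A u) : IsUnit A.det := by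
  obtain ⟨m, hm, hl⟩ := exists_sqNorm_lower_bound (isCompact_singleton (x := (0 : Fin n → ℂ)))
    (A := fun _ => A) (fun _ _ => continuousOn_const) (fun _ _ => h)
  exact (norm_inv_apply_le hm (hl 0 rfl)).1

/-- The local curvature estimate in a coordinate domain. -/
theorem exists_local_curvature_bound {κ : ℝ} (hκ : 0 < κ) {U : Set (Fin n → ℂ)} (hU : IsOpen U)
    {p : Fin n → ℂ} (hp : p ∈ U) {Om : (Fin n → ℂ) → Matrix (Fin n) (Fin n) ℂ}
    (hOm : SmoothMat U Om) (hpos : ∀ z ∈ U, ∀ u, u ≠ 0 → 0 < sqNorm (Om z) u)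
    {σ : (Fin n → ℂ) → ℂ} {φ : (Fin n → ℂ) → ℝ} (hσ : ContDiffOn ℂ ∞ σ U)
    (hφ : ContDiffOn ℝ ∞ φ U) (hlt : ∀ z ∈ U, ‖σ z‖ ^ 2 * Real.exp (-φ z) < Real.exp (-1))
    {i₀ : Fin n} (hi₀ : dz i₀ σ p ≠ 0) {Q : ℝ → (Fin n → ℂ) → ℝ}
    (hQ : ∀ β, ∀ w ∈ U,
      Q β w = Real.log (((1 - (‖σ w‖ ^ 2 * Real.exp (-φ w)) ^ β) / β) ^ 2))
    (hhalf : ∀ β ∈ Set.Ioc (0 : ℝ) (1 / 2), ∀ z ∈ U, σ z ≠ 0 → ∀ u,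
      (1 / 2) * sqNorm (Om z) u ≤
        sqNorm (Om z - (κ : ℂ) • hessian (fun w => (Q β w : ℂ)) z) u) :
    ∃ V ⊆ U, IsOpen V ∧ p ∈ V ∧ ∃ C, ∀ β ∈ Set.Ioc (0 : ℝ) (1 / 2), ∀ z ∈ V, σ z ≠ 0 → ∀ u v,
      sqNorm (Om z - (κ : ℂ) • hessian (fun w => (Q β w : ℂ)) z) u = 1 →
      sqNorm (Om z - (κ : ℂ) • hessian (fun w => (Q β w : ℂ)) z) v = 1 →
      ‖bisectional (fun z => Om z - (κ : ℂ) • hessian (fun w => (Q β w : ℂ)) z) z u v‖ ≤ C := by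
  have hdz : ContinuousOn (dz i₀ σ) U := by
    rw [dz_eq_del]
    exact (smooth_del hU (smooth_of_holomorphic hσ) _).continuousOn
  have hU' := isOpen_inter_ne_zero hU hdz
  set U' := U ∩ {z | dz i₀ σ z ≠ 0} with hU'def
  have hsub : U' ⊆ U := Set.inter_subset_left
  obtain ⟨r, hr, hrU⟩ := Metric.nhds_basis_closedBall.mem_iff.1 (hU'.mem_nhds ⟨hp, hi₀⟩)
  have hK := isCompact_closedBall p r
  have hBK : Metric.ball p r ⊆ Metric.closedBall p r := Metric.ball_subset_closedBall
  have hBU : Metric.ball p r ⊆ U := hBK.trans (hrU.trans hsub)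
  obtain ⟨m, hm, hlow⟩ := exists_sqNorm_lower_bound hK
    (fun i j => (hOm i j).continuousOn.mono (hrU.trans hsub))
    (fun z hz => hpos z (hsub (hrU hz)))
  -- All admissible triples $(\beta,z,v)$ form a single family, so one bound for the family is a
  -- bound uniform in all three.
  let ι := {x : ℝ × (Fin n → ℂ) × (Fin n → ℂ) // x.1 ∈ Set.Ioc (0 : ℝ) (1 / 2) ∧
    x.2.1 ∈ Metric.ball p r ∧ σ x.2.1 ≠ 0 ∧
    sqNorm (Om x.2.1 - (κ : ℂ) • hessian (fun w => (Q x.1 w : ℂ)) x.2.1) x.2.2 = 1}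
  choose W l oW hpW hWB hl hle using fun i : ι =>
    exists_log_branch Metric.isOpen_ball (hσ.mono hBU) i.2.2.1 i.2.2.2.1
  let c : ConeFamily n ι :=
    { W := W, p := fun i => i.1.2.1, v := fun i => i.1.2.2, isOpen := oW, mem := hpW
      U := U', K := Metric.closedBall p r, Om := Om, σ := σ, φ := φ, i₀ := i₀, κ := κ, m := m / 2
      β := fun i => i.1.1, l := l, Q := fun i => Q i.1.1
      isOpen_U := hU', isCompact_K := hK, K_subset := hrU
      W_subset := fun i => (hWB i).trans (hBK.trans hrU)
      p_mem := fun i => hBK i.2.2.1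
      smooth_Om := fun i j => (hOm i j).mono hsub
      hol_σ := hσ.mono hsub, smooth_φ := hφ.mono hsub
      dz_σ_ne := fun z hz => hz.2
      κ_pos := hκ, m_pos := half_pos hm
      β_pos := fun i => i.2.1.1, β_le := fun i => i.2.1.2
      hol_l := hl, exp_l := hle
      lt_neg_one := fun i z hz => by
        have := hlt z (hBU (hWB i hz))
        rwa [log_sq_eq (hle i z hz), Real.exp_lt_exp] at this
      Q_eq := fun i z hz => by
        rw [hQ _ z (hBU (hWB i hz)), powSq_eq_rpow (hle i z hz)]
      lower := fun i u => by
        have h1 := hlow _ (hBK i.2.2.1) u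
        have h2 := hhalf _ i.2.1 _ (hBU i.2.2.1) i.2.2.2.1 u
        linarith
      v_unit := fun i => i.2.2.2.2 }
  obtain ⟨B, hB⟩ := c.exists_bisectional_bound
  exact ⟨Metric.ball p r, hBU, Metric.isOpen_ball, Metric.mem_ball_self hr, B,
    fun β hβ z hz hz0 u v hu hv => hB ⟨(β, z, v), hβ, hz, hz0, hv⟩ u hu⟩

/-- After a change of frame, the local equation of the divisor has a nonvanishing derivative. -/
theorem exists_transverse_frame (hn : 0 < n) {U : Set (Fin n → ℂ)} (hU : IsOpen U)
    {p : Fin n → ℂ} (hp : p ∈ U) {σ : (Fin n → ℂ) → ℂ} {φ : (Fin n → ℂ) → ℝ}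
    (hσ : ContDiffOn ℂ ∞ σ U) (hφ : ContDiffOn ℝ ∞ φ U) (h0 : σ p = 0 → fderiv ℂ σ p ≠ 0) :
    ∃ (σ' : (Fin n → ℂ) → ℂ) (φ' : (Fin n → ℂ) → ℝ) (i₀ : Fin n),
      ContDiffOn ℂ ∞ σ' U ∧ ContDiffOn ℝ ∞ φ' U ∧
      (∀ z, ‖σ' z‖ ^ 2 * Real.exp (-φ' z) = ‖σ z‖ ^ 2 * Real.exp (-φ z)) ∧
      (∀ z, σ' z = 0 ↔ σ z = 0) ∧ dz i₀ σ' p ≠ 0 := by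
  have hd : DifferentiableAt ℂ σ p := (hσ.contDiffAt (hU.mem_nhds hp)).differentiableAt (by simp)
  by_cases hex : ∃ i₀, dz i₀ σ p ≠ 0
  · obtain ⟨i₀, hi₀⟩ := hex
    exact ⟨σ, φ, i₀, hσ, hφ, fun _ => rfl, fun _ => Iff.rfl, hi₀⟩
  push Not at hex
  have hσp : σ p ≠ 0 := by
    intro h
    refine h0 h (ContinuousLinearMap.ext fun u => ?_)
    rw [← del_of_holomorphic u hd, del_eq_sum]
    simp [hex]
  set i₀ : Fin n := ⟨0, hn⟩
  have hlin : ContDiff ℂ ∞ fun z : Fin n → ℂ => z i₀ := contDiff_apply ℂ ℂ i₀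
  have hlinR : ContDiff ℝ ∞ fun z : Fin n → ℂ => (z i₀).re :=
    Complex.reCLM.contDiff.comp (contDiff_apply ℝ ℂ i₀)
  have he : ContDiff ℂ ∞ fun z : Fin n → ℂ => Complex.exp (z i₀) := hlin.cexp
  -- Where $d\sigma=0$ but $\sigma\ne0$, multiplying the local frame by $e^{-z_{i_0}}$ keeps $|s|^2$
  -- and gives $\sigma$ a nonzero derivative. Points off $D$ are thus treated like points on it.
  refine ⟨fun z => σ z * Complex.exp (z i₀), fun z => φ z + 2 * (z i₀).re, i₀,
    hσ.mul he.contDiffOn, hφ.add (contDiff_const.mul hlinR).contDiffOn, fun z => ?_,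
    fun z => by simp, ?_⟩
  · rw [norm_mul, Complex.norm_exp, mul_pow, ← Real.exp_nat_mul, mul_assoc, ← Real.exp_add]
    congr 2
    push_cast
    ring
  · have d2 : DifferentiableAt ℂ (fun z : Fin n → ℂ => Complex.exp (z i₀)) p :=
      he.contDiffAt.differentiableAt (by simp)
    have d3 : DifferentiableAt ℂ (fun z : Fin n → ℂ => z i₀) p :=
      hlin.contDiffAt.differentiableAt (by simp)
    have h1 : del (Pi.single i₀ 1) (fun z : Fin n → ℂ => Complex.exp (z i₀)) p =
        Complex.exp (p i₀) := by
      rw [del_comp_of_hasDerivAt _ (Complex.hasDerivAt_exp _) (d3.restrictScalars ℝ),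
        del_of_holomorphic _ d3]
      have : fderiv ℂ (fun z : Fin n → ℂ => z i₀) p = ContinuousLinearMap.proj i₀ :=
        (ContinuousLinearMap.proj i₀ : (Fin n → ℂ) →L[ℂ] ℂ).fderiv
      rw [this]; simp
    rw [dz_eq_del, del_mul _ (hd.restrictScalars ℝ) (d2.restrictScalars ℝ), h1, ← dz_eq_del,
      hex, zero_mul, zero_add]
    exact mul_ne_zero hσp (Complex.exp_ne_zero _)

end Local

/-! ### From the preferred chart at a point to all charts, and to all of $X$. -/

section Global

open Matrix

variable {n : ℕ} {X : Type*} [TopologicalSpace X] [ChartedSpace (Fin n → ℂ) X]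
  [IsManifold 𝓘(ℂ, Fin n → ℂ) ω X]
  {L : X → Type*} [TopologicalSpace (Bundle.TotalSpace ℂ L)]
  [∀ x, TopologicalSpace (L x)] [∀ x, AddCommGroup (L x)] [∀ x, Module ℂ (L x)]
  [FiberBundle ℂ L] [VectorBundle ℂ ℂ L]

omit [IsManifold 𝓘(ℂ, Fin n → ℂ) ω X] in
theorem HermitianMetric.sq_rescale (h : HermitianMetric n L) (s : ∀ x, L x) {c : ℝ} (hc : 0 < c)
    (x : X) : (h.rescale c hc).sq s x = c * h.sq s x := by
  simp [HermitianMetric.sq, HermitianMetric.rescale]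

theorem sqNorm_transition {ψ : (Fin n → ℂ) → (Fin n → ℂ)} {z : Fin n → ℂ}
    (A : Matrix (Fin n) (Fin n) ℂ) (u : Fin n → ℂ) :
    sqNorm (jacobian ψ z * A * (jacobian ψ z)ᴴ) u = sqNorm A (fderiv ℂ ψ z u) := by
  rw [sqNorm_eq_re_herm, herm_congruence, vecMul_jacobian, sqNorm_eq_re_herm]

variable [ContMDiffVectorBundle ω ℂ L 𝓘(ℂ, Fin n → ℂ)] {s : ∀ x, L x}
  (hs : CutsSmoothDivisor n s) (kf : KahlerForm n X) (h : HermitianMetric n L) {κ : ℝ}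
  (hκ : 0 < κ)
include hs hκ

/-- Both forms transform by the same Jacobian, so the inequality proved in the chart at $x_0$ passes
to every chart meeting $O$. -/
theorem exists_normalization_near (x₀ : X) : ∃ O ∈ nhds x₀, ∃ c₀ > 0, ∀ c, ∀ hc : 0 < c, c ≤ c₀ →
    (∀ x ∈ O, (h.rescale c hc).sq s x < Real.exp (-1)) ∧
    ∀ β > 0, ∀ e ∈ atlas (Fin n → ℂ) X, ∀ z ∈ e.target, e.symm z ∈ O → s (e.symm z) ≠ 0 →
      ∀ u, (1 / 2) * sqNorm (coeff kf.form e z) u ≤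
        sqNorm (conicMetric κ kf (h.rescale c hc) s β e z) u := by
  obtain ⟨U, σ, φ, oU, hx₀U, hUt, hσ, hφ, hsq, hzero, -⟩ := exists_local_data h hs x₀
  set e₀ := chartAt (Fin n → ℂ) x₀ with he₀
  have he₀a : e₀ ∈ atlas (Fin n → ℂ) X := chart_mem_atlas _ _
  have hx₀ : x₀ ∈ e₀.source := mem_chart_source _ _
  obtain ⟨V, hVU, oV, hpV, c₀, hc₀, hloc⟩ := exists_local_normalization hκ oU hx₀U
    (Om := coeff kf.form e₀) (fun i j => (kf.smooth e₀ he₀a i j).mono hUt)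
    (fun z hz u hu => kf.sqNorm_coeff_pos he₀a (hUt hz) hu) hσ hφ
  have hO : e₀.source ∩ e₀ ⁻¹' V ∈ nhds x₀ :=
    (e₀.isOpen_inter_preimage oV).mem_nhds ⟨hx₀, hpV⟩
  refine ⟨e₀.source ∩ e₀ ⁻¹' V, hO, c₀, hc₀, fun c hc hcc => ⟨fun x hx => ?_,
    fun β hβ e he z hz hzO hz0 u => ?_⟩⟩
  · have h1 := (hloc c hc hcc _ hx.2).1
    rw [← hsq _ (hVU hx.2), e₀.left_inv hx.1] at h1
    rwa [h.sq_rescale]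
  · have hzs : z ∈ (e.symm.trans e₀).source := ⟨hz, hzO.1⟩
    have hQ : ∀ w ∈ U, potential (h.rescale c hc) s β (e₀.symm w) =
        Real.log (((1 - (c * (‖σ w‖ ^ 2 * Real.exp (-φ w))) ^ β) / β) ^ 2) := by
      intro w hw
      rw [potential, h.sq_rescale, hsq w hw]
    have oW := isOpen_inter_ne_zero oV (hσ.continuousOn.mono hVU)
    have hzW : e₀ (e.symm z) ∈ V ∩ {z | σ z ≠ 0} := by
      refine ⟨hzO.2, fun h0 => hz0 ?_⟩
      rwa [← hzero _ (hVU hzO.2), e₀.left_inv hzO.1] at h0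
    have hpot : ContDiffOn ℝ ∞ (fun w => (potential (h.rescale c hc) s β (e₀.symm w) : ℂ))
        (V ∩ {z | σ z ≠ 0}) := fun w hw =>
      (((hloc c hc hcc w hw.1).2 hw.2 β hβ _ hQ).1).contDiffWithinAt
    rw [conicMetric_transition κ kf _ s β he he₀a hzs oW hzW hpot, sqNorm_transition,
      coeff_transition kf.form he he₀a hzs, sqNorm_transition, conicMetric_eq]
    exact ((hloc c hc hcc _ hzO.2).2 hzW.2 β hβ _ hQ).2 _

theorem exists_bisectional_bound_near (hn : 0 < n)
    (hnorm : IsNormalized κ kf h s (Set.Ioc 0 (1 / 2))) (x₀ : X) :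
    ∃ O ∈ nhds x₀, ∃ C, ∀ β ∈ Set.Ioc (0 : ℝ) (1 / 2), ∀ e ∈ atlas (Fin n → ℂ) X,
      ∀ z ∈ e.target, e.symm z ∈ O → s (e.symm z) ≠ 0 → ∀ u v : Fin n → ℂ,
      sqNorm (conicMetric κ kf h s β e z) u = 1 → sqNorm (conicMetric κ kf h s β e z) v = 1 →
      ‖bisectional (conicMetric κ kf h s β e) z u v‖ ≤ C := by
  obtain ⟨U, σ₀, φ₀, oU, hx₀U, hUt, hσ₀, hφ₀, hsq₀, hzero₀, htr⟩ := exists_local_data h hs x₀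
  obtain ⟨σ, φ, i₀, hσ, hφ, hsq₁, hzero₁, hi₀⟩ :=
    exists_transverse_frame hn oU hx₀U hσ₀ hφ₀ htr
  set e₀ := chartAt (Fin n → ℂ) x₀ with he₀
  have he₀a : e₀ ∈ atlas (Fin n → ℂ) X := chart_mem_atlas _ _
  have hx₀ : x₀ ∈ e₀.source := mem_chart_source _ _
  have hsq : ∀ z ∈ U, h.sq s (e₀.symm z) = ‖σ z‖ ^ 2 * Real.exp (-φ z) := fun z hz => by
    rw [hsq₀ z hz, hsq₁]
  have hzero : ∀ z ∈ U, s (e₀.symm z) = 0 ↔ σ z = 0 := fun z hz => by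
    rw [hzero₀ z hz, hzero₁]
  have hlt : ∀ z ∈ U, ‖σ z‖ ^ 2 * Real.exp (-φ z) < Real.exp (-1) := fun z hz => by
    rw [← hsq z hz]; exact hnorm.sq_lt _
  have hQ : ∀ β, ∀ w ∈ U, potential h s β (e₀.symm w) =
      Real.log (((1 - (‖σ w‖ ^ 2 * Real.exp (-φ w)) ^ β) / β) ^ 2) := by
    intro β w hw
    rw [potential, hsq w hw]
  have hOm : SmoothMat U (coeff kf.form e₀) := fun i j => (kf.smooth e₀ he₀a i j).mono hUt
  have hOmpos : ∀ z ∈ U, ∀ u, u ≠ 0 → 0 < sqNorm (coeff kf.form e₀ z) u :=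
    fun z hz u hu => kf.sqNorm_coeff_pos he₀a (hUt hz) hu
  have hhalf : ∀ β ∈ Set.Ioc (0 : ℝ) (1 / 2), ∀ z ∈ U, σ z ≠ 0 → ∀ u,
      (1 / 2) * sqNorm (coeff kf.form e₀ z) u ≤ sqNorm (conicMetric κ kf h s β e₀ z) u :=
    fun β hβ z hz hz0 => hnorm.half_le β hβ e₀ he₀a z (hUt hz) fun h0 => hz0 ((hzero z hz).1 h0)
  obtain ⟨V, hVU, oV, hpV, C, hC⟩ := exists_local_curvature_bound hκ oU hx₀U hOm hOmpos hσ hφ hlt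
    hi₀ (Q := fun β w => potential h s β (e₀.symm w)) hQ
    (by simpa only [conicMetric_eq] using hhalf)
  have hO : e₀.source ∩ e₀ ⁻¹' V ∈ nhds x₀ :=
    (e₀.isOpen_inter_preimage oV).mem_nhds ⟨hx₀, hpV⟩
  refine ⟨e₀.source ∩ e₀ ⁻¹' V, hO, C, fun β hβ e he z hz hzO hz0 u v hu hv => ?_⟩
  have hzs : z ∈ (e.symm.trans e₀).source := ⟨hz, hzO.1⟩
  have oW := isOpen_inter_ne_zero oU hσ.continuousOn
  have hpot : ContDiffOn ℝ ∞ (fun w => (potential h s β (e₀.symm w) : ℂ)) (U ∩ {z | σ z ≠ 0}) :=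
    smoothOn_local_potential oU hσ hφ
      (fun z hz => (hlt z hz).trans (Real.exp_lt_one_iff.2 (by norm_num))) hβ.1 (hQ β)
  have hzW : e₀ (e.symm z) ∈ U ∩ {z | σ z ≠ 0} := by
    refine ⟨hVU hzO.2, fun h0 => hz0 ?_⟩
    rwa [← hzero _ (hVU hzO.2), e₀.left_inv hzO.1] at h0
  have hψ := holomorphic_transition he he₀a
  have oT := hψ.continuousOn.isOpen_inter_preimage (e.symm.trans e₀).open_source oW
  have hg : SmoothMat (U ∩ {z | σ z ≠ 0}) (conicMetric κ kf h s β e₀) := by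
    have := smoothMat_sub_hessian oW Set.inter_subset_left hOm κ hpot
    simpa only [← conicMetric_eq] using this
  have htrans := conicMetric_transition κ kf h s β he he₀a hzs oW hzW hpot
  have hunit : IsUnit (conicMetric κ kf h s β e₀ (e₀ (e.symm z))).det := by
    refine isUnit_det_of_sqNorm_pos fun y hy => ?_
    have h1 := hhalf β hβ _ hzW.1 hzW.2 y
    have h2 := hOmpos _ hzW.1 y hy
    linarith
  rw [bisectional_comp oW oT (hψ.mono Set.inter_subset_left) (fun _ hw => hw.2) ⟨hzs, hzW⟩ hg
    (fun w hw => conicMetric_transition κ kf h s β he he₀a hw.1 oW hw.2 hpot) hunit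
    (isUnit_det_jacobian_transition he he₀a hzs)]
  rw [htrans, sqNorm_transition, conicMetric_eq] at hu hv
  have := hC β hβ _ hzO.2 hzW.2 _ _ hu hv
  simpa only [← conicMetric_eq] using this

end Global

end ConicMetric

theorem mainTheorem3 {n : ℕ} {X : Type*} [TopologicalSpace X] [ChartedSpace (Fin n → ℂ) X]
    [IsManifold 𝓘(ℂ, Fin n → ℂ) ω X] [CompactSpace X] [T2Space X]
    {L : X → Type*} [TopologicalSpace (Bundle.TotalSpace ℂ L)]
    [∀ x, TopologicalSpace (L x)] [∀ x, AddCommGroup (L x)] [∀ x, Module ℂ (L x)]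
    [FiberBundle ℂ L] [VectorBundle ℂ ℂ L] [ContMDiffVectorBundle ω ℂ L 𝓘(ℂ, Fin n → ℂ)]
    (s : ∀ x, L x) (hs : ConicMetric.CutsSmoothDivisor n s)
    (kf : ConicMetric.KahlerForm n X) (h : ConicMetric.HermitianMetric n L)
    (κ : ℝ) (hκ : 0 < κ) :
    (∃ c₀ > 0, ∀ c, ∀ hc : 0 < c, c ≤ c₀ →
      ConicMetric.IsNormalized κ kf (h.rescale c hc) s (Set.Ioo 0 1)) ∧
    (ConicMetric.IsNormalized κ kf h s (Set.Ioc 0 (1 / 2)) →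
      ∃ C > 0, ∀ β ∈ Set.Ioc (0 : ℝ) (1 / 2),
        ConicMetric.BisectionalBounded κ kf h s β C) := by
  refine ⟨?_, fun hnorm => ?_⟩
  · choose O hO c₀ hc₀ hloc using fun x => ConicMetric.exists_normalization_near hs kf h hκ x
    obtain ⟨t, ht⟩ := CompactSpace.elim_nhds_subcover O hO
    have hcov : ∀ x, ∃ y ∈ t, x ∈ O y := fun x => by
      have : x ∈ ⋃ y ∈ t, O y := by rw [ht]; trivial
      simpa using this
    -- A positive lower bound for finitely many $c_0(y)$ that also makes sense for an empty cover.
    have hle : ∀ y ∈ t, (1 + ∑ x ∈ t, (c₀ x)⁻¹)⁻¹ ≤ c₀ y := by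
      intro y hy
      have h1 : (c₀ y)⁻¹ ≤ ∑ x ∈ t, (c₀ x)⁻¹ :=
        Finset.single_le_sum (f := fun x => (c₀ x)⁻¹) (fun x _ => (inv_pos.2 (hc₀ x)).le) hy
      exact inv_le_of_inv_le₀ (hc₀ y) (by linarith)
    have hpos : 0 < 1 + ∑ x ∈ t, (c₀ x)⁻¹ :=
      add_pos_of_pos_of_nonneg one_pos (Finset.sum_nonneg fun x _ => (inv_pos.2 (hc₀ x)).le)
    refine ⟨_, inv_pos.2 hpos, fun c hc hcc => ⟨fun x => ?_, fun β hβ e he z hz hz0 u => ?_⟩⟩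
    · obtain ⟨y, hy, hxy⟩ := hcov x
      exact (hloc y c hc (hcc.trans (hle y hy))).1 x hxy
    · obtain ⟨y, hy, hxy⟩ := hcov (e.symm z)
      exact (hloc y c hc (hcc.trans (hle y hy))).2 β hβ.1 e he z hz hxy hz0 u
  · rcases Nat.eq_zero_or_pos n with rfl | hn
    -- In dimension $0$ there is no coordinate $z_{i_0}$ to twist by, but the curvature sum is
    -- empty.
    · exact ⟨1, one_pos, fun β _ e _ z _ _ u v _ _ => by simp [ConicMetric.bisectional]⟩
    choose O hO C hC using fun x =>
      ConicMetric.exists_bisectional_bound_near hs kf h hκ hn hnorm x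
    obtain ⟨t, ht⟩ := CompactSpace.elim_nhds_subcover O hO
    refine ⟨1 + ∑ x ∈ t, |C x|, add_pos_of_pos_of_nonneg one_pos
      (Finset.sum_nonneg fun x _ => abs_nonneg _), fun β hβ e he z hz hz0 u v hu hv => ?_⟩
    obtain ⟨y, hy, hxy⟩ : ∃ y ∈ t, e.symm z ∈ O y := by
      have : e.symm z ∈ ⋃ y ∈ t, O y := by rw [ht]; trivial
      simpa using this
    have h1 : |C y| ≤ ∑ x ∈ t, |C x| :=
      Finset.single_le_sum (f := fun x => |C x|) (fun x _ => abs_nonneg _) hy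
    have h2 := hC y β hβ e he z hz hxy hz0 u v hu hv
    have h3 := le_abs_self (C y)
    linarith
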